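/- Let $\sigma\ge 0$ and let $(X_N(i,j) : 1\le i\le j\le N,\ N\in\mathbb N)$ be a family of independent random variables on a probability space such that: for $i<j$ the entry $X_N(i,j)$ is complex-valued with $\mathbb E[X_N(i,j)]=0$ and $\mathbb E[|X_N(i,j)|^2]=\sigma^2$; the diagonal entries $X_N(i,i)$ are real-valued with finite variance; and $\sup_{1\le i\le j\le N,\,N\in\mathbb N}\mathbb E[|X_N(i,j)|^m]<\infty$ for every $m\in\mathbb N$. Put $X_N(j,i)=\overline{X_N(i,j)}$ for $i<j$. For band widths $b_N\in\mathbb N_0$ let $\xi_N=\min\{2b_N+1,N\}$, let $|i-j|_N=\min\{|i-j|,N-|i-j|\}$, and define the random Hermitian band matrix $$\Xi_N(i,j)=\frac{1}{\sqrt{\xi_N}}\,\mathbf 1\{|i-j|_N\le b_N\}\,X_N(i,j),\qquad 1\le i,j\le N.$$ Assume that $N^{\varepsilon}=o(\xi_N)$ as $N\to\infty$ for some $\varepsilon>0$. Fix $r\in\mathbb N$ and nonzero real numbers $\theta_1,\dots,\theta_r$ that do not depend on $N$, and for each $N\ge r$ let $a_N^{(1)},\dots,a_N^{(r)}\in\mathbb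 C^N$ be deterministic orthonormal vectors. Let $$M_N=\Xi_N+A_N,\qquad A_N=\sum_{s=1}^r\theta_s\,a_N^{(s)}\bigl(a_N^{(s)}\bigr)^*.$$ For a Hermitian matrix $H\in\mathbb C^{N\times N}$ with orthonormal eigenvectors $h^{(k)}$ and eigenvalues $\lambda_k$, and a unit vector $u\in\mathbb C^N$, let $\mu_H^{u}=\sum_{k=1}^N|\langle u,h^{(k)}\rangle|^2\,\delta_{\lambda_k}$ be the spectral measure of $H$ with respect to the vector state of $u$, i.e. the unique probability measure on $\mathbb R$ with $\int x^m\,\mu_H^u(dx)=\langle H^m u,u\rangle$ for all $m\in\mathbb N$. Then for every $s'\in\{1,\dots,r\}$, writing $\theta=\theta_{s'}$, $$\mu_{\theta}(dx)=\frac{\mathbf 1\{|x|\le 2\sigma\}}{2\pi}\,\frac{\sqrt{4\sigma^2-x^2}}{\theta^2+\sigma^2-\theta x}\,dx+\mathbf 1\{|\theta|>\sigma\}\Bigl(1-\frac{\sigma^2}{\theta^2}\Bigr)\delta_{\theta+\sigma^2/\theta}(dx)$$ is a probability measure on $\mathbb R$, and, almost surely, $\mu_{M_N}^{a_N^{(s')}}$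 converges weakly to $\mu_{\theta}$ as $N\to\infty$. -/

import Mathlib

open MeasureTheory ProbabilityTheory Filter Topology Asymptotics

noncomputable section

namespace SpikedBand

/-! ### Spectral measures of Hermitian matrices -/

/-- The vector state `A ↦ ⟨A u, u⟩` on `N × N` complex matrices (the inner product of Mathlib is
linear in its second argument). -/
def vectorState {N : ℕ} (u : EuclideanSpace ℂ (Fin N)) :
    Matrix (Fin N) (Fin N) ℂ →ₗ[ℂ] ℂ where
  toFun A := inner ℂ u (Matrix.toEuclideanLin A u)
  map_add' A B := by simp
  map_smul' c A := by simp

/-- `ν` is a spectral measure of `H` with respect to the linear functional `ψ`: a probability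
measure on `ℝ` whose moments all exist and are `∫ x ^ m dν = ψ (H ^ m)`. -/
structure IsSpectralMeasure {N : ℕ} (H : Matrix (Fin N) (Fin N) ℂ)
    (ψ : Matrix (Fin N) (Fin N) ℂ →ₗ[ℂ] ℂ) (ν : Measure ℝ) : Prop where
  isProbabilityMeasure : IsProbabilityMeasure ν
  integrable_pow : ∀ m : ℕ, Integrable (fun x : ℝ => x ^ m) ν
  moment_eq : ∀ m : ℕ, ((∫ x, x ^ m ∂ν : ℝ) : ℂ) = ψ (H ^ m)

/-- The measure `∑ k, |⟨u, h_k⟩|² δ_{λ_k}`, where `(λ_k, h_k)` is an orthonormal eigensystem of the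
Hermitian matrix `H`. For a unit vector `u` this is the unique spectral measure of `H` with respect
to the vector state of `u`; see `isSpectralMeasure_vectorSpectralMeasure` and
`eq_vectorSpectralMeasure`. -/
def vectorSpectralMeasure {N : ℕ} {H : Matrix (Fin N) (Fin N) ℂ} (hH : H.IsHermitian)
    (u : EuclideanSpace ℂ (Fin N)) : FiniteMeasure ℝ :=
  ⟨∑ k, ENNReal.ofReal (‖inner ℂ u (hH.eigenvectorBasis k)‖ ^ 2) •
      Measure.dirac (hH.eigenvalues k),
    ⟨by simp [ENNReal.sum_lt_top]⟩⟩

theorem integrable_vectorSpectralMeasure {N : ℕ} {H : Matrix (Fin N) (Fin N) ℂ}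
    (hH : H.IsHermitian) (u : EuclideanSpace ℂ (Fin N)) {f : ℝ → ℝ} :
    Integrable f (vectorSpectralMeasure hH u : Measure ℝ) := by
  simp only [vectorSpectralMeasure, FiniteMeasure.toMeasure_mk]
  rw [integrable_finsetSum_measure]
  intro k _
  exact (integrable_dirac (by simp)).smul_measure ENNReal.ofReal_ne_top

theorem integral_vectorSpectralMeasure {N : ℕ} {H : Matrix (Fin N) (Fin N) ℂ}
    (hH : H.IsHermitian) (u : EuclideanSpace ℂ (Fin N)) (f : ℝ → ℝ) :
    ∫ x, f x ∂(vectorSpectralMeasure hH u : Measure ℝ) =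
      ∑ k, ‖inner ℂ u (hH.eigenvectorBasis k)‖ ^ 2 * f (hH.eigenvalues k) := by
  simp only [vectorSpectralMeasure, FiniteMeasure.toMeasure_mk]
  rw [integral_finsetSum_measure]
  · refine Finset.sum_congr rfl fun k _ => ?_
    rw [integral_smul_measure, integral_dirac, ENNReal.toReal_ofReal (by positivity), smul_eq_mul]
  · intro k _
    exact (integrable_dirac (by simp)).smul_measure ENNReal.ofReal_ne_top

theorem toEuclideanLin_pow_eigenvectorBasis {N : ℕ} {H : Matrix (Fin N) (Fin N) ℂ}
    (hH : H.IsHermitian) (m : ℕ) (k : Fin N) :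
    Matrix.toEuclideanLin (H ^ m) (hH.eigenvectorBasis k) =
      ((hH.eigenvalues k ^ m : ℝ) : ℂ) • hH.eigenvectorBasis k := by
  induction m with
  | zero => simp
  | succ m ih =>
    have h1 : Matrix.toEuclideanLin H (hH.eigenvectorBasis k) =
        (hH.eigenvalues k : ℂ) • hH.eigenvectorBasis k := by
      ext i
      have := congrFun (hH.mulVec_eigenvectorBasis k) i
      simpa [Matrix.toLpLin_apply] using this
    have h2 : Matrix.toEuclideanLin (H ^ (m + 1)) (hH.eigenvectorBasis k) =
        Matrix.toEuclideanLin (H ^ m) (Matrix.toEuclideanLin H (hH.eigenvectorBasis k)) := by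
      rw [pow_succ]
      simp [Matrix.toLpLin_apply]
    rw [h2, h1, map_smul, ih, smul_smul, pow_succ]
    congr 1
    push_cast
    ring

theorem isSpectralMeasure_vectorSpectralMeasure {N : ℕ} {H : Matrix (Fin N) (Fin N) ℂ}
    (hH : H.IsHermitian) (u : EuclideanSpace ℂ (Fin N)) (hu : ‖u‖ = 1) :
    IsSpectralMeasure H (vectorState u) (vectorSpectralMeasure hH u : Measure ℝ) := by
  have hm : ∀ m : ℕ, ((∫ x, x ^ m ∂(vectorSpectralMeasure hH u : Measure ℝ) : ℝ) : ℂ) =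
      vectorState u (H ^ m) := by
    intro m
    rw [integral_vectorSpectralMeasure]
    change _ = inner ℂ u (Matrix.toEuclideanLin (H ^ m) u)
    conv_rhs => rw [← hH.eigenvectorBasis.sum_repr' u]
    rw [map_sum, inner_sum]
    push_cast
    refine Finset.sum_congr rfl fun k _ => ?_
    rw [map_smul, toEuclideanLin_pow_eigenvectorBasis, inner_smul_right, inner_smul_right,
      hH.eigenvectorBasis.sum_repr' u, ← inner_conj_symm (hH.eigenvectorBasis k) u]
    have := Complex.conj_mul' (inner ℂ u (hH.eigenvectorBasis k))
    rw [← this]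
    push_cast
    ring
  refine ⟨⟨?_⟩, fun m => integrable_vectorSpectralMeasure hH u, hm⟩
  have h0 := hm 0
  have h1 : vectorState u (H ^ 0) = 1 := by
    change inner ℂ u (Matrix.toEuclideanLin (H ^ 0) u) = 1
    simp [inner_self_eq_norm_sq_to_K, hu]
  rw [h1] at h0
  simp only [pow_zero, integral_const, smul_eq_mul, mul_one] at h0
  have h2 : (vectorSpectralMeasure hH u : Measure ℝ).real Set.univ = 1 := by exact_mod_cast h0
  rwa [Measure.real, ENNReal.toReal_eq_one_iff] at h2

theorem eq_vectorSpectralMeasure {N : ℕ} {H : Matrix (Fin N) (Fin N) ℂ}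
    (hH : H.IsHermitian) (u : EuclideanSpace ℂ (Fin N)) (hu : ‖u‖ = 1) {ν : Measure ℝ}
    (hν : IsSpectralMeasure H (vectorState u) ν) :
    ν = (vectorSpectralMeasure hH u : Measure ℝ) := by
  have := hν.isProbabilityMeasure
  have hρ := isSpectralMeasure_vectorSpectralMeasure hH u hu
  have hint : ∀ p : Polynomial ℝ, Integrable (fun x => p.eval x) ν := by
    intro p
    simp only [Polynomial.eval_eq_sum_range]
    exact integrable_finsetSum _ fun i _ => (hν.integrable_pow i).const_mul _
  have hpoly : ∀ p : Polynomial ℝ, ∫ x, p.eval x ∂ν =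
      ∫ x, p.eval x ∂(vectorSpectralMeasure hH u : Measure ℝ) := by
    intro p
    simp only [Polynomial.eval_eq_sum_range]
    rw [integral_finsetSum _ fun i _ => (hν.integrable_pow i).const_mul _,
      integral_finsetSum _ fun i _ => (hρ.integrable_pow i).const_mul _]
    refine Finset.sum_congr rfl fun i _ => ?_
    rw [integral_const_mul, integral_const_mul]
    congr 1
    have := (hν.moment_eq i).trans (hρ.moment_eq i).symm
    exact_mod_cast this
  let S : Finset ℝ := Finset.univ.image hH.eigenvalues
  let q : Polynomial ℝ := (∏ s ∈ S, (Polynomial.X - Polynomial.C s)) ^ 2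
  have hq : ∫ x, q.eval x ∂ν = 0 := by
    rw [hpoly, integral_vectorSpectralMeasure]
    refine Finset.sum_eq_zero fun k _ => ?_
    have : q.eval (hH.eigenvalues k) = 0 := by
      simp only [q, Polynomial.eval_pow, Polynomial.eval_prod, Polynomial.eval_sub,
        Polynomial.eval_X, Polynomial.eval_C]
      rw [Finset.prod_eq_zero (i := hH.eigenvalues k) (by simp [S]) (sub_self _)]
      simp
    rw [this, mul_zero]
  have hS : ∀ᵐ x ∂ν, x ∈ S := by
    rw [integral_eq_zero_iff_of_nonneg (fun x => by simp [q, sq_nonneg]) (hint q)] at hq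
    filter_upwards [hq] with x hx
    simp only [q, Polynomial.eval_pow, Polynomial.eval_prod, Polynomial.eval_sub,
      Polynomial.eval_X, Polynomial.eval_C, Pi.zero_apply, ne_eq, OfNat.ofNat_ne_zero,
      not_false_eq_true, pow_eq_zero_iff, Finset.prod_eq_zero_iff] at hx
    obtain ⟨s, hs, h⟩ := hx
    rwa [sub_eq_zero.mp h]
  refine ext_of_forall_integral_eq_of_IsFiniteMeasure fun f => ?_
  let p : Polynomial ℝ := Lagrange.interpolate S id f
  have hp : ∀ x ∈ S, p.eval x = f x := fun x hx =>
    Lagrange.eval_interpolate_at_node (v := id) f (Set.injOn_id _) hx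
  calc ∫ x, f x ∂ν = ∫ x, p.eval x ∂ν :=
        integral_congr_ae (hS.mono fun x hx => (hp x hx).symm)
    _ = ∫ x, p.eval x ∂(vectorSpectralMeasure hH u : Measure ℝ) := hpoly p
    _ = ∫ x, f x ∂(vectorSpectralMeasure hH u : Measure ℝ) := by
        rw [integral_vectorSpectralMeasure, integral_vectorSpectralMeasure]
        exact Finset.sum_congr rfl fun k _ => by rw [hp _ (by simp [S])]

/-! ### Random band matrices -/

/-- The pairs `(i, j)` with `i ≤ j` in `{0, …, N - 1}`, over all `N`. -/
abbrev UpperIndex : Type := Σ N : ℕ, {p : Fin N × Fin N // p.1 ≤ p.2}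

/-- The entries `X N i j` (`i ≤ j`) of a sequence of (unnormalized) Wigner matrices of variance
`σ ^ 2`. Nothing is assumed about `X N i j` for `j < i`. -/
structure IsWignerFamily {Ω : Type*} [MeasurableSpace Ω] (P : Measure Ω) (σ : ℝ)
    (X : (N : ℕ) → Fin N → Fin N → Ω → ℂ) : Prop where
  measurable : ∀ (N : ℕ) (i j : Fin N), i ≤ j → Measurable (X N i j)
  indep : iIndepFun (fun k : UpperIndex => X k.1 k.2.1.1 k.2.1.2) P
  centered : ∀ (N : ℕ) (i j : Fin N), i < j → ∫ ω, X N i j ω ∂P = 0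
  variance : ∀ (N : ℕ) (i j : Fin N), i < j → ∫ ω, ‖X N i j ω‖ ^ 2 ∂P = σ ^ 2
  diagonal_real : ∀ (N : ℕ) (i : Fin N) (ω : Ω), (X N i i ω).im = 0
  diagonal_memLp : ∀ (N : ℕ) (i : Fin N), MemLp (X N i i) 2 P
  moments : ∀ m : ℕ, ∃ C : NNReal, ∀ (N : ℕ) (i j : Fin N), i ≤ j →
    ∫⁻ ω, ‖X N i j ω‖ₑ ^ m ∂P ≤ C

/-- The matrix with entries `x i j` on and above the diagonal and `conj (x j i)` below it. -/
def hermitianCompletion {N : ℕ} (x : Fin N → Fin N → ℂ) : Matrix (Fin N) (Fin N) ℂ :=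
  Matrix.of fun i j => if i ≤ j then x i j else star (x j i)

/-- `ξ_N = min (2 b_N + 1) N`. -/
def bandSize (b : ℕ → ℕ) (N : ℕ) : ℕ := min (2 * b N + 1) N

/-- The `N`-periodic distance `min |i - j| (N - |i - j|)`. -/
def periodicDist {N : ℕ} (i j : Fin N) : ℕ :=
  min (Nat.dist i j) (N - Nat.dist i j)

/-- The periodic `(0, 1)`-band matrix of band width `w`. -/
def bandMatrix (N w : ℕ) : Matrix (Fin N) (Fin N) ℂ :=
  Matrix.of fun i j => if periodicDist i j ≤ w then 1 else 0

/-- The normalized periodic random band matrix (at a fixed outcome)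
`ξ_N ^ (-1/2) • (B_N ∘ X_N)`, with `∘` the entrywise product. -/
def randomBandMatrix (b : ℕ → ℕ) (N : ℕ) (x : Fin N → Fin N → ℂ) : Matrix (Fin N) (Fin N) ℂ :=
  (((1 / √(bandSize b N : ℝ) : ℝ)) : ℂ) •
    Matrix.hadamard (bandMatrix N (b N)) (hermitianCompletion x)

/-- The perturbation `∑ s, θ_s a_s a_s^*`. -/
def spikeMatrix {N r : ℕ} (θ : Fin r → ℝ) (a : Fin r → EuclideanSpace ℂ (Fin N)) :
    Matrix (Fin N) (Fin N) ℂ :=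
  ∑ s, (θ s : ℂ) • Matrix.vecMulVec (a s).ofLp (star (a s).ofLp)

/-- The spiked random band matrix `M_N = Ξ_N + A_N` (at a fixed outcome). -/
def spikedMatrix {r : ℕ} (b : ℕ → ℕ) (N : ℕ) (x : Fin N → Fin N → ℂ) (θ : Fin r → ℝ)
    (a : Fin r → EuclideanSpace ℂ (Fin N)) : Matrix (Fin N) (Fin N) ℂ :=
  randomBandMatrix b N x + spikeMatrix θ a

theorem spikedMatrix_isHermitian {r : ℕ} (b : ℕ → ℕ) (N : ℕ) {x : Fin N → Fin N → ℂ}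
    (hx : ∀ i, (x i i).im = 0) (θ : Fin r → ℝ) (a : Fin r → EuclideanSpace ℂ (Fin N)) :
    (spikedMatrix b N x θ a).IsHermitian := by
  refine Matrix.IsHermitian.add ?_ ?_
  · ext i j
    have hd : periodicDist j i = periodicDist i j := by
      simp only [periodicDist, Nat.dist_comm]
    simp only [randomBandMatrix, bandMatrix, hermitianCompletion, Matrix.conjTranspose_apply,
      Matrix.smul_apply, Matrix.hadamard_apply, Matrix.of_apply, hd, smul_eq_mul, star_mul',
      RCLike.star_def, Complex.conj_ofReal]
    rcases lt_trichotomy i j with h | h | h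
    · simp [h.le, h.not_ge, apply_ite (starRingEnd ℂ)]
    · subst h
      simp [apply_ite (starRingEnd ℂ), Complex.conj_eq_iff_im.mpr (hx i)]
    · simp [h.le, h.not_ge, apply_ite (starRingEnd ℂ)]
  · ext i j
    simp only [spikeMatrix, Matrix.conjTranspose_apply, Matrix.sum_apply, Matrix.smul_apply,
      Matrix.vecMulVec_apply, star_sum]
    refine Finset.sum_congr rfl fun s _ => ?_
    simp [mul_comm]

theorem IsWignerFamily.isHermitian_spikedMatrix {Ω : Type*} [MeasurableSpace Ω] {P : Measure Ω}
    {σ : ℝ} {X : (N : ℕ) → Fin N → Fin N → Ω → ℂ} (hX : IsWignerFamily P σ X) {r : ℕ}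
    (b : ℕ → ℕ) (N : ℕ) (ω : Ω) (θ : Fin r → ℝ) (a : Fin r → EuclideanSpace ℂ (Fin N)) :
    (spikedMatrix b N (fun i j => X N i j ω) θ a).IsHermitian :=
  spikedMatrix_isHermitian b N (fun i => hX.diagonal_real N i ω) θ a

/-! ### The limiting measure -/

/-- The measure with density `√(4σ² - x²) / (2π (θ² + σ² - θ x))` on `[-2σ, 2σ]`, plus, if
`|θ| > σ`, an atom of mass `1 - σ² / θ²` at `θ + σ² / θ`. -/
def limitMeasure (σ θ : ℝ) : Measure ℝ :=
  (volume.restrict (Set.Icc (-(2 * σ)) (2 * σ))).withDensity (fun x =>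
      ENNReal.ofReal (√(4 * σ ^ 2 - x ^ 2) / (2 * Real.pi * (θ ^ 2 + σ ^ 2 - θ * x)))) +
    (if σ < |θ| then ENNReal.ofReal (1 - σ ^ 2 / θ ^ 2) • Measure.dirac (θ + σ ^ 2 / θ) else 0)

end SpikedBand

end

/-! The proof works with resolvents `G(z) = (H - z)⁻¹` at points `z = iη` high on the imaginary
axis, `η > 2(σ² + 1)`, where `‖G‖ ≤ 1` and every fixed-point argument is a contraction. The core is
an isotropic law for the band matrix: almost surely `⟨u, G(z) v⟩ - m ⟨u, v⟩ → 0` for deterministic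
`u`, `v` in the unit ball, where `m (z + σ² m) = -1`.

For the isotropic law the entries are truncated at `N ^ δ` with `N ^ (8δ) ≤ ξ_N`, recentered, and
the diagonal is dropped. This changes the matrix by `o(1)` in operator norm almost surely
(`IsWignerFamily.ae_tendsto_norm_sub`). What remains is a sum over the edges of a graph of degree
less than `ξ_N`, with independent, centered entries bounded by `K = 2 N ^ δ / √ξ_N`. Fluctuations:
the Efron–Stein inequality applied repeatedly to powers (`integral_norm_pow_le`), together with the
bound on the sum of squared effects of single-edge deletions (`IsBandEdges.sum_update_sq_le`), makes
a high moment summable in `N`. Expectation: in `H G = 1 + z G` each entry is expanded to second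
order against the resolvent with that entry deleted, which is independent of it. This gives a
self-consistent equation (`IsEdgeFamily.norm_self_consistent_le`). Since the diagonal of `G`
concentrates and every vertex carries total variance close to `σ²`, the equation becomes `⟨u, v⟩ +
(z + σ² m) E⟨u, G v⟩ ≈ 0`, with an error that the smallness of `m` absorbs
(`IsEdgeFamily.norm_expected_green_sub_le`).

The spikes enter through the resolvent identity `G_Ξ - G_M = G_Ξ A G_M`. Between spike vectors, the
isotropic law and orthonormality decouple the resulting finite linear system, leaving `⟨a_s, G_M
a_s⟩ (1 + θ_s m) → m` (`tendsto_green_spiked`). The limit `m / (1 + θ m)` is the Stieltjes transform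
of the limit measure (`integral_limitMeasure`). That computation substitutes `x = 2σ cos t`, which
turns both the density and the Cauchy kernel into Poisson-type kernels `1 + γ² - 2γ cos t`.

Finally, convergence of Stieltjes transforms at countably many points of the imaginary axis implies
weak convergence (`tendsto_of_stieltjes`): the functions `x ↦ (x - ic)⁻¹` generate a
point-separating star algebra whose elements are limits of linear combinations of `1` and these
functions, and the same transforms control the tails. -/

namespace SpikedBand

/-! ### Efron–Stein inequality and independence of a deleted coordinate. -/

section EfronStein

theorem integrable_of_norm_le {α E : Type*} [MeasurableSpace α] [NormedAddCommGroup E]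
    {μ : Measure α} [IsFiniteMeasure μ] {f : α → E} (hf : AEStronglyMeasurable f μ) {C : ℝ}
    (hC : ∀ x, ‖f x‖ ≤ C) : Integrable f μ :=
  Integrable.of_bound hf C (ae_of_all _ hC)

theorem integral_norm_sub_sq {α : Type*} [MeasurableSpace α] {μ : Measure α}
    [IsProbabilityMeasure μ] {f : α → ℂ} (hf : Measurable f) {C : ℝ} (hC : ∀ x, ‖f x‖ ≤ C) (c : ℂ) :
    ∫ x, ‖f x - c‖ ^ 2 ∂μ = ∫ x, ‖f x - ∫ y, f y ∂μ‖ ^ 2 ∂μ + ‖(∫ y, f y ∂μ) - c‖ ^ 2 := by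
  set a := ∫ y, f y ∂μ with ha
  have hint : Integrable f μ := integrable_of_norm_le hf.aestronglyMeasurable hC
  have hsq : Integrable (fun x => ‖f x - a‖ ^ 2) μ := by
    refine integrable_of_norm_le (C := (C + ‖a‖) ^ 2)
      (by fun_prop) fun x => ?_
    rw [Real.norm_of_nonneg (by positivity)]
    gcongr
    exact (norm_sub_le _ _).trans (by gcongr; exact hC x)
  have hin : Integrable (fun x => 2 * inner ℝ (a - c) (f x - a)) μ :=
    ((hint.sub (integrable_const a)).const_inner (𝕜 := ℝ) (a - c)).const_mul 2
  have h0 : ∫ x, 2 * inner ℝ (a - c) (f x - a) ∂μ = 0 := by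
    rw [integral_const_mul, integral_inner (𝕜 := ℝ) (f := fun x => f x - a)
      (hint.sub (integrable_const a)), integral_sub hint (integrable_const a)]
    simp [← ha]
  calc ∫ x, ‖f x - c‖ ^ 2 ∂μ
      = ∫ x, (‖f x - a‖ ^ 2 + 2 * inner ℝ (a - c) (f x - a)) + ‖a - c‖ ^ 2 ∂μ := by
        refine integral_congr_ae (ae_of_all _ fun x => ?_)
        have : f x - c = (f x - a) + (a - c) := by ring
        simp only
        rw [this, norm_add_sq_real, real_inner_comm]
    _ = _ := by
        rw [integral_add (f := fun x => ‖f x - a‖ ^ 2 + 2 * inner ℝ (a - c) (f x - a))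
          (hsq.add hin) (integrable_const _), integral_add hsq hin, h0]
        simp

theorem integral_norm_sub_integral_sq_le {α : Type*} [MeasurableSpace α] {μ : Measure α}
    [IsProbabilityMeasure μ] {f : α → ℂ} (hf : Measurable f) {C : ℝ} (hC : ∀ x, ‖f x‖ ≤ C) (c : ℂ) :
    ∫ x, ‖f x - ∫ y, f y ∂μ‖ ^ 2 ∂μ ≤ ∫ x, ‖f x - c‖ ^ 2 ∂μ := by
  rw [integral_norm_sub_sq hf hC c]
  exact le_add_of_nonneg_right (by positivity)

theorem norm_integral_sq_le {α : Type*} [MeasurableSpace α] {μ : Measure α}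
    [IsProbabilityMeasure μ] {f : α → ℂ} (hf : Measurable f) {C : ℝ} (hC : ∀ x, ‖f x‖ ≤ C) :
    ‖∫ y, f y ∂μ‖ ^ 2 ≤ ∫ x, ‖f x‖ ^ 2 ∂μ := by
  have := integral_norm_sub_sq (μ := μ) hf hC 0
  simp only [sub_zero] at this
  rw [this]
  exact le_add_of_nonneg_left (by positivity)

theorem integral_pi_succ {E : Type*} [NormedAddCommGroup E] [NormedSpace ℝ E] {n : ℕ}
    (μ : Fin (n + 1) → Measure ℂ) [∀ i, IsProbabilityMeasure (μ i)] {F : (Fin (n + 1) → ℂ) → E}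
    (hF : StronglyMeasurable F) {C : ℝ} (hC : ∀ y, ‖F y‖ ≤ C) (i : Fin (n + 1)) :
    ∫ y, F y ∂(Measure.pi μ) =
      ∫ y, ∫ x, F (i.insertNth x y) ∂(μ i) ∂(Measure.pi fun j => μ (i.succAbove j)) := by
  have h := (measurePreserving_piFinSuccAbove μ i).symm
  rw [← h.integral_comp' (g := F), integral_prod_symm]
  · rfl
  · refine integrable_of_norm_le (C := C) ?_ fun x => hC _
    exact (hF.comp_measurable (MeasurableEquiv.measurable _)).aestronglyMeasurable

theorem measurable_insertNth {n : ℕ} (i : Fin (n + 1)) :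
    Measurable fun p : ℂ × (Fin n → ℂ) => (i.insertNth p.1 p.2 : Fin (n + 1) → ℂ) :=
  (MeasurableEquiv.piFinSuccAbove (fun _ : Fin (n + 1) => ℂ) i).symm.measurable

/-- The Efron--Stein inequality, comparing with the function in which one coordinate is set to
zero. -/
theorem efronStein_pi (n : ℕ) (μ : Fin n → Measure ℂ) [∀ i, IsProbabilityMeasure (μ i)]
    {F : (Fin n → ℂ) → ℂ} (hF : Measurable F) {C : ℝ} (hC : ∀ y, ‖F y‖ ≤ C) :
    ∫ y, ‖F y - ∫ y', F y' ∂(Measure.pi μ)‖ ^ 2 ∂(Measure.pi μ) ≤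
      ∑ k, ∫ y, ‖F y - F (Function.update y k 0)‖ ^ 2 ∂(Measure.pi μ) := by
  induction n with
  | zero =>
    have : ∀ y, F y = F 0 := fun y => by rw [Subsingleton.elim y 0]
    simp [this]
  | succ n ih =>
    have hC0 : 0 ≤ C := (norm_nonneg _).trans (hC 0)
    set ν : Measure (Fin n → ℂ) := Measure.pi fun j => μ (Fin.succAbove 0 j) with hν
    have hfm : Measurable fun p : ℂ × (Fin n → ℂ) =>
        F (Fin.insertNth (α := fun _ => ℂ) 0 p.1 p.2) := hF.comp (measurable_insertNth 0)
    set f : ℂ → (Fin n → ℂ) → ℂ := fun x y => F (Fin.insertNth (α := fun _ => ℂ) 0 x y) with hf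
    have hfy : ∀ y, Measurable fun x => f x y := fun y => hfm.comp measurable_prodMk_right
    set g : (Fin n → ℂ) → ℂ := fun y => ∫ x, f x y ∂(μ 0) with hg
    have hgm : Measurable g := by
      have : StronglyMeasurable (Function.uncurry fun (y : Fin n → ℂ) (x : ℂ) => f x y) :=
        (hfm.comp measurable_swap).stronglyMeasurable
      exact this.integral_prod_right.measurable
    have hgC : ∀ y, ‖g y‖ ≤ C := fun y => by
      have := norm_integral_le_of_norm_le_const (μ := μ 0) (ae_of_all _ fun x => hC
        (Fin.insertNth (α := fun _ => ℂ) 0 x y))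
      rwa [probReal_univ, mul_one] at this
    have hm : ∫ y, F y ∂(Measure.pi μ) = ∫ y, g y ∂ν :=
      integral_pi_succ μ hF.stronglyMeasurable hC 0
    have hsm : ∀ G : (Fin (n + 1) → ℂ) → ℂ, Measurable G → StronglyMeasurable
        fun y => ‖F y - G y‖ ^ 2 := fun G hG => by
      apply Measurable.stronglyMeasurable; fun_prop
    have hbd : ∀ a b : ℂ, ‖a‖ ≤ C → ‖b‖ ≤ C → ‖‖a - b‖ ^ 2‖ ≤ (C + C) ^ 2 := fun a b ha hb => by
      rw [Real.norm_of_nonneg (by positivity)]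
      gcongr
      exact (norm_sub_le _ _).trans (add_le_add ha hb)
    have hmC : ‖∫ y, g y ∂ν‖ ≤ C := by
      have := norm_integral_le_of_norm_le_const (μ := ν) (ae_of_all _ hgC)
      simpa using this
    have hum : ∀ k, Measurable fun y : Fin (n + 1) → ℂ => Function.update y k (0 : ℂ) := fun k => by
      fun_prop
    have hum' : ∀ k, Measurable fun y : Fin n → ℂ => Function.update y k (0 : ℂ) := fun k => by
      fun_prop
    -- With the other coordinates frozen, the second moment splits into the variance in coordinate
    -- `0` and the deviation of the partial mean `g`. The variance is at most the mean square
    -- distance to any constant, here `f 0 y`.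
    have hsplit : ∀ y, ∫ x, ‖f x y - ∫ y, g y ∂ν‖ ^ 2 ∂(μ 0) ≤
        ∫ x, ‖f x y - f 0 y‖ ^ 2 ∂(μ 0) + ‖g y - ∫ y, g y ∂ν‖ ^ 2 := fun y => by
      rw [integral_norm_sub_sq (hfy y) (fun x => hC _)]
      exact add_le_add (integral_norm_sub_integral_sq_le (hfy y) (fun x => hC _) _) le_rfl
    have hint : ∀ G : ℂ → (Fin n → ℂ) → ℂ, (Measurable fun p : ℂ × (Fin n → ℂ) => G p.1 p.2) →
        (∀ x y, ‖G x y‖ ≤ C) → Integrable (fun y => ∫ x, ‖f x y - G x y‖ ^ 2 ∂(μ 0)) ν := by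
      intro G hG hGC
      have hm' : Measurable fun p : (Fin n → ℂ) × ℂ => ‖f p.2 p.1 - G p.2 p.1‖ ^ 2 :=
        ((hfm.comp measurable_swap).sub (hG.comp measurable_swap)).norm.pow_const 2
      refine integrable_of_norm_le (C := (C + C) ^ 2)
        hm'.stronglyMeasurable.integral_prod_right.aestronglyMeasurable fun y => ?_
      have := norm_integral_le_of_norm_le_const (μ := μ 0) (f := fun x => ‖f x y - G x y‖ ^ 2)
        (ae_of_all _ fun x => hbd (f x y) (G x y) (hC _) (hGC x y))
      simpa using this
    rw [hm, integral_pi_succ μ (hsm _ measurable_const) (fun y => hbd _ _ (hC y) hmC) 0,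
      Fin.sum_univ_succ]
    have hterm0 : ∫ y, ‖F y - F (Function.update y 0 0)‖ ^ 2 ∂(Measure.pi μ) =
        ∫ y, ∫ x, ‖f x y - f 0 y‖ ^ 2 ∂(μ 0) ∂ν := by
      rw [integral_pi_succ μ (hsm (fun y => F (Function.update y 0 0)) (hF.comp (hum 0)))
        (fun y => hbd _ _ (hC y) (hC _)) 0]
      simp only [hf, Fin.insertNth_zero', Fin.update_cons_zero, hν]
    have htermk : ∀ k : Fin n, ∫ y, ‖F y - F (Function.update y k.succ 0)‖ ^ 2 ∂(Measure.pi μ) =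
        ∫ y, ∫ x, ‖f x y - f x (Function.update y k 0)‖ ^ 2 ∂(μ 0) ∂ν := fun k => by
      rw [integral_pi_succ μ (hsm (fun y => F (Function.update y k.succ 0)) (hF.comp (hum _)))
        (fun y => hbd _ _ (hC y) (hC _)) 0]
      simp only [hf, Fin.insertNth_zero', Fin.cons_update, hν]
    rw [hterm0]
    simp only [htermk]
    have hf0 : Measurable fun p : ℂ × (Fin n → ℂ) => f 0 p.2 := by
      have := hfm.comp (show Measurable fun p : ℂ × (Fin n → ℂ) => ((0 : ℂ), p.2) by fun_prop)
      exact this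
    have hi1 := hint (fun _ y => f 0 y) hf0 (fun x y => hC _)
    have hi2 : Integrable (fun y => ‖g y - ∫ y, g y ∂ν‖ ^ 2) ν :=
      integrable_of_norm_le (C := (C + C) ^ 2) (by fun_prop) fun y => hbd _ _ (hgC y) hmC
    calc ∫ y, ∫ x, ‖F (Fin.insertNth 0 x y) - ∫ y, g y ∂ν‖ ^ 2 ∂(μ 0) ∂ν
        ≤ ∫ y, (∫ x, ‖f x y - f 0 y‖ ^ 2 ∂(μ 0) + ‖g y - ∫ y, g y ∂ν‖ ^ 2) ∂ν :=
          integral_mono (hint (fun _ _ => ∫ y, g y ∂ν) measurable_const (fun _ _ => hmC))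
            (hi1.add hi2) hsplit
      _ = ∫ y, ∫ x, ‖f x y - f 0 y‖ ^ 2 ∂(μ 0) ∂ν + ∫ y, ‖g y - ∫ y, g y ∂ν‖ ^ 2 ∂ν :=
          integral_add hi1 hi2
      _ ≤ _ := by
        gcongr
        refine (ih _ hgm hgC).trans (Finset.sum_le_sum fun k _ => ?_)
        have hfk : Measurable fun p : ℂ × (Fin n → ℂ) => f p.1 (Function.update p.2 k 0) :=
          hfm.comp (show Measurable fun p : ℂ × (Fin n → ℂ) => (p.1, Function.update p.2 k 0) from
            measurable_fst.prodMk ((hum' k).comp measurable_snd))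
        refine integral_mono (integrable_of_norm_le (C := (C + C) ^ 2)
          ((hgm.sub (hgm.comp (hum' k))).norm.pow_const 2).aestronglyMeasurable
            fun y => hbd _ _ (hgC y) (hgC _))
          (hint (fun x y => f x (Function.update y k 0)) hfk fun x y => hC _) fun y => ?_
        -- Jensen in the first coordinate passes from increments of `g` back to increments of `F`.
        have hfy' := (hfy y).sub (hfy (Function.update y k 0))
        have := norm_integral_sq_le (μ := μ 0) hfy' (C := C + C) fun x =>
          (norm_sub_le _ _).trans (add_le_add (hC _) (hC _))
        simp only [Pi.sub_apply] at this
        rwa [integral_sub (integrable_of_norm_le (hfy y).aestronglyMeasurable fun x => hC _)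
          (integrable_of_norm_le (hfy _).aestronglyMeasurable fun x => hC _)] at this

variable {Ω : Type*} [MeasurableSpace Ω] {P : Measure Ω} {n : ℕ}
  {h : Fin n → Ω → ℂ}

theorem efronStein [IsProbabilityMeasure P] (hm : ∀ k, Measurable (h k)) (hi : iIndepFun h P)
    {F : (Fin n → ℂ) → ℂ} (hF : Measurable F) {C : ℝ} (hC : ∀ y, ‖F y‖ ≤ C) :
    ∫ ω, ‖F (fun k => h k ω) - ∫ ω', F (fun k => h k ω') ∂P‖ ^ 2 ∂P ≤
      ∑ k, ∫ ω, ‖F (fun k => h k ω) - F (Function.update (fun k => h k ω) k 0)‖ ^ 2 ∂P := by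
  have hpi := (iIndepFun_iff_map_fun_eq_pi_map fun k => (hm k).aemeasurable).1 hi
  have hhm : Measurable fun ω => fun k => h k ω := measurable_pi_lambda _ hm
  have : ∀ k, IsProbabilityMeasure (P.map (h k)) := fun k =>
    Measure.isProbabilityMeasure_map (hm k).aemeasurable
  have key := efronStein_pi n (fun k => P.map (h k)) hF hC
  rw [← hpi] at key
  have hum : ∀ k, Measurable fun y : Fin n → ℂ => Function.update y k (0 : ℂ) := fun k => by
    fun_prop
  rw [integral_map hhm.aemeasurable hF.aestronglyMeasurable,
    integral_map hhm.aemeasurable (by fun_prop)] at key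
  refine key.trans (Finset.sum_le_sum fun k _ => ?_)
  rw [integral_map hhm.aemeasurable]
  exact ((hF.sub (hF.comp (hum k))).norm.pow_const 2).aestronglyMeasurable

/-- Once coordinate `k` is overwritten by `0`, `F` depends only on the other coordinates and so is
independent of `h k`. This is what lets expectations factor in the resolvent expansion. -/
theorem integral_mul_update (hm : ∀ k, Measurable (h k)) (hi : iIndepFun h P)
    {F : (Fin n → ℂ) → ℂ} (hF : Measurable F) {φ : ℂ → ℂ} (hφ : Measurable φ) (k : Fin n) :
    ∫ ω, φ (h k ω) * F (Function.update (fun k => h k ω) k 0) ∂P =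
      (∫ ω, φ (h k ω) ∂P) * ∫ ω, F (Function.update (fun k => h k ω) k 0) ∂P := by
  have hind := hi.indepFun_finset {k} (Finset.univ.erase k) (by simp) hm
  set ψ : ((Finset.erase Finset.univ k) → ℂ) → (Fin n → ℂ) := fun y j =>
    if hj : j ∈ Finset.univ.erase k then y ⟨j, hj⟩ else 0 with hψ
  have hψm : Measurable ψ := by
    refine measurable_pi_lambda _ fun j => ?_
    by_cases hj : j ∈ Finset.univ.erase k
    · simp only [hψ, hj, dite_true]; fun_prop
    · simp only [hψ, hj, dite_false]; fun_prop
  have hind2 := hind.comp (φ := fun y => φ (y ⟨k, Finset.mem_singleton_self k⟩)) (ψ := fun y => F (ψ y))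
    (by fun_prop) (hF.comp hψm)
  have hup : ∀ ω, ψ (fun j => h j ω) = Function.update (fun k => h k ω) k 0 := fun ω => by
    funext j
    by_cases hj : j = k
    · subst hj; simp [hψ]
    · simp [hψ, hj]
  have := hind2.integral_fun_mul_eq_mul_integral (𝕜 := ℂ)
    (by
      apply Measurable.aestronglyMeasurable
      exact hφ.comp (hm k))
    (by
      apply Measurable.aestronglyMeasurable
      exact (hF.comp hψm).comp (measurable_pi_lambda _ fun j => hm j))
  simpa only [Function.comp_def, hup] using this

end EfronStein

/-! ### High moments from iterated Efron–Stein. -/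

section MomentBound

variable {Ω : Type*} [MeasurableSpace Ω] {P : Measure Ω} {n : ℕ} {h : Fin n → Ω → ℂ}

/-- Cauchy–Schwarz, from the discriminant of the nonnegative quadratic `t ↦ ∫ (t f + g)²`. -/
theorem integral_mul_sq_le [IsFiniteMeasure P] {f g : Ω → ℝ} (hf : Measurable f)
    (hg : Measurable g) {C D : ℝ} (hC : ∀ ω, ‖f ω‖ ≤ C) (hD : ∀ ω, ‖g ω‖ ≤ D) :
    (∫ ω, f ω * g ω ∂P) ^ 2 ≤ (∫ ω, f ω ^ 2 ∂P) * ∫ ω, g ω ^ 2 ∂P := by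
  have i1 : Integrable (fun ω => f ω ^ 2) P :=
    integrable_of_norm_le (C := C ^ 2) (by fun_prop) fun ω => by
      rw [norm_pow]; exact pow_le_pow_left₀ (norm_nonneg _) (hC ω) 2
  have i2 : Integrable (fun ω => g ω ^ 2) P :=
    integrable_of_norm_le (C := D ^ 2) (by fun_prop) fun ω => by
      rw [norm_pow]; exact pow_le_pow_left₀ (norm_nonneg _) (hD ω) 2
  have i3 : Integrable (fun ω => f ω * g ω) P :=
    integrable_of_norm_le (C := C * D) (by fun_prop) fun ω => by
      rw [norm_mul]
      exact mul_le_mul (hC ω) (hD ω) (norm_nonneg _) ((norm_nonneg _).trans (hC ω))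
  have key : ∀ t : ℝ, 0 ≤ (∫ ω, f ω ^ 2 ∂P) * (t * t) + (2 * ∫ ω, f ω * g ω ∂P) * t +
      ∫ ω, g ω ^ 2 ∂P := fun t => by
    have h0 : 0 ≤ ∫ ω, (t * f ω + g ω) ^ 2 ∂P := integral_nonneg fun ω => sq_nonneg _
    have h1 : ∫ ω, (t * f ω + g ω) ^ 2 ∂P =
        ∫ ω, ((t * t) * f ω ^ 2 + (2 * t) * (f ω * g ω)) + g ω ^ 2 ∂P := by
      congr 1; funext ω; ring
    rw [h1, integral_add (f := fun ω => (t * t) * f ω ^ 2 + (2 * t) * (f ω * g ω))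
      ((i1.const_mul _).add (i3.const_mul _)) i2, integral_add (i1.const_mul _) (i3.const_mul _),
      integral_const_mul, integral_const_mul] at h0
    linarith
  have := discrim_le_zero key
  rw [discrim] at this
  linarith

/-- The right-hand side involves `b` only through `a - b`. With `b` the value after deleting a
coordinate, the factor `(‖a‖ + d) ^ p` is therefore common to all coordinates and can be pulled out
of the Efron–Stein sum. -/
theorem norm_pow_succ_sub_pow_succ_le (a b : ℂ) {d : ℝ} (hd : ‖a - b‖ ≤ d) (p : ℕ) :
    ‖a ^ (p + 1) - b ^ (p + 1)‖ ≤ (p + 1) * ‖a - b‖ * (‖a‖ + d) ^ p := by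
  have hd0 : 0 ≤ d := (norm_nonneg _).trans hd
  have hb : ‖b‖ ≤ ‖a‖ + d := by
    have : b = a - (a - b) := by ring
    calc ‖b‖ = ‖a - (a - b)‖ := by rw [← this]
      _ ≤ ‖a‖ + ‖a - b‖ := norm_sub_le _ _
      _ ≤ _ := by gcongr
  induction p with
  | zero => simp
  | succ p ih =>
    have e : a ^ (p + 1 + 1) - b ^ (p + 1 + 1) =
        (a - b) * a ^ (p + 1) + b * (a ^ (p + 1) - b ^ (p + 1)) := by ring
    calc ‖a ^ (p + 1 + 1) - b ^ (p + 1 + 1)‖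
        ≤ ‖a - b‖ * ‖a‖ ^ (p + 1) + ‖b‖ * ‖a ^ (p + 1) - b ^ (p + 1)‖ := by
          rw [e]
          refine (norm_add_le _ _).trans ?_
          rw [norm_mul, norm_mul, norm_pow]
      _ ≤ ‖a - b‖ * (‖a‖ + d) ^ (p + 1) +
          (‖a‖ + d) * ((p + 1) * ‖a - b‖ * (‖a‖ + d) ^ p) := by
          gcongr
          linarith
      _ = _ := by push_cast; ring

/-- The constants in the moment bound obtained by iterating the Efron--Stein inequality. -/
noncomputable def momentConst : ℕ → ℝ
  | 0 => 1
  | p + 1 => momentConst p + (p + 1) ^ 2 * 4 ^ p * (momentConst p + 1)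

theorem momentConst_nonneg (p : ℕ) : 0 ≤ momentConst p := by
  induction p with
  | zero => simp [momentConst]
  | succ p ih => rw [momentConst]; positivity

/-- Induction on `p`, with `Y` the centered variable. Efron–Stein for `Y ^ (p + 1)` bounds its
variance by a multiple of `Q (E|Y|^(2p) + Q^p)`. Its squared mean is at most `E|Y|^(2p) · E|Y|²` by
Cauchy–Schwarz, and `E|Y|² ≤ Q` is Efron–Stein itself. -/
theorem integral_norm_pow_le [IsProbabilityMeasure P] (hm : ∀ k, Measurable (h k))
    (hi : iIndepFun h P) {F : (Fin n → ℂ) → ℂ} (hF : Measurable F) {C : ℝ} (hC : ∀ y, ‖F y‖ ≤ C)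
    {Q : ℝ}
    (hQ : ∀ ω, ∑ k, ‖F (fun k => h k ω) - F (Function.update (fun k => h k ω) k 0)‖ ^ 2 ≤ Q)
    (p : ℕ) :
    ∫ ω, ‖F (fun k => h k ω) - ∫ ω', F (fun k => h k ω') ∂P‖ ^ (2 * p) ∂P ≤
      momentConst p * Q ^ p := by
  set m := ∫ ω', F (fun k => h k ω') ∂P with hmdef
  have hhm : Measurable fun ω => fun k => h k ω := measurable_pi_lambda _ hm
  have hum : ∀ k, Measurable fun y : Fin n → ℂ => Function.update y k (0 : ℂ) := fun k => by
    fun_prop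
  obtain ⟨ω₀⟩ : Nonempty Ω := P.nonempty_of_neZero
  have hQ0 : 0 ≤ Q := (Finset.sum_nonneg fun k _ => by positivity).trans (hQ ω₀)
  have hC0 : 0 ≤ C := (norm_nonneg _).trans (hC 0)
  set Y : (Fin n → ℂ) → ℂ := fun y => F y - m with hY
  have hYm : Measurable Y := by fun_prop
  set D := C + ‖m‖ with hD
  have hD0 : 0 ≤ D := by positivity
  have hYD : ∀ y, ‖Y y‖ ≤ D := fun y => (norm_sub_le _ _).trans (add_le_add (hC y) le_rfl)
  have hYint : ∫ ω, Y (fun k => h k ω) ∂P = 0 := by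
    simp only [hY]
    rw [integral_sub (f := fun ω => F fun k => h k ω)
      (integrable_of_norm_le (hF.comp hhm).aestronglyMeasurable fun _ => hC _)
      (integrable_const _)]
    simp [← hmdef]
  have hpowint : ∀ q : ℕ, Integrable (fun ω => ‖Y (fun k => h k ω)‖ ^ q) P := fun q => by
    refine integrable_of_norm_le (C := D ^ q)
      ((hYm.comp hhm).norm.pow_const q).aestronglyMeasurable fun ω => ?_
    rw [norm_pow, norm_norm]
    gcongr
    exact hYD _
  have hES : ∀ q : ℕ, ∫ ω, ‖Y (fun k => h k ω) ^ (q + 1)‖ ^ 2 ∂P ≤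
      (((q : ℝ) + 1) ^ 2 * 4 ^ q * Q) * ((∫ ω, ‖Y (fun k => h k ω)‖ ^ (2 * q) ∂P) + Q ^ q) +
        ‖∫ ω, Y (fun k => h k ω) ^ (q + 1) ∂P‖ ^ 2 := by
    intro q
    have hZm : Measurable fun y => Y y ^ (q + 1) := hYm.pow_const _
    have hZC : ∀ y, ‖Y y ^ (q + 1)‖ ≤ D ^ (q + 1) := fun y => by
      rw [norm_pow]; gcongr; exact hYD y
    have e := integral_norm_sub_sq (μ := P) (hZm.comp hhm) (fun ω => hZC _) 0
    simp only [sub_zero, Function.comp_def] at e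
    rw [e]
    gcongr
    refine (efronStein hm hi hZm hZC).trans ?_
    have hterm : ∀ k : Fin n, Integrable (fun ω => ‖Y (fun k => h k ω) ^ (q + 1) -
        Y (Function.update (fun k => h k ω) k 0) ^ (q + 1)‖ ^ 2) P := fun k => by
      refine integrable_of_norm_le (C := (D ^ (q + 1) + D ^ (q + 1)) ^ 2)
        (((hZm.comp hhm).sub (hZm.comp ((hum k).comp hhm))).norm.pow_const 2).aestronglyMeasurable
        fun ω => ?_
      rw [norm_pow, norm_norm]
      gcongr
      exact (norm_sub_le _ _).trans (add_le_add (hZC _) (hZC _))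
    have hconst : (∫ ω, ‖Y (fun k => h k ω)‖ ^ (2 * q) ∂P) + Q ^ q =
        ∫ ω, (‖Y (fun k => h k ω)‖ ^ (2 * q) + Q ^ q) ∂P := by
      rw [integral_add (hpowint _) (integrable_const _)]
      simp
    rw [← integral_finsetSum _ fun k _ => hterm k, hconst, ← integral_const_mul]
    refine integral_mono (integrable_finsetSum _ fun k _ => hterm k)
      (((hpowint _).add (integrable_const _)).const_mul _) fun ω => ?_
    set y := fun k => h k ω
    have hdk : ∀ k, ‖Y y - Y (Function.update y k 0)‖ ^ 2 ≤ Q := fun k => by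
      refine le_trans ?_ (hQ ω)
      simp only [hY, sub_sub_sub_cancel_right]
      exact Finset.single_le_sum (f := fun k => ‖F y - F (Function.update y k 0)‖ ^ 2)
        (fun k _ => by positivity) (Finset.mem_univ k)
    have hpow : (‖Y y‖ + √Q) ^ (2 * q) ≤ 4 ^ q * (‖Y y‖ ^ (2 * q) + Q ^ q) := by
      have h1 := add_pow_le (norm_nonneg (Y y)) (Real.sqrt_nonneg Q) (2 * q)
      have h2 : √Q ^ (2 * q) = Q ^ q := by rw [pow_mul, Real.sq_sqrt hQ0]
      rw [h2] at h1
      refine h1.trans ?_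
      gcongr
      calc (2 : ℝ) ^ (2 * q - 1) ≤ 2 ^ (2 * q) := pow_le_pow_right₀ (by norm_num) (by omega)
        _ = 4 ^ q := by rw [pow_mul]; norm_num
    calc ∑ k, ‖Y y ^ (q + 1) - Y (Function.update y k 0) ^ (q + 1)‖ ^ 2
        ≤ ∑ k, ((q : ℝ) + 1) ^ 2 * (‖Y y‖ + √Q) ^ (2 * q) *
            ‖F y - F (Function.update y k 0)‖ ^ 2 := by
          refine Finset.sum_le_sum fun k _ => ?_
          have h1 := norm_pow_succ_sub_pow_succ_le (Y y) (Y (Function.update y k 0))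
            (Real.le_sqrt_of_sq_le (hdk k)) q
          have h2 := pow_le_pow_left₀ (norm_nonneg _) h1 2
          refine h2.trans (le_of_eq ?_)
          simp only [hY, sub_sub_sub_cancel_right]
          ring
      _ = ((q : ℝ) + 1) ^ 2 * (‖Y y‖ + √Q) ^ (2 * q) *
            ∑ k, ‖F y - F (Function.update y k 0)‖ ^ 2 := by rw [Finset.mul_sum]
      _ ≤ ((q : ℝ) + 1) ^ 2 * (4 ^ q * (‖Y y‖ ^ (2 * q) + Q ^ q)) * Q := by
          gcongr
          exact hQ ω
      _ = _ := by ring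
  have hsq : ∀ q : ℕ, ∀ ω, ‖Y (fun k => h k ω) ^ q‖ ^ 2 = ‖Y (fun k => h k ω)‖ ^ (2 * q) :=
    fun q ω => by rw [norm_pow, ← pow_mul, mul_comm]
  have hone : ∫ ω, ‖Y (fun k => h k ω)‖ ^ 2 ∂P ≤ Q := by
    refine (efronStein hm hi hF hC).trans ?_
    rw [← integral_finsetSum]
    · have := integral_mono_of_nonneg (μ := P) (ae_of_all _ fun ω =>
        Finset.sum_nonneg fun k _ => sq_nonneg ‖F (fun k => h k ω) -
          F (Function.update (fun k => h k ω) k 0)‖) (integrable_const Q) (ae_of_all _ hQ)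
      simpa using this
    · intro k _
      refine integrable_of_norm_le (C := (C + C) ^ 2)
        (((hF.comp hhm).sub (hF.comp ((hum k).comp hhm))).norm.pow_const 2).aestronglyMeasurable
        fun ω => ?_
      rw [norm_pow, norm_norm]
      gcongr
      exact (norm_sub_le _ _).trans (add_le_add (hC _) (hC _))
  change ∫ ω, ‖Y (fun k => h k ω)‖ ^ (2 * p) ∂P ≤ _
  induction p with
  | zero => simp [momentConst]
  | succ p ih =>
    rw [momentConst]
    have h1 := hES p
    simp only [hsq] at h1
    refine h1.trans ?_
    have hmean : ‖∫ ω, Y (fun k => h k ω) ^ (p + 1) ∂P‖ ^ 2 ≤ momentConst p * Q ^ (p + 1) := by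
      -- For `p = 0` the mean is that of `Y` itself, which vanishes.
      rcases Nat.eq_zero_or_pos p with rfl | hp
      · simp only [zero_add, pow_one, hYint]
        simp [momentConst, hQ0]
      · have h2 : ‖∫ ω, Y (fun k => h k ω) ^ (p + 1) ∂P‖ ≤
            ∫ ω, ‖Y (fun k => h k ω)‖ ^ p * ‖Y (fun k => h k ω)‖ ∂P := by
          refine (norm_integral_le_integral_norm _).trans (le_of_eq ?_)
          congr 1; funext ω; rw [norm_pow, pow_succ]
        have h3 := integral_mul_sq_le (P := P) (f := fun ω => ‖Y (fun k => h k ω)‖ ^ p)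
          (g := fun ω => ‖Y (fun k => h k ω)‖) ((hYm.comp hhm).norm.pow_const p)
          (hYm.comp hhm).norm (C := D ^ p) (D := D)
          (fun ω => by rw [norm_pow, norm_norm]; gcongr; exact hYD _)
          (fun ω => by rw [norm_norm]; exact hYD _)
        refine (pow_le_pow_left₀ (norm_nonneg _) h2 2).trans (h3.trans ?_)
        have h4 : ∫ ω, (‖Y (fun k => h k ω)‖ ^ p) ^ 2 ∂P ≤ momentConst p * Q ^ p := by
          simpa only [← pow_mul, mul_comm p 2] using ih
        calc _ ≤ (momentConst p * Q ^ p) * Q := by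
              gcongr
              exact mul_nonneg (momentConst_nonneg p) (by positivity)
          _ = _ := by ring
    calc _ ≤ (((p : ℝ) + 1) ^ 2 * 4 ^ p * Q) * (momentConst p * Q ^ p + Q ^ p) +
          momentConst p * Q ^ (p + 1) := by gcongr
      _ = _ := by ring

end MomentBound

/-! ### Resolvents of Hermitian matrices in operator norm, and matrices built from edges. -/

section Green

open scoped Matrix Matrix.Norms.L2Operator

variable {N : ℕ}

theorem sum_norm_mulVec_sq_le (A : Matrix (Fin N) (Fin N) ℂ) (v : Fin N → ℂ) :
    ∑ i, ‖(A *ᵥ v) i‖ ^ 2 ≤ ‖A‖ ^ 2 * ∑ i, ‖v i‖ ^ 2 := by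
  have h := Matrix.l2_opNorm_mulVec A (WithLp.toLp 2 v)
  have h2 := pow_le_pow_left₀ (norm_nonneg _) h 2
  rw [mul_pow, EuclideanSpace.norm_sq_eq, EuclideanSpace.norm_sq_eq] at h2
  exact h2

theorem norm_star_dotProduct_sq_le (u v : Fin N → ℂ) :
    ‖star u ⬝ᵥ v‖ ^ 2 ≤ (∑ i, ‖u i‖ ^ 2) * ∑ i, ‖v i‖ ^ 2 := by
  have h := norm_inner_le_norm (𝕜 := ℂ) (WithLp.toLp 2 u) (WithLp.toLp 2 v)
  have h2 := pow_le_pow_left₀ (norm_nonneg _) h 2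
  rw [mul_pow, EuclideanSpace.norm_sq_eq, EuclideanSpace.norm_sq_eq] at h2
  rwa [EuclideanSpace.inner_eq_star_dotProduct, dotProduct_comm] at h2

theorem norm_star_dotProduct_mulVec_le (A : Matrix (Fin N) (Fin N) ℂ) {u v : Fin N → ℂ}
    (hu : ∑ i, ‖u i‖ ^ 2 ≤ 1) (hv : ∑ i, ‖v i‖ ^ 2 ≤ 1) : ‖star u ⬝ᵥ A *ᵥ v‖ ≤ ‖A‖ := by
  refine (sq_le_sq₀ (norm_nonneg _) (norm_nonneg _)).1 ?_
  calc _ ≤ (∑ i, ‖u i‖ ^ 2) * ∑ i, ‖(A *ᵥ v) i‖ ^ 2 := norm_star_dotProduct_sq_le _ _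
    _ ≤ 1 * (‖A‖ ^ 2 * 1) := by
        gcongr
        exact (sum_norm_mulVec_sq_le A v).trans (by gcongr)
    _ = ‖A‖ ^ 2 := by ring

theorem sum_norm_single_sq (j : Fin N) : ∑ i, ‖(Pi.single j (1 : ℂ) : Fin N → ℂ) i‖ ^ 2 = 1 := by
  simp [Pi.single_apply, apply_ite (norm : ℂ → ℝ), ite_pow]

theorem sum_norm_col_sq_le (A : Matrix (Fin N) (Fin N) ℂ) (j : Fin N) :
    ∑ i, ‖A i j‖ ^ 2 ≤ ‖A‖ ^ 2 := by
  have := sum_norm_mulVec_sq_le A (Pi.single j 1)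
  rw [sum_norm_single_sq, mul_one] at this
  simpa using this

theorem norm_entry_le (A : Matrix (Fin N) (Fin N) ℂ) (i j : Fin N) : ‖A i j‖ ≤ ‖A‖ := by
  refine (sq_le_sq₀ (norm_nonneg _) (norm_nonneg _)).1 ((Finset.single_le_sum (f := fun i => ‖A i j‖ ^ 2)
    (fun _ _ => by positivity) (Finset.mem_univ i)).trans (sum_norm_col_sq_le A j))

theorem norm_le_of_sum_sq_le {A : Matrix (Fin N) (Fin N) ℂ} {c : ℝ} (hc : 0 ≤ c)
    (h : ∀ v : Fin N → ℂ, ∑ i, ‖(A *ᵥ v) i‖ ^ 2 ≤ c ^ 2 * ∑ i, ‖v i‖ ^ 2) : ‖A‖ ≤ c := by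
  rw [Matrix.cstar_norm_def]
  refine ContinuousLinearMap.opNorm_le_bound _ hc fun x => ?_
  refine (sq_le_sq₀ (norm_nonneg _) (by positivity)).1 ?_
  rw [mul_pow, EuclideanSpace.norm_sq_eq, EuclideanSpace.norm_sq_eq]
  exact h x.ofLp

/-- The resolvent `(H - z)⁻¹`. -/
noncomputable def green (H : Matrix (Fin N) (Fin N) ℂ) (z : ℂ) : Matrix (Fin N) (Fin N) ℂ :=
  (H - z • 1)⁻¹

theorem star_dotProduct_mulVec_im {H : Matrix (Fin N) (Fin N) ℂ} (hH : H.IsHermitian)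
    (v : Fin N → ℂ) : (star v ⬝ᵥ H *ᵥ v).im = 0 := by
  have := hH.im_star_dotProduct_mulVec_self v
  simpa using this

/-- The quadratic form of `H` is real, so the imaginary part of `⟨v, (H - z) v⟩` is `-Im z · ‖v‖²`;
Cauchy–Schwarz then bounds `‖v‖` by `‖(H - z) v‖`. Both invertibility of `H - z` and `‖green H z‖ ≤
1` follow from this. -/
theorem sum_norm_sq_le_sub_mulVec {H : Matrix (Fin N) (Fin N) ℂ} (hH : H.IsHermitian) {z : ℂ}
    (hz : 1 ≤ z.im) (v : Fin N → ℂ) :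
    ∑ i, ‖v i‖ ^ 2 ≤ ∑ i, ‖((H - z • 1) *ᵥ v) i‖ ^ 2 := by
  set s := ∑ i, ‖v i‖ ^ 2 with hs
  have hs0 : 0 ≤ s := by positivity
  have hvv : star v ⬝ᵥ v = (s : ℂ) := by
    simp only [dotProduct, Pi.star_apply, RCLike.star_def, Complex.conj_mul', hs]
    push_cast; rfl
  have him : (star v ⬝ᵥ (H - z • 1) *ᵥ v).im = -(z.im * s) := by
    rw [Matrix.sub_mulVec, dotProduct_sub, Matrix.smul_mulVec, Matrix.one_mulVec, dotProduct_smul,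
      hvv, Complex.sub_im, star_dotProduct_mulVec_im hH]
    simp
  have h1 := norm_star_dotProduct_sq_le v ((H - z • 1) *ᵥ v)
  have h2 : s ≤ ‖star v ⬝ᵥ (H - z • 1) *ᵥ v‖ := by
    calc s ≤ z.im * s := le_mul_of_one_le_left hs0 hz
      _ = |(star v ⬝ᵥ (H - z • 1) *ᵥ v).im| := by
          rw [him, abs_neg, abs_of_nonneg (by positivity)]
      _ ≤ _ := Complex.abs_im_le_norm _
  rw [← hs] at h1
  rcases hs0.eq_or_lt with h0 | h0
  · rw [← h0]; positivity
  · have : s * s ≤ s * ∑ i, ‖((H - z • 1) *ᵥ v) i‖ ^ 2 := by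
      calc s * s = s ^ 2 := by ring
        _ ≤ _ := (pow_le_pow_left₀ hs0 h2 2).trans h1
    exact le_of_mul_le_mul_left this h0

theorem isUnit_sub_smul_one {H : Matrix (Fin N) (Fin N) ℂ} (hH : H.IsHermitian) {z : ℂ}
    (hz : 1 ≤ z.im) : IsUnit (H - z • 1) := by
  rw [← Matrix.mulVec_injective_iff_isUnit]
  intro v w hvw
  have h := sum_norm_sq_le_sub_mulVec hH hz (v - w)
  have h0 : (H - z • 1) *ᵥ (v - w) = 0 := by
    rw [Matrix.mulVec_sub]; exact sub_eq_zero.2 hvw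
  rw [h0] at h
  simp only [Pi.zero_apply, norm_zero, ne_eq, OfNat.ofNat_ne_zero, not_false_eq_true, zero_pow,
    Finset.sum_const_zero] at h
  funext i
  have hi := (Finset.sum_eq_zero_iff_of_nonneg fun i _ => by positivity).1
    (le_antisymm h (by positivity)) i (Finset.mem_univ i)
  simpa [sub_eq_zero] using hi

theorem sub_mul_green {H : Matrix (Fin N) (Fin N) ℂ} (hH : H.IsHermitian) {z : ℂ}
    (hz : 1 ≤ z.im) : (H - z • 1) * green H z = 1 :=
  Matrix.mul_nonsing_inv _ ((Matrix.isUnit_iff_isUnit_det _).1 (isUnit_sub_smul_one hH hz))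

theorem green_mul_sub {H : Matrix (Fin N) (Fin N) ℂ} (hH : H.IsHermitian) {z : ℂ}
    (hz : 1 ≤ z.im) : green H z * (H - z • 1) = 1 :=
  Matrix.nonsing_inv_mul _ ((Matrix.isUnit_iff_isUnit_det _).1 (isUnit_sub_smul_one hH hz))

theorem norm_green_le {H : Matrix (Fin N) (Fin N) ℂ} (hH : H.IsHermitian) {z : ℂ}
    (hz : 1 ≤ z.im) : ‖green H z‖ ≤ 1 := by
  refine norm_le_of_sum_sq_le zero_le_one fun v => ?_
  have := sum_norm_sq_le_sub_mulVec hH hz (green H z *ᵥ v)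
  rw [Matrix.mulVec_mulVec, sub_mul_green hH hz, Matrix.one_mulVec] at this
  simpa using this

theorem green_sub_green {H H' : Matrix (Fin N) (Fin N) ℂ} (hH : H.IsHermitian)
    (hH' : H'.IsHermitian) {z : ℂ} (hz : 1 ≤ z.im) :
    green H z - green H' z = green H z * (H' - H) * green H' z := by
  have : H' - H = (H' - z • 1) - (H - z • 1) := by abel
  rw [this, mul_sub, sub_mul, mul_assoc, sub_mul_green hH' hz, green_mul_sub hH hz]
  simp

theorem sum_green_mulVec_sq_le {H : Matrix (Fin N) (Fin N) ℂ} (hH : H.IsHermitian) {z : ℂ}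
    (hz : 1 ≤ z.im) {v : Fin N → ℂ} (hv : ∑ i, ‖v i‖ ^ 2 ≤ 1) :
    ∑ i, ‖(green H z *ᵥ v) i‖ ^ 2 ≤ 1 := by
  refine (sum_norm_mulVec_sq_le _ v).trans ?_
  exact mul_le_one₀ (pow_le_one₀ (norm_nonneg _) (norm_green_le hH hz)) (by positivity) hv

/-- The Hermitian matrix with entries `c` at `p` and `conj c` at the transposed position. -/
def pairMatrix (p : Fin N × Fin N) (c : ℂ) : Matrix (Fin N) (Fin N) ℂ :=
  Matrix.single p.1 p.2 c + Matrix.single p.2 p.1 (star c)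

theorem pairMatrix_isHermitian (p : Fin N × Fin N) (c : ℂ) : (pairMatrix p c).IsHermitian := by
  rw [Matrix.IsHermitian, pairMatrix, Matrix.conjTranspose_add, Matrix.conjTranspose_single,
    Matrix.conjTranspose_single, star_star, add_comm]

theorem pairMatrix_mulVec (p : Fin N × Fin N) (c : ℂ) (v : Fin N → ℂ) :
    pairMatrix p c *ᵥ v = Pi.single p.1 (c * v p.2) + Pi.single p.2 (star c * v p.1) := by
  rw [pairMatrix, Matrix.add_mulVec, Matrix.single_mulVec, Matrix.single_mulVec]
  rfl

theorem norm_single_le (i j : Fin N) (c : ℂ) : ‖(Matrix.single i j c : Matrix _ _ ℂ)‖ ≤ ‖c‖ := by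
  refine norm_le_of_sum_sq_le (norm_nonneg _) fun v => ?_
  have : ∑ l, ‖((Matrix.single i j c : Matrix (Fin N) (Fin N) ℂ) *ᵥ v) l‖ ^ 2 =
      ‖c * v j‖ ^ 2 := by
    rw [Matrix.single_mulVec]
    rw [Finset.sum_eq_single i]
    · simp
    · intro l _ hl; simp [hl]
    · simp
  rw [this, norm_mul, mul_pow]
  gcongr
  exact Finset.single_le_sum (f := fun l => ‖v l‖ ^ 2) (fun _ _ => by positivity)
    (Finset.mem_univ j)

theorem norm_pairMatrix_le (p : Fin N × Fin N) (c : ℂ) : ‖pairMatrix p c‖ ≤ 2 * ‖c‖ := by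
  refine (norm_add_le _ _).trans ?_
  have h1 := norm_single_le p.1 p.2 c
  have h2 := norm_single_le p.2 p.1 (star c)
  rw [norm_star] at h2
  linarith

theorem norm_mul_pairMatrix_mulVec_le (A : Matrix (Fin N) (Fin N) ℂ) (p : Fin N × Fin N) (c : ℂ)
    (v : Fin N → ℂ) (l : Fin N) :
    ‖(A *ᵥ (pairMatrix p c *ᵥ v)) l‖ ≤ ‖A‖ * (‖c‖ * (‖v p.1‖ + ‖v p.2‖)) := by
  rw [pairMatrix_mulVec, Matrix.mulVec_add, Matrix.mulVec_single, Matrix.mulVec_single]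
  simp only [Pi.add_apply, Pi.smul_apply, Matrix.col_apply, op_smul_eq_smul, smul_eq_mul]
  refine (norm_add_le _ _).trans ?_
  rw [norm_mul, norm_mul, norm_mul, norm_mul, norm_star]
  have h1 := norm_entry_le A l p.1
  have h2 := norm_entry_le A l p.2
  calc _ ≤ ‖c‖ * ‖v p.2‖ * ‖A‖ + ‖c‖ * ‖v p.1‖ * ‖A‖ := by gcongr
    _ = _ := by ring

theorem star_dotProduct_pairMatrix_mulVec (p : Fin N × Fin N) (c : ℂ) (u v : Fin N → ℂ) :
    star u ⬝ᵥ pairMatrix p c *ᵥ v =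
      star (u p.1) * (c * v p.2) + star (u p.2) * (star c * v p.1) := by
  rw [pairMatrix_mulVec, dotProduct_add, dotProduct_single, dotProduct_single]
  rfl

variable {n : ℕ}

/-- The Hermitian matrix with zero diagonal whose upper entry at `e k` is `y k`. -/
def edgeMatrix (e : Fin n → Fin N × Fin N) (y : Fin n → ℂ) : Matrix (Fin N) (Fin N) ℂ :=
  ∑ k, pairMatrix (e k) (y k)

theorem edgeMatrix_isHermitian (e : Fin n → Fin N × Fin N) (y : Fin n → ℂ) :
    (edgeMatrix e y).IsHermitian := by
  rw [Matrix.IsHermitian, edgeMatrix, Matrix.conjTranspose_sum]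
  exact Finset.sum_congr rfl fun k _ => pairMatrix_isHermitian _ _

theorem edgeMatrix_update (e : Fin n → Fin N × Fin N) (y : Fin n → ℂ) (k : Fin n) :
    edgeMatrix e (Function.update y k 0) = edgeMatrix e y - pairMatrix (e k) (y k) := by
  rw [edgeMatrix, edgeMatrix, ← Finset.add_sum_erase _ _ (Finset.mem_univ k),
    ← Finset.add_sum_erase _ (fun k => pairMatrix (e k) (y k)) (Finset.mem_univ k)]
  rw [add_sub_cancel_left, Function.update_self]
  have : pairMatrix (e k) 0 = 0 := by simp [pairMatrix]
  rw [this, zero_add]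
  refine Finset.sum_congr rfl fun j hj => ?_
  rw [Function.update_of_ne (Finset.ne_of_mem_erase hj)]

theorem continuous_edgeMatrix (e : Fin n → Fin N × Fin N) : Continuous (edgeMatrix e) := by
  refine continuous_pi fun i => continuous_pi fun j => ?_
  simp only [edgeMatrix, pairMatrix, Matrix.sum_apply, Matrix.add_apply, Matrix.single_apply]
  refine continuous_finsetSum _ fun k _ => ?_
  split_ifs <;> fun_prop

/-- Cramer's rule writes the entry as an adjugate entry times the inverse of a determinant, both
continuous in `y`; inversion on `ℂ` is measurable everywhere, so invertibility plays no role. -/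
theorem measurable_green_edgeMatrix (e : Fin n → Fin N × Fin N) (z : ℂ) (i j : Fin N) :
    Measurable fun y => green (edgeMatrix e y) z i j := by
  have hc : Continuous fun y => edgeMatrix e y - z • (1 : Matrix (Fin N) (Fin N) ℂ) :=
    (continuous_edgeMatrix e).sub continuous_const
  simp only [green, Matrix.inv_def, Matrix.smul_apply, Ring.inverse_eq_inv', smul_eq_mul]
  exact hc.matrix_det.measurable.inv.mul (hc.matrix_adjugate.matrix_elem i j).measurable

theorem measurable_green_mulVec (e : Fin n → Fin N × Fin N) (z : ℂ) (v : Fin N → ℂ) (i : Fin N) :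
    Measurable fun y => (green (edgeMatrix e y) z *ᵥ v) i := by
  simp only [Matrix.mulVec, dotProduct]
  exact Finset.measurable_fun_sum _ fun j _ =>
    (measurable_green_edgeMatrix e z i j).mul_const _

theorem measurable_dotProduct_green (e : Fin n → Fin N × Fin N) (z : ℂ) (u v : Fin N → ℂ) :
    Measurable fun y => star u ⬝ᵥ green (edgeMatrix e y) z *ᵥ v := by
  simp only [dotProduct]
  exact Finset.measurable_fun_sum _ fun j _ =>
    (measurable_green_mulVec e z v j).const_mul _

theorem norm_dotProduct_green_le {H : Matrix (Fin N) (Fin N) ℂ} (hH : H.IsHermitian) {z : ℂ}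
    (hz : 1 ≤ z.im) {u v : Fin N → ℂ} (hu : ∑ i, ‖u i‖ ^ 2 ≤ 1) (hv : ∑ i, ‖v i‖ ^ 2 ≤ 1) :
    ‖star u ⬝ᵥ green H z *ᵥ v‖ ≤ 1 :=
  (norm_star_dotProduct_mulVec_le _ hu hv).trans (norm_green_le hH hz)

end Green

/-! ### Sums over band edges and the effect of deleting one edge. -/

section EdgeSums

open scoped Matrix Matrix.Norms.L2Operator

variable {N n : ℕ}

/-- The sum of the weights `s k` of the edges `e k` that contain the vertex `i`. -/
def vertexSum {R : Type*} [CommSemiring R] (e : Fin n → Fin N × Fin N) (s : Fin n → R)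
    (i : Fin N) : R :=
  ∑ k, ((if (e k).1 = i then s k else 0) + if (e k).2 = i then s k else 0)

/-- Double counting of incidences between edges and their endpoints. -/
theorem sum_edge_mul_eq {R : Type*} [CommSemiring R] (e : Fin n → Fin N × Fin N) (s : Fin n → R)
    (a : Fin N → R) :
    ∑ k, s k * (a (e k).1 + a (e k).2) = ∑ i, vertexSum e s i * a i := by
  simp only [vertexSum, Finset.sum_mul]
  rw [Finset.sum_comm]
  refine Finset.sum_congr rfl fun k _ => ?_
  simp only [add_mul, ite_mul, zero_mul, Finset.sum_add_distrib, Finset.sum_ite_eq,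
    Finset.mem_univ, if_true, mul_add]

theorem sum_edge_vertex_le {e : Fin n → Fin N × Fin N} {s : Fin n → ℝ} {ξ : ℝ}
    (hξ : ∀ i, vertexSum e s i ≤ ξ) {a : Fin N → ℝ} (ha : ∀ i, 0 ≤ a i) :
    ∑ k, s k * (a (e k).1 + a (e k).2) ≤ ξ * ∑ i, a i := by
  rw [sum_edge_mul_eq, Finset.mul_sum]
  exact Finset.sum_le_sum fun i _ => mul_le_mul_of_nonneg_right (hξ i) (ha i)

theorem sum_edge_le {e : Fin n → Fin N × Fin N} (he : Function.Injective e)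
    {f : Fin N × Fin N → ℝ} (hf : ∀ p, 0 ≤ f p) : ∑ k, f (e k) ≤ ∑ i, ∑ j, f (i, j) := by
  rw [← Fintype.sum_prod_type' fun i j => f (i, j), ← Finset.sum_image (s := Finset.univ)
    (f := f) he.injOn]
  exact Finset.sum_le_sum_of_subset_of_nonneg (Finset.subset_univ _) fun p _ _ => hf p

/-- A list of distinct edges such that every vertex has degree at most `ξ`. -/
structure IsBandEdges (e : Fin n → Fin N × Fin N) (ξ : ℝ) : Prop where
  injective : Function.Injective e
  degree_le : ∀ i, vertexSum e (fun _ => (1 : ℝ)) i ≤ ξ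

theorem IsBandEdges.sum_le {e : Fin n → Fin N × Fin N} {ξ : ℝ} (h : IsBandEdges e ξ)
    {a : Fin N → ℝ} (ha : ∀ i, 0 ≤ a i) :
    ∑ k, (a (e k).1 + a (e k).2) ≤ ξ * ∑ i, a i := by
  have := sum_edge_vertex_le h.degree_le ha
  simpa using this

/-- Because the edges are distinct, each sum is dominated by the sum over all pairs, which is a
product of two `ℓ²` sums. No degree factor `ξ` appears, in contrast to `IsBandEdges.sum_le`. -/
theorem IsBandEdges.sum_sq_mul_le {e : Fin n → Fin N × Fin N} {ξ : ℝ} (h : IsBandEdges e ξ)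
    {a b : Fin N → ℂ} (ha : ∑ i, ‖a i‖ ^ 2 ≤ 1) (hb : ∑ i, ‖b i‖ ^ 2 ≤ 1) :
    ∑ k, (‖a (e k).1‖ ^ 2 * ‖b (e k).2‖ ^ 2 + ‖a (e k).2‖ ^ 2 * ‖b (e k).1‖ ^ 2) ≤ 2 := by
  rw [Finset.sum_add_distrib]
  have h1 := sum_edge_le h.injective (f := fun p => ‖a p.1‖ ^ 2 * ‖b p.2‖ ^ 2)
    fun p => by positivity
  have h2 := sum_edge_le h.injective (f := fun p => ‖a p.2‖ ^ 2 * ‖b p.1‖ ^ 2)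
    fun p => by positivity
  have h3 : ∑ i, ∑ j, ‖a i‖ ^ 2 * ‖b j‖ ^ 2 ≤ 1 := by
    rw [← Finset.sum_mul_sum]
    exact mul_le_one₀ ha (by positivity) hb
  have h4 : ∑ i, ∑ j, ‖a j‖ ^ 2 * ‖b i‖ ^ 2 ≤ 1 := by rwa [Finset.sum_comm]
  linarith [h1.trans h3, h2.trans h4]

/-- The resolvent identity with the reduced resolvent on the right, as needed for concentration. The
primed variant has it on the left, as needed for expanding resolvent vectors in one entry. -/
theorem green_update_eq (e : Fin n → Fin N × Fin N) (y : Fin n → ℂ) (k : Fin n) {z : ℂ}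
    (hz : 1 ≤ z.im) :
    green (edgeMatrix e (Function.update y k 0)) z = green (edgeMatrix e y) z +
      green (edgeMatrix e y) z * pairMatrix (e k) (y k) *
        green (edgeMatrix e (Function.update y k 0)) z := by
  have h := green_sub_green (edgeMatrix_isHermitian e y)
    (edgeMatrix_isHermitian e (Function.update y k 0)) hz
  have h2 : edgeMatrix e (Function.update y k 0) - edgeMatrix e y = -pairMatrix (e k) (y k) := by
    rw [edgeMatrix_update]; abel
  rw [h2, mul_neg, neg_mul, sub_eq_iff_eq_add] at h
  exact (eq_neg_add_iff_add_eq.1 h).symm.trans (add_comm _ _)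

theorem green_update_eq' (e : Fin n → Fin N × Fin N) (y : Fin n → ℂ) (k : Fin n) {z : ℂ}
    (hz : 1 ≤ z.im) :
    green (edgeMatrix e (Function.update y k 0)) z = green (edgeMatrix e y) z +
      green (edgeMatrix e (Function.update y k 0)) z * pairMatrix (e k) (y k) *
        green (edgeMatrix e y) z := by
  have h := green_sub_green (edgeMatrix_isHermitian e (Function.update y k 0))
    (edgeMatrix_isHermitian e y) hz
  have h2 : edgeMatrix e y - edgeMatrix e (Function.update y k 0) = pairMatrix (e k) (y k) := by
    rw [edgeMatrix_update]; abel
  rw [h2, sub_eq_iff_eq_add'] at h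
  exact h

/-- The effect on a resolvent form of deleting single edges, summed over the edges. -/
theorem IsBandEdges.sum_update_sq_le {e : Fin n → Fin N × Fin N} {ξ : ℝ} (h : IsBandEdges e ξ)
    (hξ : 0 ≤ ξ) {z : ℂ} (hz : 1 ≤ z.im) {u v : Fin N → ℂ} (hu : ∑ i, ‖u i‖ ^ 2 ≤ 1)
    (hv : ∑ i, ‖v i‖ ^ 2 ≤ 1) {y : Fin n → ℂ} {K : ℝ} (hK : ∀ k, ‖y k‖ ≤ K) (hK0 : 0 ≤ K) :
    ∑ k, ‖star u ⬝ᵥ green (edgeMatrix e y) z *ᵥ v -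
      star u ⬝ᵥ green (edgeMatrix e (Function.update y k 0)) z *ᵥ v‖ ^ 2 ≤
      8 * K ^ 2 + 16 * ξ * K ^ 4 := by
  have hH := edgeMatrix_isHermitian e y
  set G := green (edgeMatrix e y) z with hG
  have hG1 : ‖G‖ ≤ 1 := norm_green_le hH hz
  set p : Fin N → ℂ := Gᴴ *ᵥ u with hp
  set q : Fin N → ℂ := G *ᵥ v with hq
  have hp1 : ∑ i, ‖p i‖ ^ 2 ≤ 1 := by
    refine (sum_norm_mulVec_sq_le _ u).trans ?_
    rw [Matrix.l2_opNorm_conjTranspose]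
    exact mul_le_one₀ (pow_le_one₀ (norm_nonneg _) hG1) (by positivity) hu
  have hq1 : ∑ i, ‖q i‖ ^ 2 ≤ 1 := sum_green_mulVec_sq_le hH hz hv
  have hstar : ∀ w : Fin N → ℂ, star u ⬝ᵥ G *ᵥ w = star p ⬝ᵥ w := fun w => by
    rw [hp, Matrix.star_mulVec, Matrix.conjTranspose_conjTranspose, Matrix.dotProduct_mulVec]
  -- The increment is `-⟨p, D (q + w)⟩` with `p = Gᴴ u`, `q = G v` and a correction `w` of size at
  -- most `2K`. The part with `q` pairs two `ℓ²` vectors along distinct edges and sums to `O(K²)`.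
  -- The part with `w` has only a uniform bound, which costs the degree `ξ` but gains another `K²`.
  have hterm : ∀ k, ‖star u ⬝ᵥ G *ᵥ v -
      star u ⬝ᵥ green (edgeMatrix e (Function.update y k 0)) z *ᵥ v‖ ^ 2 ≤
      4 * K ^ 2 * (‖p (e k).1‖ ^ 2 * ‖q (e k).2‖ ^ 2 + ‖p (e k).2‖ ^ 2 * ‖q (e k).1‖ ^ 2) +
      16 * K ^ 4 * (‖p (e k).1‖ ^ 2 + ‖p (e k).2‖ ^ 2) := by
    intro k
    have hG1' := norm_green_le (edgeMatrix_isHermitian e (Function.update y k 0)) hz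
    have hup := green_update_eq e y k hz
    set G' := green (edgeMatrix e (Function.update y k 0)) z with hG'
    rw [← hG] at hup
    set D := pairMatrix (e k) (y k) with hD
    have hD1 : ‖D‖ ≤ 2 * K := (norm_pairMatrix_le _ _).trans (by gcongr; exact hK k)
    set w : Fin N → ℂ := (G * D * G') *ᵥ v with hw
    have hw1 : ∀ i, ‖w i‖ ≤ 2 * K := fun i => by
      have hn : ‖G * D * G'‖ ≤ 2 * K := by
        calc ‖G * D * G'‖ ≤ ‖G‖ * ‖D‖ * ‖G'‖ :=
              (norm_mul_le _ _).trans (by gcongr; exact norm_mul_le _ _)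
          _ ≤ 1 * (2 * K) * 1 := by gcongr
          _ = 2 * K := by ring
      have h1 := sum_norm_mulVec_sq_le (G * D * G') v
      have h2 : ‖w i‖ ^ 2 ≤ ∑ i, ‖w i‖ ^ 2 :=
        Finset.single_le_sum (f := fun i => ‖w i‖ ^ 2) (fun _ _ => by positivity)
          (Finset.mem_univ i)
      refine (sq_le_sq₀ (norm_nonneg _) (by positivity)).1 (h2.trans (h1.trans ?_))
      calc _ ≤ (2 * K) ^ 2 * 1 := by gcongr
        _ = _ := by ring
    have e1 : G' *ᵥ v = q + w := by
      conv_lhs => rw [hup]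
      rw [Matrix.add_mulVec]
    have e2 : star u ⬝ᵥ G *ᵥ v - star u ⬝ᵥ G' *ᵥ v = -(star p ⬝ᵥ D *ᵥ (q + w)) := by
      conv_lhs => rw [hup]
      rw [Matrix.add_mulVec, dotProduct_add, mul_assoc, ← Matrix.mulVec_mulVec, hstar,
        ← Matrix.mulVec_mulVec, hstar, e1]
      ring
    rw [e2, norm_neg, hD, star_dotProduct_pairMatrix_mulVec]
    have hqw : ∀ i, ‖(q + w) i‖ ≤ ‖q i‖ + 2 * K := fun i =>
      (norm_add_le _ _).trans (by gcongr; exact hw1 i)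
    have h3 : ‖star (p (e k).1) * (y k * (q + w) (e k).2) +
        star (p (e k).2) * (star (y k) * (q + w) (e k).1)‖ ≤
        ‖p (e k).1‖ * (K * (‖q (e k).2‖ + 2 * K)) + ‖p (e k).2‖ * (K * (‖q (e k).1‖ + 2 * K)) := by
      refine (norm_add_le _ _).trans ?_
      simp only [norm_mul, norm_star]
      gcongr
      · exact hK k
      · exact hqw _
      · exact hK k
      · exact hqw _
    refine (pow_le_pow_left₀ (norm_nonneg _) h3 2).trans ?_
    set a := ‖p (e k).1‖
    set b := ‖p (e k).2‖
    set c := ‖q (e k).1‖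
    set d := ‖q (e k).2‖
    have i1 := two_mul_le_add_sq (a * (d + 2 * K)) (b * (c + 2 * K))
    have i2 : a ^ 2 * (d + 2 * K) ^ 2 ≤ a ^ 2 * (2 * d ^ 2 + 8 * K ^ 2) := by
      gcongr; nlinarith [two_mul_le_add_sq d (2 * K)]
    have i3 : b ^ 2 * (c + 2 * K) ^ 2 ≤ b ^ 2 * (2 * c ^ 2 + 8 * K ^ 2) := by
      gcongr; nlinarith [two_mul_le_add_sq c (2 * K)]
    calc (a * (K * (d + 2 * K)) + b * (K * (c + 2 * K))) ^ 2
        = K ^ 2 * ((a * (d + 2 * K)) ^ 2 + (b * (c + 2 * K)) ^ 2 +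
          2 * (a * (d + 2 * K)) * (b * (c + 2 * K))) := by ring
      _ ≤ K ^ 2 * (2 * (a ^ 2 * (2 * d ^ 2 + 8 * K ^ 2)) +
          2 * (b ^ 2 * (2 * c ^ 2 + 8 * K ^ 2))) := by
        refine mul_le_mul_of_nonneg_left ?_ (by positivity)
        rw [mul_pow, mul_pow] at i1 ⊢
        linarith
      _ = _ := by ring
  refine (Finset.sum_le_sum fun k _ => hterm k).trans ?_
  rw [Finset.sum_add_distrib, ← Finset.mul_sum, ← Finset.mul_sum]
  have h1 := h.sum_sq_mul_le hp1 hq1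
  have h2 := h.sum_le (a := fun i => ‖p i‖ ^ 2) fun i => by positivity
  calc _ ≤ 4 * K ^ 2 * 2 + 16 * K ^ 4 * (ξ * 1) := by
        gcongr
        exact h2.trans (by gcongr)
    _ = _ := by ring

end EdgeSums

/-! ### Deterministic second-order expansion in one matrix entry. -/

section SelfConsistent

open scoped Matrix Matrix.Norms.L2Operator

variable {N n : ℕ}

theorem norm_mulVec_sub_le {G G' : Matrix (Fin N) (Fin N) ℂ} {p : Fin N × Fin N} {c : ℂ}
    (hG' : ‖G'‖ ≤ 1) (hup : G' = G + G' * pairMatrix p c * G) (v : Fin N → ℂ) (l : Fin N) :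
    ‖(G' *ᵥ v) l - (G *ᵥ v) l‖ ≤ ‖c‖ * (‖(G *ᵥ v) p.1‖ + ‖(G *ᵥ v) p.2‖) := by
  have h : G' *ᵥ v = G *ᵥ v + G' *ᵥ (pairMatrix p c *ᵥ (G *ᵥ v)) := by
    conv_lhs => rw [hup]
    rw [Matrix.add_mulVec, ← Matrix.mulVec_mulVec, ← Matrix.mulVec_mulVec]
  rw [h, Pi.add_apply, add_sub_cancel_left]
  refine (norm_mul_pairMatrix_mulVec_le G' p c _ l).trans ?_
  exact mul_le_of_le_one_left (by positivity) hG'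

theorem norm_entry_sub_le {G G' : Matrix (Fin N) (Fin N) ℂ} {p : Fin N × Fin N} {c : ℂ}
    (hG : ‖G‖ ≤ 1) (hG' : ‖G'‖ ≤ 1) (hup : G' = G + G' * pairMatrix p c * G) (i j : Fin N) :
    ‖G' i j - G i j‖ ≤ 2 * ‖c‖ := by
  have h : (G' - G) i j = (G' * pairMatrix p c * G) i j := by
    rw [sub_eq_iff_eq_add'.2 hup]
  rw [← Matrix.sub_apply, h]
  calc _ ≤ ‖G' * pairMatrix p c * G‖ := norm_entry_le _ _ _
    _ ≤ ‖G'‖ * ‖pairMatrix p c‖ * ‖G‖ := (norm_mul_le _ _).trans (by gcongr; exact norm_mul_le _ _)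
    _ ≤ 1 * (2 * ‖c‖) * 1 := by gcongr; exact norm_pairMatrix_le _ _
    _ = _ := by ring

/-- Second order expansion of a resolvent vector in one matrix entry. -/
theorem norm_edge_expansion_le {G G' : Matrix (Fin N) (Fin N) ℂ} {p : Fin N × Fin N} {c : ℂ}
    (hG : ‖G‖ ≤ 1) (hG' : ‖G'‖ ≤ 1) (hup : G' = G + G' * pairMatrix p c * G) {K : ℝ}
    (hc : ‖c‖ ≤ K) (hK : K ≤ 1) (v : Fin N → ℂ) :
    ‖c * (G *ᵥ v) p.2 - c * (G' *ᵥ v) p.2 + (‖c‖ ^ 2 : ℝ) * (G' p.2 p.2 * (G' *ᵥ v) p.1)‖ ≤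
      (2 * K ^ 2 * ‖G p.2 p.1‖ + 6 * K ^ 3) * (‖(G *ᵥ v) p.1‖ + ‖(G *ᵥ v) p.2‖) := by
  have hK0 : 0 ≤ K := (norm_nonneg _).trans hc
  set D := pairMatrix p c with hD
  set q := G *ᵥ v with hq
  set q' := G' *ᵥ v with hq'
  set S := ‖q p.1‖ + ‖q p.2‖ with hS
  have h : q' = q + G' *ᵥ (D *ᵥ q) := by
    conv_lhs => rw [hq', hup]
    rw [Matrix.add_mulVec, ← Matrix.mulVec_mulVec, ← Matrix.mulVec_mulVec]
  -- The resolvent identity iterated twice: the first two terms contain only reduced quantities,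
  -- which do not depend on the entry `c`, and the remainder is of second order in `c`.
  have h2 : q = q' - G' *ᵥ (D *ᵥ q') + (G' * D * G') *ᵥ (D *ᵥ q) := by
    have e1 : G' *ᵥ (D *ᵥ q') = G' *ᵥ (D *ᵥ q) + (G' * D * G') *ᵥ (D *ᵥ q) := by
      conv_lhs => rw [h]
      rw [Matrix.mulVec_add, Matrix.mulVec_add, ← Matrix.mulVec_mulVec, ← Matrix.mulVec_mulVec]
    rw [e1]
    conv_rhs => rw [h]
    abel
  have h3 : (G' *ᵥ (D *ᵥ q')) p.2 = G' p.2 p.1 * (c * q' p.2) + G' p.2 p.2 * (star c * q' p.1) := by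
    rw [hD, pairMatrix_mulVec, Matrix.mulVec_add, Matrix.mulVec_single, Matrix.mulVec_single]
    simp [mul_comm]
  have h4 := congrFun h2 p.2
  simp only [Pi.add_apply, Pi.sub_apply, h3] at h4
  set R := ((G' * D * G') *ᵥ (D *ᵥ q)) p.2 with hR
  have hcc : ((‖c‖ ^ 2 : ℝ) : ℂ) = c * star c := by
    rw [RCLike.star_def, Complex.mul_conj']; push_cast; rfl
  -- After multiplication by `c`, the term with `c * star c` is the one that is kept. The term with
  -- `c * c` need not average to zero for complex entries, so it stays as an error weighted by the
  -- off-diagonal entry `G' p.2 p.1`.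
  have h5 : c * q p.2 - c * q' p.2 + (‖c‖ ^ 2 : ℝ) * (G' p.2 p.2 * q' p.1) =
      -(c * c * G' p.2 p.1 * q' p.2) + c * R := by
    rw [h4, hcc]; ring
  rw [h5]
  have hS0 : 0 ≤ S := by positivity
  -- Reduced quantities change from edge to edge, so they are converted back to `G` and `q`, which
  -- are common to all edges and can be summed.
  have hq'2 : ‖q' p.2‖ ≤ 2 * S := by
    have h6 := norm_mulVec_sub_le hG' hup v p.2
    rw [← hq, ← hq', ← hS] at h6
    have h7 : ‖q p.2‖ ≤ S := le_add_of_nonneg_left (norm_nonneg _)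
    have h8 : ‖c‖ * S ≤ S := mul_le_of_le_one_left hS0 (hc.trans hK)
    have := norm_sub_norm_le (q' p.2) (q p.2)
    linarith
  have hG21 : ‖G' p.2 p.1‖ ≤ ‖G p.2 p.1‖ + 2 * K := by
    have h6 := norm_entry_sub_le hG hG' hup p.2 p.1
    have := norm_sub_norm_le (G' p.2 p.1) (G p.2 p.1)
    linarith
  have hRb : ‖R‖ ≤ 2 * K * (K * S) := by
    refine (norm_mul_pairMatrix_mulVec_le _ p c q p.2).trans ?_
    rw [← hS]
    gcongr
    calc _ ≤ ‖G'‖ * ‖D‖ * ‖G'‖ := (norm_mul_le _ _).trans (by gcongr; exact norm_mul_le _ _)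
      _ ≤ 1 * (2 * ‖c‖) * 1 := by gcongr; exact norm_pairMatrix_le _ _
      _ ≤ _ := by linarith
  calc ‖-(c * c * G' p.2 p.1 * q' p.2) + c * R‖
      ≤ ‖c‖ * ‖c‖ * ‖G' p.2 p.1‖ * ‖q' p.2‖ + ‖c‖ * ‖R‖ := by
        refine (norm_add_le _ _).trans ?_
        rw [norm_neg, norm_mul, norm_mul, norm_mul, norm_mul]
    _ ≤ K * K * (‖G p.2 p.1‖ + 2 * K) * (2 * S) + K * (2 * K * (K * S)) := by gcongr
    _ = _ := by ring

/-- Used to restore the full resolvent in the main term after the expectation has been factored.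
Multiplied by a variance at most `K²`, the cost is of order `K³`, like the other third-order errors.
-/
theorem norm_edge_main_sub_le {G G' : Matrix (Fin N) (Fin N) ℂ} {p : Fin N × Fin N} {c : ℂ}
    (hG : ‖G‖ ≤ 1) (hG' : ‖G'‖ ≤ 1) (hup : G' = G + G' * pairMatrix p c * G) {K : ℝ}
    (hc : ‖c‖ ≤ K) (hK : K ≤ 1) (v : Fin N → ℂ) :
    ‖G p.2 p.2 * (G *ᵥ v) p.1 - G' p.2 p.2 * (G' *ᵥ v) p.1‖ ≤
      5 * K * (‖(G *ᵥ v) p.1‖ + ‖(G *ᵥ v) p.2‖) := by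
  have hK0 : 0 ≤ K := (norm_nonneg _).trans hc
  set q := G *ᵥ v with hq
  set q' := G' *ᵥ v with hq'
  set S := ‖q p.1‖ + ‖q p.2‖ with hS
  have hS0 : 0 ≤ S := by positivity
  have h6 := norm_mulVec_sub_le hG' hup v p.1
  rw [← hq, ← hq', ← hS] at h6
  have h6' : ‖q' p.1 - q p.1‖ ≤ K * S := h6.trans (by gcongr)
  have hq'1 : ‖q' p.1‖ ≤ 2 * S := by
    have h7 : ‖q p.1‖ ≤ S := le_add_of_nonneg_right (norm_nonneg _)
    have h8 : K * S ≤ S := mul_le_of_le_one_left hS0 hK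
    have := norm_sub_norm_le (q' p.1) (q p.1)
    linarith
  have hG22 := norm_entry_sub_le hG hG' hup p.2 p.2
  have e : G p.2 p.2 * q p.1 - G' p.2 p.2 * q' p.1 =
      -((G' p.2 p.2 - G p.2 p.2) * q' p.1) + -(G p.2 p.2 * (q' p.1 - q p.1)) := by ring
  rw [e]
  refine (norm_add_le _ _).trans ?_
  rw [norm_neg, norm_neg, norm_mul, norm_mul]
  have := (norm_entry_le G p.2 p.2).trans hG
  calc _ ≤ (2 * K) * (2 * S) + 1 * (K * S) := by
        gcongr
        exact hG22.trans (by gcongr)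
    _ = _ := by ring

/-- Independent, centered random variables bounded by `K`. -/
structure IsEdgeFamily {Ω : Type*} [MeasurableSpace Ω] (P : Measure Ω) (h : Fin n → Ω → ℂ)
    (K : ℝ) : Prop where
  measurable : ∀ k, Measurable (h k)
  indep : iIndepFun h P
  centered : ∀ k, ∫ ω, h k ω ∂P = 0
  norm_le : ∀ k ω, ‖h k ω‖ ≤ K

/-- An edge read backwards carries the conjugate entry, so one expansion lemma serves both
orientations. -/
theorem pairMatrix_swap (p : Fin N × Fin N) (c : ℂ) :
    pairMatrix p.swap (star c) = pairMatrix p c := by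
  simp only [pairMatrix, star_star, Prod.fst_swap, Prod.snd_swap]
  exact add_comm _ _

theorem edgeMatrix_dotProduct (e : Fin n → Fin N × Fin N) (y : Fin n → ℂ) (u q : Fin N → ℂ) :
    star u ⬝ᵥ edgeMatrix e y *ᵥ q = ∑ k, (star (u (e k).1) * (y k * q (e k).2) +
      star (u (e k).2) * (star (y k) * q (e k).1)) := by
  rw [edgeMatrix, Matrix.sum_mulVec, dotProduct_sum]
  exact Finset.sum_congr rfl fun k _ => star_dotProduct_pairMatrix_mulVec _ _ _ _

/-- The terms with coefficient `A` carry entries of `G`. Weighted AM–GM with weights `√ξ` and `1/√ξ`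
separates `‖u‖²‖G‖²`, whose edge sum is at most `2` because the columns of `G` are bounded in `ℓ²`,
from `‖q‖²`, whose edge sum is at most `ξ`. The balance is `O(√ξ)`, where the plain terms with
coefficient `B` cost `O(ξ)`. -/
theorem IsBandEdges.sum_error_le {e : Fin n → Fin N × Fin N} {ξ : ℝ} (h : IsBandEdges e ξ)
    (hξ : 0 < ξ) {G : Matrix (Fin N) (Fin N) ℂ} (hG : ‖G‖ ≤ 1) {u q : Fin N → ℂ}
    (hu : ∑ i, ‖u i‖ ^ 2 ≤ 1) (hq : ∑ i, ‖q i‖ ^ 2 ≤ 1) {A B : ℝ} (hA : 0 ≤ A) (hB : 0 ≤ B) :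
    ∑ k, (‖u (e k).1‖ * ((A * ‖G (e k).2 (e k).1‖ + B) * (‖q (e k).1‖ + ‖q (e k).2‖)) +
      ‖u (e k).2‖ * ((A * ‖G (e k).1 (e k).2‖ + B) * (‖q (e k).1‖ + ‖q (e k).2‖))) ≤
      A * (3 * √ξ) + B * (2 * ξ) := by
  have hs : 0 < √ξ := Real.sqrt_pos.2 hξ
  have hterm : ∀ k, (‖u (e k).1‖ * ((A * ‖G (e k).2 (e k).1‖ + B) * (‖q (e k).1‖ + ‖q (e k).2‖)) +
      ‖u (e k).2‖ * ((A * ‖G (e k).1 (e k).2‖ + B) * (‖q (e k).1‖ + ‖q (e k).2‖))) ≤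
      A * (√ξ * (‖u (e k).1‖ ^ 2 * ‖G (e k).2 (e k).1‖ ^ 2 +
          ‖u (e k).2‖ ^ 2 * ‖G (e k).1 (e k).2‖ ^ 2) +
        (√ξ)⁻¹ * (‖q (e k).1‖ ^ 2 + ‖q (e k).2‖ ^ 2)) +
      B * ((‖u (e k).1‖ ^ 2 + ‖u (e k).2‖ ^ 2) + (‖q (e k).1‖ ^ 2 + ‖q (e k).2‖ ^ 2)) := by
    intro k
    set a := ‖u (e k).1‖
    set b := ‖u (e k).2‖
    set c := ‖q (e k).1‖
    set d := ‖q (e k).2‖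
    set g := ‖G (e k).2 (e k).1‖
    set g' := ‖G (e k).1 (e k).2‖
    have i1 : (a + b) * (c + d) ≤ (a ^ 2 + b ^ 2) + (c ^ 2 + d ^ 2) := by
      nlinarith [sq_nonneg (a - b), sq_nonneg (c - d), sq_nonneg (a + b - (c + d))]
    have i2 : (a * g + b * g') * (c + d) ≤
        √ξ * (a ^ 2 * g ^ 2 + b ^ 2 * g' ^ 2) + (√ξ)⁻¹ * (c ^ 2 + d ^ 2) := by
      have e1 : √ξ * (√ξ)⁻¹ = 1 := mul_inv_cancel₀ hs.ne'
      have e2 : 0 ≤ (√ξ)⁻¹ * (√ξ * (a * g + b * g') - (c + d)) ^ 2 := by positivity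
      have e3 : (√ξ)⁻¹ * (√ξ * (a * g + b * g') - (c + d)) ^ 2 =
          (√ξ * (√ξ)⁻¹) * (√ξ * (a * g + b * g') ^ 2) -
          2 * (√ξ * (√ξ)⁻¹) * ((a * g + b * g') * (c + d)) + (√ξ)⁻¹ * (c + d) ^ 2 := by ring
      rw [e3, e1] at e2
      have e4 : √ξ * (a * g + b * g') ^ 2 ≤ √ξ * (2 * (a ^ 2 * g ^ 2 + b ^ 2 * g' ^ 2)) := by
        gcongr; nlinarith [sq_nonneg (a * g - b * g')]
      have e5 : (√ξ)⁻¹ * (c + d) ^ 2 ≤ (√ξ)⁻¹ * (2 * (c ^ 2 + d ^ 2)) := by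
        gcongr; nlinarith [sq_nonneg (c - d)]
      linarith
    calc _ = A * ((a * g + b * g') * (c + d)) + B * ((a + b) * (c + d)) := by ring
      _ ≤ _ := by gcongr
  refine (Finset.sum_le_sum fun k _ => hterm k).trans ?_
  rw [Finset.sum_add_distrib, ← Finset.mul_sum, ← Finset.mul_sum, Finset.sum_add_distrib,
    Finset.sum_add_distrib, ← Finset.mul_sum, ← Finset.mul_sum]
  have h1 := h.sum_le (a := fun i => ‖u i‖ ^ 2) fun i => by positivity
  have h2 := h.sum_le (a := fun i => ‖q i‖ ^ 2) fun i => by positivity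
  have h3 : ∑ k, (‖u (e k).1‖ ^ 2 * ‖G (e k).2 (e k).1‖ ^ 2 +
      ‖u (e k).2‖ ^ 2 * ‖G (e k).1 (e k).2‖ ^ 2) ≤ 2 := by
    rw [Finset.sum_add_distrib]
    have hcol : ∑ i, ∑ j, ‖u i‖ ^ 2 * ‖G j i‖ ^ 2 ≤ 1 := by
      refine le_trans (Finset.sum_le_sum fun i _ => ?_) hu
      rw [← Finset.mul_sum]
      exact mul_le_of_le_one_right (by positivity)
        ((sum_norm_col_sq_le G i).trans (pow_le_one₀ (norm_nonneg _) hG))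
    have j1 := sum_edge_le h.injective (f := fun p => ‖u p.1‖ ^ 2 * ‖G p.2 p.1‖ ^ 2)
      fun p => by positivity
    have j2 := sum_edge_le h.injective (f := fun p => ‖u p.2‖ ^ 2 * ‖G p.1 p.2‖ ^ 2)
      fun p => by positivity
    rw [Finset.sum_comm] at j2
    linarith [j1.trans hcol, j2.trans hcol]
  have hsq : (√ξ)⁻¹ * ξ = √ξ := by
    rw [inv_mul_eq_div, Real.div_sqrt]
  calc _ ≤ A * (√ξ * 2 + (√ξ)⁻¹ * (ξ * 1)) + B * (ξ * 1 + ξ * 1) := by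
        gcongr
        · exact h2.trans (by gcongr)
        · exact h1.trans (by gcongr)
        · exact h2.trans (by gcongr)
    _ = _ := by rw [mul_one, hsq]; ring

end SelfConsistent

/-! ### The self-consistent equation in expectation. -/

section SelfConsistentExpectation

open scoped Matrix Matrix.Norms.L2Operator

variable {N n : ℕ} {Ω : Type*} [MeasurableSpace Ω] {P : Measure Ω} {h : Fin n → Ω → ℂ}
  {e : Fin n → Fin N × Fin N} {K ξ : ℝ} {z : ℂ}

theorem norm_apply_le_one {v : Fin N → ℂ} (hv : ∑ i, ‖v i‖ ^ 2 ≤ 1) (i : Fin N) : ‖v i‖ ≤ 1 := by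
  refine (sq_le_one_iff₀ (norm_nonneg _)).1 (le_trans ?_ hv)
  exact Finset.single_le_sum (f := fun i => ‖v i‖ ^ 2) (fun _ _ => by positivity)
    (Finset.mem_univ i)

theorem norm_green_edge_apply_le (y : Fin n → ℂ) (hz : 1 ≤ z.im) (i j : Fin N) :
    ‖green (edgeMatrix e y) z i j‖ ≤ 1 :=
  (norm_entry_le _ _ _).trans (norm_green_le (edgeMatrix_isHermitian e y) hz)

theorem norm_green_edge_mulVec_le (y : Fin n → ℂ) (hz : 1 ≤ z.im) {v : Fin N → ℂ}
    (hv : ∑ i, ‖v i‖ ^ 2 ≤ 1) (i : Fin N) : ‖(green (edgeMatrix e y) z *ᵥ v) i‖ ≤ 1 :=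
  norm_apply_le_one (sum_green_mulVec_sq_le (edgeMatrix_isHermitian e y) hz hv) i

theorem IsEdgeFamily.measurable_pi (hE : IsEdgeFamily P h K) :
    Measurable fun ω => fun k => h k ω :=
  measurable_pi_lambda _ hE.measurable

/-- The reduced resolvent is independent of the entry: the first-order term has mean zero and the
second-order one factors through the variance. The pair `(φ, p)` is either the identity with `e k`
or conjugation with the swapped edge. The constant `11` is `6` from the expansion plus `5` from
replacing the reduced resolvent by the full one. -/
theorem IsEdgeFamily.norm_integral_edge_le [IsProbabilityMeasure P] (hE : IsEdgeFamily P h K)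
    (hK : K ≤ 1) (hz : 1 ≤ z.im) {v : Fin N → ℂ} (hv : ∑ i, ‖v i‖ ^ 2 ≤ 1) (k : Fin n)
    {φ : ℂ → ℂ} (hφ : Measurable φ) (hφn : ∀ c, ‖φ c‖ = ‖c‖) (hφ0 : ∫ ω, φ (h k ω) ∂P = 0)
    {p : Fin N × Fin N} (hp : ∀ c, pairMatrix p (φ c) = pairMatrix (e k) c) :
    ‖∫ ω, φ (h k ω) * (green (edgeMatrix e fun k => h k ω) z *ᵥ v) p.2 ∂P +
      ((∫ ω, ‖h k ω‖ ^ 2 ∂P : ℝ) : ℂ) * ∫ ω, green (edgeMatrix e fun k => h k ω) z p.2 p.2 *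
        (green (edgeMatrix e fun k => h k ω) z *ᵥ v) p.1 ∂P‖ ≤
      ∫ ω, (2 * K ^ 2 * ‖green (edgeMatrix e fun k => h k ω) z p.2 p.1‖ + 11 * K ^ 3) *
        (‖(green (edgeMatrix e fun k => h k ω) z *ᵥ v) p.1‖ +
          ‖(green (edgeMatrix e fun k => h k ω) z *ᵥ v) p.2‖) ∂P := by
  set y : Ω → Fin n → ℂ := fun ω k => h k ω with hy
  have hym : Measurable y := hE.measurable_pi
  have hum : Measurable fun y : Fin n → ℂ => Function.update y k (0 : ℂ) := by fun_prop
  set Gf : (Fin n → ℂ) → Matrix (Fin N) (Fin N) ℂ := fun y => green (edgeMatrix e y) z with hGf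
  have mG : ∀ i j, Measurable fun y => Gf y i j := measurable_green_edgeMatrix e z
  have mq : ∀ i, Measurable fun y => (Gf y *ᵥ v) i := measurable_green_mulVec e z v
  have bG : ∀ y i j, ‖Gf y i j‖ ≤ 1 := fun y i j => norm_green_edge_apply_le y hz i j
  have bq : ∀ y i, ‖(Gf y *ᵥ v) i‖ ≤ 1 := fun y i => norm_green_edge_mulVec_le y hz hv i
  set H : Ω → ℂ := fun ω => φ (h k ω) with hH
  have mH : Measurable H := hφ.comp (hE.measurable k)
  have bH : ∀ ω, ‖H ω‖ ≤ 1 := fun ω => by rw [hH, hφn]; exact (hE.norm_le k ω).trans hK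
  have mh := hE.measurable k
  set s : ℝ := ∫ ω, ‖h k ω‖ ^ 2 ∂P with hs
  have hs0 : 0 ≤ s := integral_nonneg fun ω => by positivity
  have hsK : s ≤ K ^ 2 := by
    have := integral_mono_of_nonneg (μ := P) (ae_of_all _ fun ω => sq_nonneg ‖h k ω‖)
      (integrable_const (K ^ 2)) (ae_of_all _ fun ω =>
        pow_le_pow_left₀ (norm_nonneg _) (hE.norm_le k ω) 2)
    simpa using this
  set y' : Ω → Fin n → ℂ := fun ω => Function.update (y ω) k 0 with hy'
  have hy'm : Measurable y' := hum.comp hym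
  have f1 : ∫ ω, H ω * (Gf (y' ω) *ᵥ v) p.2 ∂P = 0 := by
    have := integral_mul_update hE.measurable hE.indep (mq p.2) hφ k
    rw [hφ0, zero_mul] at this
    exact this
  have f2 : ∫ ω, ((‖h k ω‖ ^ 2 : ℝ) : ℂ) * (Gf (y' ω) p.2 p.2 * (Gf (y' ω) *ᵥ v) p.1) ∂P =
      (s : ℂ) * ∫ ω, Gf (y' ω) p.2 p.2 * (Gf (y' ω) *ᵥ v) p.1 ∂P := by
    have := integral_mul_update hE.measurable hE.indep ((mG p.2 p.2).mul (mq p.1))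
      (φ := fun c => ((‖c‖ ^ 2 : ℝ) : ℂ)) (by fun_prop) k
    rw [hs, ← integral_complex_ofReal]
    exact this
  have i1 : Integrable (fun ω => H ω * (Gf (y ω) *ᵥ v) p.2) P :=
    integrable_of_norm_le (C := 1) (mH.mul ((mq _).comp hym)).aestronglyMeasurable fun ω => by
      rw [norm_mul]; exact mul_le_one₀ (bH ω) (norm_nonneg _) (bq _ _)
  have i2 : Integrable (fun ω => H ω * (Gf (y' ω) *ᵥ v) p.2) P :=
    integrable_of_norm_le (C := 1) (mH.mul ((mq _).comp hy'm)).aestronglyMeasurable fun ω => by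
      rw [norm_mul]; exact mul_le_one₀ (bH ω) (norm_nonneg _) (bq _ _)
  have i3 : Integrable (fun ω => ((‖h k ω‖ ^ 2 : ℝ) : ℂ) *
      (Gf (y' ω) p.2 p.2 * (Gf (y' ω) *ᵥ v) p.1)) P :=
    integrable_of_norm_le (C := 1) (Measurable.aestronglyMeasurable (by
      exact (mh.norm.pow_const 2).complex_ofReal.mul
        (((mG _ _).comp hy'm).mul ((mq _).comp hy'm)))) fun ω => by
      rw [norm_mul, norm_mul, Complex.norm_real, norm_pow, norm_norm]
      exact mul_le_one₀ (pow_le_one₀ (norm_nonneg _) ((hE.norm_le k ω).trans hK))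
        (by positivity) (mul_le_one₀ (bG _ _ _) (norm_nonneg _) (bq _ _))
  have i4 : Integrable (fun ω => Gf (y ω) p.2 p.2 * (Gf (y ω) *ᵥ v) p.1) P :=
    integrable_of_norm_le (C := 1)
      (((mG _ _).comp hym).mul ((mq _).comp hym)).aestronglyMeasurable fun ω => by
      rw [norm_mul]; exact mul_le_one₀ (bG _ _ _) (norm_nonneg _) (bq _ _)
  have i5 : Integrable (fun ω => Gf (y' ω) p.2 p.2 * (Gf (y' ω) *ᵥ v) p.1) P :=
    integrable_of_norm_le (C := 1)
      (((mG _ _).comp hy'm).mul ((mq _).comp hy'm)).aestronglyMeasurable fun ω => by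
      rw [norm_mul]; exact mul_le_one₀ (bG _ _ _) (norm_nonneg _) (bq _ _)
  set S : Ω → ℝ := fun ω => ‖(Gf (y ω) *ᵥ v) p.1‖ + ‖(Gf (y ω) *ᵥ v) p.2‖ with hS
  have mS : Measurable S := ((mq _).comp hym).norm.add ((mq _).comp hym).norm
  have bS : ∀ ω, ‖S ω‖ ≤ 2 := fun ω => by
    rw [Real.norm_of_nonneg (by positivity)]
    have := bq (y ω) p.1
    have := bq (y ω) p.2
    simp only [hS]; linarith
  have i6 : Integrable S P := integrable_of_norm_le mS.aestronglyMeasurable bS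
  have i7 : ∀ A B : ℝ, Integrable (fun ω => (A * ‖Gf (y ω) p.2 p.1‖ + B) * S ω) P := fun A B =>
    integrable_of_norm_le (C := (|A| + |B|) * 2) (Measurable.aestronglyMeasurable (by
      exact ((((mG p.2 p.1).comp hym).norm.const_mul A).add_const B).mul mS)) fun ω => by
      rw [norm_mul]
      refine mul_le_mul ?_ (bS ω) (norm_nonneg _) (by positivity)
      refine (norm_add_le _ _).trans ?_
      rw [norm_mul, norm_norm]
      gcongr
      · exact mul_le_of_le_one_right (norm_nonneg _) (bG _ _ _)
      · rfl
  have hup : ∀ ω, Gf (y' ω) = Gf (y ω) + Gf (y' ω) * pairMatrix p (H ω) * Gf (y ω) := fun ω => by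
    rw [hH, hp]
    exact green_update_eq' e (y ω) k hz
  have nG : ∀ y, ‖Gf y‖ ≤ 1 := fun y => norm_green_le (edgeMatrix_isHermitian e y) hz
  have bHK : ∀ ω, ‖H ω‖ ≤ K := fun ω => by rw [hH, hφn]; exact hE.norm_le k ω
  have key1 : ‖∫ ω, (H ω * (Gf (y ω) *ᵥ v) p.2 - H ω * (Gf (y' ω) *ᵥ v) p.2 +
      ((‖h k ω‖ ^ 2 : ℝ) : ℂ) * (Gf (y' ω) p.2 p.2 * (Gf (y' ω) *ᵥ v) p.1)) ∂P‖ ≤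
      ∫ ω, (2 * K ^ 2 * ‖Gf (y ω) p.2 p.1‖ + 6 * K ^ 3) * S ω ∂P := by
    refine norm_integral_le_of_norm_le (i7 _ _) (ae_of_all _ fun ω => ?_)
    have := norm_edge_expansion_le (nG _) (nG _) (hup ω) (bHK ω) hK v
    rwa [show ‖H ω‖ = ‖h k ω‖ from hφn _] at this
  have key2 : ‖∫ ω, (Gf (y ω) p.2 p.2 * (Gf (y ω) *ᵥ v) p.1 -
      Gf (y' ω) p.2 p.2 * (Gf (y' ω) *ᵥ v) p.1) ∂P‖ ≤ ∫ ω, 5 * K * S ω ∂P :=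
    norm_integral_le_of_norm_le (i6.const_mul _) (ae_of_all _ fun ω =>
      norm_edge_main_sub_le (nG _) (nG _) (hup ω) (bHK ω) hK v)
  rw [integral_add (f := fun ω => H ω * (Gf (y ω) *ᵥ v) p.2 - H ω * (Gf (y' ω) *ᵥ v) p.2)
    (i1.sub i2) i3, integral_sub i1 i2, f1, f2] at key1
  rw [integral_sub i4 i5] at key2
  have hsplit : ∫ ω, H ω * (Gf (y ω) *ᵥ v) p.2 ∂P +
      (s : ℂ) * ∫ ω, Gf (y ω) p.2 p.2 * (Gf (y ω) *ᵥ v) p.1 ∂P =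
      (∫ ω, H ω * (Gf (y ω) *ᵥ v) p.2 ∂P - 0 +
        (s : ℂ) * ∫ ω, Gf (y' ω) p.2 p.2 * (Gf (y' ω) *ᵥ v) p.1 ∂P) +
      (s : ℂ) * (∫ ω, Gf (y ω) p.2 p.2 * (Gf (y ω) *ᵥ v) p.1 ∂P -
        ∫ ω, Gf (y' ω) p.2 p.2 * (Gf (y' ω) *ᵥ v) p.1 ∂P) := by ring
  change ‖∫ ω, H ω * (Gf (y ω) *ᵥ v) p.2 ∂P +
      (s : ℂ) * ∫ ω, Gf (y ω) p.2 p.2 * (Gf (y ω) *ᵥ v) p.1 ∂P‖ ≤ _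
  rw [hsplit]
  refine (norm_add_le _ _).trans ?_
  rw [norm_mul, Complex.norm_real, Real.norm_of_nonneg hs0]
  have hfin : ∫ ω, (2 * K ^ 2 * ‖Gf (y ω) p.2 p.1‖ + 11 * K ^ 3) * S ω ∂P =
      ∫ ω, (2 * K ^ 2 * ‖Gf (y ω) p.2 p.1‖ + 6 * K ^ 3) * S ω ∂P +
        K ^ 2 * ∫ ω, 5 * K * S ω ∂P := by
    rw [← integral_const_mul, ← integral_add (i7 _ _) ((i6.const_mul _).const_mul _)]
    congr 1; funext ω; ring
  refine le_trans ?_ hfin.ge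
  gcongr

/-- The self-consistent equation for the expected resolvent, up to a small error. -/
theorem IsEdgeFamily.norm_self_consistent_le [IsProbabilityMeasure P] (hE : IsEdgeFamily P h K)
    (hB : IsBandEdges e ξ) (hξ : 0 < ξ) (hK0 : 0 ≤ K) (hK : K ≤ 1) (hz : 1 ≤ z.im)
    {u v : Fin N → ℂ} (hu : ∑ i, ‖u i‖ ^ 2 ≤ 1) (hv : ∑ i, ‖v i‖ ^ 2 ≤ 1) :
    ‖star u ⬝ᵥ v + z * ∫ ω, star u ⬝ᵥ green (edgeMatrix e fun k => h k ω) z *ᵥ v ∂P +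
      ∑ k, ((∫ ω, ‖h k ω‖ ^ 2 ∂P : ℝ) : ℂ) *
        (star (u (e k).1) * ∫ ω, green (edgeMatrix e fun k => h k ω) z (e k).2 (e k).2 *
            (green (edgeMatrix e fun k => h k ω) z *ᵥ v) (e k).1 ∂P +
          star (u (e k).2) * ∫ ω, green (edgeMatrix e fun k => h k ω) z (e k).1 (e k).1 *
            (green (edgeMatrix e fun k => h k ω) z *ᵥ v) (e k).2 ∂P)‖ ≤
      6 * K ^ 2 * √ξ + 22 * K ^ 3 * ξ := by
  set y : Ω → Fin n → ℂ := fun ω k => h k ω with hy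
  have hym : Measurable y := hE.measurable_pi
  set Gf : (Fin n → ℂ) → Matrix (Fin N) (Fin N) ℂ := fun y => green (edgeMatrix e y) z with hGf
  have mG : ∀ i j, Measurable fun y => Gf y i j := measurable_green_edgeMatrix e z
  have mq : ∀ i, Measurable fun y => (Gf y *ᵥ v) i := measurable_green_mulVec e z v
  have bG : ∀ y i j, ‖Gf y i j‖ ≤ 1 := fun y i j => norm_green_edge_apply_le y hz i j
  have bq : ∀ y i, ‖(Gf y *ᵥ v) i‖ ≤ 1 := fun y i => norm_green_edge_mulVec_le y hz hv i
  have nG : ∀ y, ‖Gf y‖ ≤ 1 := fun y => norm_green_le (edgeMatrix_isHermitian e y) hz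
  have mh := hE.measurable
  have bh : ∀ k ω, ‖h k ω‖ ≤ 1 := fun k ω => (hE.norm_le k ω).trans hK
  have j1 : ∀ k i, Integrable (fun ω => h k ω * (Gf (y ω) *ᵥ v) i) P := fun k i =>
    integrable_of_norm_le (C := 1) ((mh k).mul ((mq _).comp hym)).aestronglyMeasurable fun ω => by
      rw [norm_mul]; exact mul_le_one₀ (bh k ω) (norm_nonneg _) (bq _ _)
  have j2 : ∀ k i, Integrable (fun ω => star (h k ω) * (Gf (y ω) *ᵥ v) i) P := fun k i =>
    integrable_of_norm_le (C := 1) (Measurable.aestronglyMeasurable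
      (by exact (continuous_star.measurable.comp (mh k)).mul ((mq _).comp hym))) fun ω => by
      rw [norm_mul, norm_star]; exact mul_le_one₀ (bh k ω) (norm_nonneg _) (bq _ _)
  -- This is `1 + z G = H G`, with `H` written as a sum over edges.
  have hid : ∀ ω, star u ⬝ᵥ v + z * (star u ⬝ᵥ Gf (y ω) *ᵥ v) =
      ∑ k, (star (u (e k).1) * (h k ω * (Gf (y ω) *ᵥ v) (e k).2) +
        star (u (e k).2) * (star (h k ω) * (Gf (y ω) *ᵥ v) (e k).1)) := fun ω => by
    rw [← edgeMatrix_dotProduct e (y ω) u]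
    have h1 := sub_mul_green (edgeMatrix_isHermitian e (y ω)) hz
    rw [sub_mul, sub_eq_iff_eq_add, smul_mul_assoc, one_mul] at h1
    rw [Matrix.mulVec_mulVec, h1, Matrix.add_mulVec, dotProduct_add, Matrix.one_mulVec,
      Matrix.smul_mulVec, dotProduct_smul, smul_eq_mul]
  have hint : Integrable (fun ω => star u ⬝ᵥ Gf (y ω) *ᵥ v) P :=
    integrable_of_norm_le (C := 1)
      ((measurable_dotProduct_green e z u v).comp hym).aestronglyMeasurable fun ω =>
        norm_dotProduct_green_le (edgeMatrix_isHermitian e _) hz hu hv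
  have hE1 : star u ⬝ᵥ v + z * ∫ ω, star u ⬝ᵥ Gf (y ω) *ᵥ v ∂P =
      ∑ k, (star (u (e k).1) * ∫ ω, h k ω * (Gf (y ω) *ᵥ v) (e k).2 ∂P +
        star (u (e k).2) * ∫ ω, star (h k ω) * (Gf (y ω) *ᵥ v) (e k).1 ∂P) := by
    have h1 : star u ⬝ᵥ v + z * ∫ ω, star u ⬝ᵥ Gf (y ω) *ᵥ v ∂P =
        ∫ ω, (star u ⬝ᵥ v + z * (star u ⬝ᵥ Gf (y ω) *ᵥ v)) ∂P := by
      rw [integral_add (integrable_const _) (hint.const_mul z), integral_const_mul]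
      simp
    rw [h1]
    simp only [hid]
    have j3 : ∀ k, Integrable (fun ω => star (u (e k).1) * (h k ω * (Gf (y ω) *ᵥ v) (e k).2) +
        star (u (e k).2) * (star (h k ω) * (Gf (y ω) *ᵥ v) (e k).1)) P := fun k =>
      ((j1 k _).const_mul _).add ((j2 k _).const_mul _)
    rw [integral_finsetSum _ fun k _ => j3 k]
    refine Finset.sum_congr rfl fun k _ => ?_
    rw [integral_add ((j1 k _).const_mul _) ((j2 k _).const_mul _), integral_const_mul,
      integral_const_mul]
  rw [hE1, ← Finset.sum_add_distrib]
  set er : Fin N → Fin N → Fin n → Ω → ℝ := fun i j k ω =>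
    (2 * K ^ 2 * ‖Gf (y ω) j i‖ + 11 * K ^ 3) *
      (‖(Gf (y ω) *ᵥ v) (e k).1‖ + ‖(Gf (y ω) *ᵥ v) (e k).2‖) with her
  have ier : ∀ i j k, Integrable (er i j k) P := fun i j k =>
    integrable_of_norm_le (C := (2 * K ^ 2 * 1 + 11 * K ^ 3) * (1 + 1))
      (Measurable.aestronglyMeasurable (by
        exact ((((mG j i).comp hym).norm.const_mul _).add_const _).mul
          (((mq _).comp hym).norm.add ((mq _).comp hym).norm))) fun ω => by
      rw [Real.norm_of_nonneg (by positivity)]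
      have := bG (y ω) j i
      have := bq (y ω) (e k).1
      have := bq (y ω) (e k).2
      simp only [her]
      gcongr
  have hsw : ∀ a b : ℝ, a + b = b + a := add_comm
  have hk : ∀ k, ‖star (u (e k).1) * ∫ ω, h k ω * (Gf (y ω) *ᵥ v) (e k).2 ∂P +
        star (u (e k).2) * ∫ ω, star (h k ω) * (Gf (y ω) *ᵥ v) (e k).1 ∂P +
        ((∫ ω, ‖h k ω‖ ^ 2 ∂P : ℝ) : ℂ) *
        (star (u (e k).1) * ∫ ω, Gf (y ω) (e k).2 (e k).2 * (Gf (y ω) *ᵥ v) (e k).1 ∂P +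
          star (u (e k).2) * ∫ ω, Gf (y ω) (e k).1 (e k).1 * (Gf (y ω) *ᵥ v) (e k).2 ∂P)‖ ≤
      ‖u (e k).1‖ * (∫ ω, er (e k).1 (e k).2 k ω ∂P) +
        ‖u (e k).2‖ * ∫ ω, er (e k).2 (e k).1 k ω ∂P := fun k => by
    have k1 := hE.norm_integral_edge_le hK hz hv k (φ := id) measurable_id (fun _ => rfl)
      (hE.centered k) (p := e k) (fun _ => rfl)
    have k2 := hE.norm_integral_edge_le hK hz hv k (φ := star) (by fun_prop) (fun _ => norm_star _)
      (by
        have := integral_conj (μ := P) (f := h k)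
        rw [hE.centered k, map_zero] at this
        exact this) (p := (e k).swap) (fun c => pairMatrix_swap _ _)
    simp only [Prod.fst_swap, Prod.snd_swap, id] at k1 k2
    have e1 : ∀ a b c d s x w : ℂ, a * x + b * w + s * (a * c + b * d) =
        a * (x + s * c) + b * (w + s * d) := fun a b c d s x w => by ring
    rw [e1]
    refine (norm_add_le _ _).trans ?_
    rw [norm_mul, norm_mul, norm_star, norm_star]
    refine add_le_add (mul_le_mul_of_nonneg_left k1 (norm_nonneg _))
      (mul_le_mul_of_nonneg_left (k2.trans (le_of_eq ?_)) (norm_nonneg _))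
    congr 1; funext ω
    rw [hsw ‖(green (edgeMatrix e fun k => h k ω) z *ᵥ v) (e k).2‖]
  refine (norm_sum_le _ _).trans ((Finset.sum_le_sum fun k _ => hk k).trans ?_)
  simp only [← integral_const_mul]
  have hcomb : ∀ k, (∫ ω, ‖u (e k).1‖ * er (e k).1 (e k).2 k ω ∂P) +
      ∫ ω, ‖u (e k).2‖ * er (e k).2 (e k).1 k ω ∂P =
      ∫ ω, (‖u (e k).1‖ * er (e k).1 (e k).2 k ω + ‖u (e k).2‖ * er (e k).2 (e k).1 k ω) ∂P :=
    fun k => (integral_add ((ier _ _ _).const_mul _) ((ier _ _ _).const_mul _)).symm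
  simp only [hcomb]
  have ier2 : ∀ k, Integrable (fun ω => ‖u (e k).1‖ * er (e k).1 (e k).2 k ω +
      ‖u (e k).2‖ * er (e k).2 (e k).1 k ω) P := fun k =>
    ((ier _ _ _).const_mul _).add ((ier _ _ _).const_mul _)
  rw [← integral_finsetSum _ fun k _ => ier2 k]
  have hpt : ∀ ω, ∑ k, (‖u (e k).1‖ * er (e k).1 (e k).2 k ω +
      ‖u (e k).2‖ * er (e k).2 (e k).1 k ω) ≤ 6 * K ^ 2 * √ξ + 22 * K ^ 3 * ξ := fun ω => by
    have := hB.sum_error_le hξ (nG (y ω)) hu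
      (sum_green_mulVec_sq_le (edgeMatrix_isHermitian e (y ω)) hz hv)
      (A := 2 * K ^ 2) (B := 11 * K ^ 3) (by positivity) (by positivity)
    refine this.trans (le_of_eq (by ring))
  have := integral_mono (μ := P) (integrable_finsetSum Finset.univ fun k _ => ier2 k)
    (integrable_const _) hpt
  refine this.trans (le_of_eq (by simp))

end SelfConsistentExpectation

/-! ### From the self-consistent equation to the scalar limit `m`. -/

section ExpectedGreen

open scoped Matrix Matrix.Norms.L2Operator

variable {N n : ℕ} {Ω : Type*} [MeasurableSpace Ω] {P : Measure Ω} {h : Fin n → Ω → ℂ}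
  {e : Fin n → Fin N × Fin N} {K ξ : ℝ} {z : ℂ}

theorem star_single_dotProduct_mulVec (A : Matrix (Fin N) (Fin N) ℂ) (j : Fin N) :
    star (Pi.single j 1 : Fin N → ℂ) ⬝ᵥ A *ᵥ Pi.single j 1 = A j j := by
  have : star (Pi.single j 1 : Fin N → ℂ) = Pi.single j 1 := by
    rw [← Pi.single_star, star_one]
  rw [this, single_dotProduct]
  simp

theorem vertexSum_ofReal (e : Fin n → Fin N × Fin N) (s : Fin n → ℝ) (i : Fin N) :
    vertexSum e (fun k => (s k : ℂ)) i = ((vertexSum e s i : ℝ) : ℂ) := by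
  simp only [vertexSum, Complex.ofReal_sum, Complex.ofReal_add, apply_ite Complex.ofReal,
    Complex.ofReal_zero]

theorem IsEdgeFamily.integral_dotProduct_green_pow_le [IsProbabilityMeasure P]
    (hE : IsEdgeFamily P h K) (hB : IsBandEdges e ξ) (hξ : 0 ≤ ξ) (hK0 : 0 ≤ K) (hz : 1 ≤ z.im)
    {u v : Fin N → ℂ} (hu : ∑ i, ‖u i‖ ^ 2 ≤ 1) (hv : ∑ i, ‖v i‖ ^ 2 ≤ 1) (p : ℕ) :
    ∫ ω, ‖star u ⬝ᵥ green (edgeMatrix e fun k => h k ω) z *ᵥ v -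
      ∫ ω', star u ⬝ᵥ green (edgeMatrix e fun k => h k ω') z *ᵥ v ∂P‖ ^ (2 * p) ∂P ≤
      momentConst p * (8 * K ^ 2 + 16 * ξ * K ^ 4) ^ p :=
  integral_norm_pow_le hE.measurable hE.indep
    (F := fun y => star u ⬝ᵥ green (edgeMatrix e y) z *ᵥ v)
    (measurable_dotProduct_green e z u v)
    (fun y => norm_dotProduct_green_le (edgeMatrix_isHermitian e y) hz hu hv)
    (fun ω => hB.sum_update_sq_le hξ hz hu hv (fun k => hE.norm_le k ω) hK0) p

theorem IsEdgeFamily.integral_diag_green_sq_le [IsProbabilityMeasure P]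
    (hE : IsEdgeFamily P h K) (hB : IsBandEdges e ξ) (hξ : 0 ≤ ξ) (hK0 : 0 ≤ K) (hz : 1 ≤ z.im)
    (j : Fin N) :
    ∫ ω, ‖green (edgeMatrix e fun k => h k ω) z j j -
      ∫ ω', green (edgeMatrix e fun k => h k ω') z j j ∂P‖ ^ 2 ∂P ≤
      3 * (8 * K ^ 2 + 16 * ξ * K ^ 4) := by
  have := hE.integral_dotProduct_green_pow_le hB hξ hK0 hz (sum_norm_single_sq j).le
    (sum_norm_single_sq j).le 1
  simp only [star_single_dotProduct_mulVec, mul_one, pow_one] at this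
  refine this.trans (le_of_eq ?_)
  norm_num [momentConst]

/-- If all diagonal entries of the expected resolvent are close to `m`, the self-consistent
equation becomes a scalar equation. -/
theorem IsEdgeFamily.norm_scalar_equation_le [IsProbabilityMeasure P]
    (hE : IsEdgeFamily P h K) (hB : IsBandEdges e ξ) (hξ : 0 < ξ) (hK0 : 0 < K) (hK : K ≤ 1)
    (hz : 1 ≤ z.im) {σ ρ Λ : ℝ}
    (hτ : ∀ i, |vertexSum e (fun k => ∫ ω, ‖h k ω‖ ^ 2 ∂P) i - σ ^ 2| ≤ ρ) {m : ℂ}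
    (hm : ‖m‖ ≤ 1)
    (hΛ : ∀ j, ‖∫ ω, green (edgeMatrix e fun k => h k ω) z j j ∂P - m‖ ≤ Λ) (hΛ0 : 0 ≤ Λ)
    (hρ : 0 ≤ ρ) {u v : Fin N → ℂ} (hu : ∑ i, ‖u i‖ ^ 2 ≤ 1) (hv : ∑ i, ‖v i‖ ^ 2 ≤ 1) :
    ‖star u ⬝ᵥ v + (z + σ ^ 2 * m) *
      ∫ ω, star u ⬝ᵥ green (edgeMatrix e fun k => h k ω) z *ᵥ v ∂P‖ ≤
      6 * K ^ 2 * √ξ + 22 * K ^ 3 * ξ +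
        (σ ^ 2 + ρ) * (2 * √(8 * K ^ 2 + 16 * ξ * K ^ 4) + Λ) + ρ := by
  set y : Ω → Fin n → ℂ := fun ω k => h k ω with hy
  have hym : Measurable y := hE.measurable_pi
  set Gf : (Fin n → ℂ) → Matrix (Fin N) (Fin N) ℂ := fun y => green (edgeMatrix e y) z with hGf
  have mG : ∀ i j, Measurable fun y => Gf y i j := measurable_green_edgeMatrix e z
  have mq : ∀ i, Measurable fun y => (Gf y *ᵥ v) i := measurable_green_mulVec e z v
  have bG : ∀ y i j, ‖Gf y i j‖ ≤ 1 := fun y i j => norm_green_edge_apply_le y hz i j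
  have bq : ∀ y i, ‖(Gf y *ᵥ v) i‖ ≤ 1 := fun y i => norm_green_edge_mulVec_le y hz hv i
  set s : Fin n → ℝ := fun k => ∫ ω, ‖h k ω‖ ^ 2 ∂P with hs
  have hs0 : ∀ k, 0 ≤ s k := fun k => integral_nonneg fun ω => by positivity
  set Q := 8 * K ^ 2 + 16 * ξ * K ^ 4 with hQ
  have hQ0 : 0 < Q := by positivity
  set t := √Q with ht
  have ht0 : 0 < t := Real.sqrt_pos.2 hQ0
  have htQ : t ^ 2 = Q := Real.sq_sqrt hQ0.le
  set T := σ ^ 2 + ρ with hT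
  have hT0 : 0 ≤ T := by positivity
  set g : Fin N → ℂ := fun j => ∫ ω, Gf (y ω) j j ∂P with hg
  set qb : Fin N → ℂ := fun i => ∫ ω, (Gf (y ω) *ᵥ v) i ∂P with hqb
  set Eq2 : Fin N → ℝ := fun i => ∫ ω, ‖(Gf (y ω) *ᵥ v) i‖ ^ 2 ∂P with hEq2
  have iG : ∀ j, Integrable (fun ω => Gf (y ω) j j) P := fun j =>
    integrable_of_norm_le (C := 1) ((mG j j).comp hym).aestronglyMeasurable fun ω => bG _ _ _
  have iq : ∀ i, Integrable (fun ω => (Gf (y ω) *ᵥ v) i) P := fun i =>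
    integrable_of_norm_le (C := 1) ((mq i).comp hym).aestronglyMeasurable fun ω => bq _ _
  have iGq : ∀ j i, Integrable (fun ω => Gf (y ω) j j * (Gf (y ω) *ᵥ v) i) P := fun j i =>
    integrable_of_norm_le (C := 1)
      (((mG j j).comp hym).mul ((mq i).comp hym)).aestronglyMeasurable fun ω => by
        rw [norm_mul]; exact mul_le_one₀ (bG _ _ _) (norm_nonneg _) (bq _ _)
  have iq2 : ∀ i, Integrable (fun ω => ‖(Gf (y ω) *ᵥ v) i‖ ^ 2) P := fun i =>
    integrable_of_norm_le (C := 1) (((mq i).comp hym).norm.pow_const 2).aestronglyMeasurable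
      fun ω => by
        rw [norm_pow, norm_norm]; exact pow_le_one₀ (norm_nonneg _) (bq _ _)
  have iX2 : ∀ j, Integrable (fun ω => ‖Gf (y ω) j j - g j‖ ^ 2) P := fun j =>
    integrable_of_norm_le (C := (1 + ‖g j‖) ^ 2)
      ((((mG j j).comp hym).sub_const _).norm.pow_const 2).aestronglyMeasurable fun ω => by
        rw [norm_pow, norm_norm]
        exact pow_le_pow_left₀ (norm_nonneg _)
          ((norm_sub_le _ _).trans (add_le_add (bG _ _ _) le_rfl)) 2
  have hEq2s : ∑ i, Eq2 i ≤ 1 := by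
    simp only [hEq2]
    rw [← integral_finsetSum _ fun i _ => iq2 i]
    have := integral_mono (μ := P) (integrable_finsetSum Finset.univ fun i _ => iq2 i)
      (integrable_const 1) fun ω =>
        sum_green_mulVec_sq_le (edgeMatrix_isHermitian e (y ω)) hz hv
    simpa using this
  have hEq20 : ∀ i, 0 ≤ Eq2 i := fun i => integral_nonneg fun ω => by positivity
  have hqbE : ∀ i, ‖qb i‖ ^ 2 ≤ Eq2 i := fun i =>
    norm_integral_sq_le ((mq i).comp hym) fun ω => bq _ _
  have hX2 : ∀ j, ∫ ω, ‖Gf (y ω) j j - g j‖ ^ 2 ∂P ≤ 3 * t ^ 2 := fun j => by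
    rw [htQ]
    exact hE.integral_diag_green_sq_le hB hξ.le hK0.le hz j
  have hYq : ∫ ω, star u ⬝ᵥ Gf (y ω) *ᵥ v ∂P = ∑ i, star (u i) * qb i := by
    simp only [dotProduct, Pi.star_apply]
    rw [integral_finsetSum _ fun i _ => (iq i).const_mul _]
    simp only [integral_const_mul, hqb]
  -- `G j j - m` splits into a fluctuation with second moment at most `3 t²` and a bias at most `Λ`.
  -- AM–GM with weight `t` turns the fluctuation into an error linear in `t`. The bound involves
  -- only vertex `i`, through quantities of bounded `ℓ¹` sum, so it can be summed over edges by
  -- vertex.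
  have hpair : ∀ i j, ‖star (u i) * ∫ ω, Gf (y ω) j j * (Gf (y ω) *ᵥ v) i ∂P -
      m * (star (u i) * qb i)‖ ≤
      (3 / 2 * t + Λ / 2) * ‖u i‖ ^ 2 + (t / 2 + Λ / 2) * Eq2 i := fun i j => by
    have e1 : star (u i) * ∫ ω, Gf (y ω) j j * (Gf (y ω) *ᵥ v) i ∂P - m * (star (u i) * qb i) =
        ∫ ω, star (u i) * ((Gf (y ω) j j - m) * (Gf (y ω) *ᵥ v) i) ∂P := by
      rw [integral_const_mul]
      simp only [sub_mul]
      rw [integral_sub (iGq j i) ((iq i).const_mul m), integral_const_mul]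
      simp only [hqb]; ring
    rw [e1]
    have hbound : ∀ ω, ‖star (u i) * ((Gf (y ω) j j - m) * (Gf (y ω) *ᵥ v) i)‖ ≤
        ((2 * t)⁻¹ * ‖u i‖ ^ 2 * ‖Gf (y ω) j j - g j‖ ^ 2 + t / 2 * ‖(Gf (y ω) *ᵥ v) i‖ ^ 2) +
        (Λ / 2 * ‖u i‖ ^ 2 + Λ / 2 * ‖(Gf (y ω) *ᵥ v) i‖ ^ 2) := fun ω => by
      rw [norm_mul, norm_mul, norm_star]
      have h1 : ‖Gf (y ω) j j - m‖ ≤ ‖Gf (y ω) j j - g j‖ + Λ :=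
        (norm_sub_le_norm_sub_add_norm_sub _ (g j) _).trans (by gcongr; exact hΛ j)
      set a := ‖u i‖
      set x := ‖Gf (y ω) j j - g j‖
      set c := ‖(Gf (y ω) *ᵥ v) i‖
      have ha : 0 ≤ a := norm_nonneg _
      have hc : 0 ≤ c := norm_nonneg _
      have h2 : a * x * c ≤ (2 * t)⁻¹ * a ^ 2 * x ^ 2 + t / 2 * c ^ 2 := by
        have : (2 * t)⁻¹ * a ^ 2 * x ^ 2 + t / 2 * c ^ 2 - a * x * c =
            (2 * t)⁻¹ * (a * x - t * c) ^ 2 := by field_simp; ring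
        have h3 : 0 ≤ (2 * t)⁻¹ * (a * x - t * c) ^ 2 := by positivity
        linarith
      have h4 : Λ * (a * c) ≤ Λ * ((a ^ 2 + c ^ 2) / 2) := by
        gcongr; linarith [two_mul_le_add_sq a c]
      calc _ ≤ a * ((x + Λ) * c) := by gcongr
        _ = a * x * c + Λ * (a * c) := by ring
        _ ≤ _ := by linarith
    have j1 := ((iX2 j).const_mul ((2 * t)⁻¹ * ‖u i‖ ^ 2)).add ((iq2 i).const_mul (t / 2))
    have j2 := (integrable_const (μ := P) (Λ / 2 * ‖u i‖ ^ 2)).add ((iq2 i).const_mul (Λ / 2))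
    refine (norm_integral_le_of_norm_le (j1.add j2) (ae_of_all _ hbound)).trans ?_
    rw [integral_add' j1 j2, integral_add' ((iX2 j).const_mul _) ((iq2 i).const_mul _),
      integral_add' (integrable_const _) ((iq2 i).const_mul _), integral_const,
      integral_const_mul, integral_const_mul, integral_const_mul]
    have h5 : (2 * t)⁻¹ * ‖u i‖ ^ 2 * ∫ ω, ‖Gf (y ω) j j - g j‖ ^ 2 ∂P ≤
        3 / 2 * t * ‖u i‖ ^ 2 := by
      calc _ ≤ (2 * t)⁻¹ * ‖u i‖ ^ 2 * (3 * t ^ 2) := by gcongr; exact hX2 j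
        _ = _ := by field_simp
    simp only [probReal_univ, one_smul]
    change _ + _ * Eq2 i + (_ + _ * Eq2 i) ≤ _
    linarith
  have hA := hE.norm_self_consistent_le hB hξ hK0.le hK hz hu hv
  set W := ∑ k, ((s k : ℝ) : ℂ) *
        (star (u (e k).1) * ∫ ω, Gf (y ω) (e k).2 (e k).2 * (Gf (y ω) *ᵥ v) (e k).1 ∂P +
          star (u (e k).2) * ∫ ω, Gf (y ω) (e k).1 (e k).1 * (Gf (y ω) *ᵥ v) (e k).2 ∂P) with hW
  set Y := ∫ ω, star u ⬝ᵥ Gf (y ω) *ᵥ v ∂P with hY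
  change ‖star u ⬝ᵥ v + z * Y + W‖ ≤ _ at hA
  have hτT : ∀ i, vertexSum e s i ≤ T := fun i => by
    have := (abs_le.1 (hτ i)).2
    rw [hT]; linarith
  have hW1 : ‖W - m * ∑ k, ((s k : ℝ) : ℂ) *
      (star (u (e k).1) * qb (e k).1 + star (u (e k).2) * qb (e k).2)‖ ≤ T * (2 * t + Λ) := by
    rw [hW, Finset.mul_sum, ← Finset.sum_sub_distrib]
    set B : Fin N → ℝ := fun i =>
      (3 / 2 * t + Λ / 2) * ‖u i‖ ^ 2 + (t / 2 + Λ / 2) * Eq2 i with hBdef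
    have hB0 : ∀ i, 0 ≤ B i := fun i => by
      have := hEq20 i
      positivity
    have hBs : ∑ i, B i ≤ 2 * t + Λ := by
      simp only [hBdef]
      rw [Finset.sum_add_distrib, ← Finset.mul_sum, ← Finset.mul_sum]
      calc _ ≤ (3 / 2 * t + Λ / 2) * 1 + (t / 2 + Λ / 2) * 1 := by gcongr
        _ = _ := by ring
    refine (norm_sum_le _ _).trans ?_
    calc _ ≤ ∑ k, s k * (B (e k).1 + B (e k).2) := by
          refine Finset.sum_le_sum fun k _ => ?_
          have e2 : ∀ S a b c d : ℂ, S * (a + b) - m * (S * (c + d)) =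
              S * ((a - m * c) + (b - m * d)) := fun S a b c d => by ring
          rw [e2, norm_mul, Complex.norm_real, Real.norm_of_nonneg (hs0 k)]
          refine mul_le_mul_of_nonneg_left ?_ (hs0 k)
          exact (norm_add_le _ _).trans (add_le_add (hpair _ _) (hpair _ _))
      _ ≤ T * ∑ i, B i := sum_edge_vertex_le hτT hB0
      _ ≤ _ := by gcongr
  -- Grouping edges by vertex produces the total variance at each vertex, which is `σ²` up to `ρ`.
  have hW2 : ‖∑ k, ((s k : ℝ) : ℂ) * (star (u (e k).1) * qb (e k).1 +
      star (u (e k).2) * qb (e k).2) - σ ^ 2 * Y‖ ≤ ρ := by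
    rw [sum_edge_mul_eq e (fun k => ((s k : ℝ) : ℂ)) (fun i => star (u i) * qb i), hYq,
      Finset.mul_sum, ← Finset.sum_sub_distrib]
    refine (norm_sum_le _ _).trans ?_
    calc _ ≤ ∑ i, ρ * ((‖u i‖ ^ 2 + Eq2 i) / 2) := by
          refine Finset.sum_le_sum fun i _ => ?_
          rw [vertexSum_ofReal, ← sub_mul, norm_mul, norm_mul, norm_star]
          have h1 : ‖((vertexSum e s i : ℝ) : ℂ) - (σ : ℂ) ^ 2‖ ≤ ρ := by
            rw [← Complex.ofReal_pow, ← Complex.ofReal_sub, Complex.norm_real]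
            exact hτ i
          have h2 : ‖u i‖ * ‖qb i‖ ≤ (‖u i‖ ^ 2 + Eq2 i) / 2 := by
            linarith [two_mul_le_add_sq ‖u i‖ ‖qb i‖, hqbE i]
          gcongr
      _ = ρ * ((∑ i, ‖u i‖ ^ 2 + ∑ i, Eq2 i) / 2) := by
          rw [← Finset.mul_sum, ← Finset.sum_div, Finset.sum_add_distrib]
      _ ≤ ρ * ((1 + 1) / 2) := by gcongr
      _ = ρ := by ring
  set V := ∑ k, ((s k : ℝ) : ℂ) * (star (u (e k).1) * qb (e k).1 +
      star (u (e k).2) * qb (e k).2) with hV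
  have e3 : star u ⬝ᵥ v + (z + σ ^ 2 * m) * Y =
      (star u ⬝ᵥ v + z * Y + W) - (W - m * V) - m * (V - σ ^ 2 * Y) := by ring
  rw [e3]
  refine (norm_sub_le _ _).trans (add_le_add ((norm_sub_le _ _).trans (add_le_add hA hW1)) ?_)
  rw [norm_mul]
  calc ‖m‖ * _ ≤ 1 * ρ := by gcongr
    _ = ρ := one_mul _

/-- The expected resolvent is close, as a quadratic form, to the scalar `m`. -/
theorem IsEdgeFamily.norm_expected_green_sub_le [IsProbabilityMeasure P]
    (hE : IsEdgeFamily P h K) (hB : IsBandEdges e ξ) (hξ : 0 < ξ) (hK0 : 0 < K) (hK : K ≤ 1)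
    (hz : 1 ≤ z.im) {σ ρ : ℝ}
    (hτ : ∀ i, |vertexSum e (fun k => ∫ ω, ‖h k ω‖ ^ 2 ∂P) i - σ ^ 2| ≤ ρ) {m : ℂ}
    (hm : ‖m‖ ≤ 1) (hmz : m * (z + σ ^ 2 * m) = -1) (hmT : ‖m‖ * (σ ^ 2 + ρ) ≤ 1 / 2)
    (hρ : 0 ≤ ρ) {u v : Fin N → ℂ} (hu : ∑ i, ‖u i‖ ^ 2 ≤ 1) (hv : ∑ i, ‖v i‖ ^ 2 ≤ 1) :
    ‖∫ ω, star u ⬝ᵥ green (edgeMatrix e fun k => h k ω) z *ᵥ v ∂P - m * (star u ⬝ᵥ v)‖ ≤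
      2 * (6 * K ^ 2 * √ξ + 22 * K ^ 3 * ξ +
        2 * (σ ^ 2 + ρ) * √(8 * K ^ 2 + 16 * ξ * K ^ 4) + ρ) := by
  set d : Fin N → ℂ := fun j => ∫ ω, green (edgeMatrix e fun k => h k ω) z j j ∂P - m with hd
  set E := 6 * K ^ 2 * √ξ + 22 * K ^ 3 * ξ +
        2 * (σ ^ 2 + ρ) * √(8 * K ^ 2 + 16 * ξ * K ^ 4) + ρ with hEdef
  have hE0 : 0 ≤ E := by positivity
  have key : ∀ u v : Fin N → ℂ, ∑ i, ‖u i‖ ^ 2 ≤ 1 → ∑ i, ‖v i‖ ^ 2 ≤ 1 →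
      ‖∫ ω, star u ⬝ᵥ green (edgeMatrix e fun k => h k ω) z *ᵥ v ∂P - m * (star u ⬝ᵥ v)‖ ≤
        E + ‖d‖ / 2 := fun u v hu hv => by
    have h1 := hE.norm_scalar_equation_le hB hξ hK0 hK hz hτ hm (Λ := ‖d‖)
      (fun j => norm_le_pi_norm d j) (norm_nonneg _) hρ hu hv
    set Y := ∫ ω, star u ⬝ᵥ green (edgeMatrix e fun k => h k ω) z *ᵥ v ∂P
    have e1 : Y - m * (star u ⬝ᵥ v) = -(m * (star u ⬝ᵥ v + (z + σ ^ 2 * m) * Y)) := by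
      linear_combination Y * hmz
    rw [e1, norm_neg, norm_mul]
    calc _ ≤ ‖m‖ * (E + (σ ^ 2 + ρ) * ‖d‖) := by
          gcongr
          refine h1.trans (le_of_eq ?_)
          rw [hEdef]; ring
      _ = ‖m‖ * E + (‖m‖ * (σ ^ 2 + ρ)) * ‖d‖ := by ring
      _ ≤ 1 * E + 1 / 2 * ‖d‖ := by gcongr
      _ = _ := by ring
  -- With `u = v` a basis vector the estimate bounds the diagonal error by half of itself plus `E`.
  -- The condition `‖m‖ (σ² + ρ) ≤ 1/2` makes this close without any continuity argument in `z`.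
  have hd2 : ‖d‖ ≤ 2 * E := by
    have : ‖d‖ ≤ E + ‖d‖ / 2 := by
      refine (pi_norm_le_iff_of_nonneg (by positivity)).2 fun j => ?_
      have := key _ _ (sum_norm_single_sq j).le (sum_norm_single_sq j).le
      simp only [star_single_dotProduct_mulVec] at this
      have h1 : star (Pi.single j 1 : Fin N → ℂ) ⬝ᵥ Pi.single j 1 = 1 := by
        have := star_single_dotProduct_mulVec (1 : Matrix (Fin N) (Fin N) ℂ) j
        rwa [Matrix.one_mulVec, Matrix.one_apply_eq] at this
      rwa [h1, mul_one] at this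
    linarith
  refine (key u v hu hv).trans ?_
  linarith

end ExpectedGreen

/-! ### Weak convergence from Stieltjes transforms on the imaginary axis. -/

section Stieltjes

open BoundedContinuousFunction

theorem norm_ofReal_sub_mul_I_ge (x c : ℝ) : |c| ≤ ‖(x : ℂ) - c * Complex.I‖ := by
  have := Complex.abs_im_le_norm ((x : ℂ) - c * Complex.I)
  simpa using this

theorem ofReal_sub_mul_I_ne_zero (x : ℝ) {c : ℝ} (hc : c ≠ 0) : (x : ℂ) - c * Complex.I ≠ 0 := by
  rw [← norm_pos_iff]
  exact (abs_pos.2 hc).trans_le (norm_ofReal_sub_mul_I_ge x c)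

/-- The function `x ↦ (x - c i)⁻¹`. -/
noncomputable def cauchyFun (c : ℝ) (hc : c ≠ 0) : ℝ →ᵇ ℂ :=
  BoundedContinuousFunction.ofNormedAddCommGroup (fun x : ℝ => ((x : ℂ) - c * Complex.I)⁻¹)
    (Continuous.inv₀ (by fun_prop) fun x => ofReal_sub_mul_I_ne_zero x hc) |c|⁻¹ fun x => by
      rw [norm_inv]
      exact inv_anti₀ (abs_pos.2 hc) (norm_ofReal_sub_mul_I_ge x c)

theorem cauchyFun_apply (c : ℝ) (hc : c ≠ 0) (x : ℝ) :
    cauchyFun c hc x = ((x : ℂ) - c * Complex.I)⁻¹ := rfl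

theorem norm_cauchyFun_le (c : ℝ) (hc : c ≠ 0) : ‖cauchyFun c hc‖ ≤ |c|⁻¹ :=
  BoundedContinuousFunction.norm_ofNormedAddCommGroup_le _ (by positivity) _

theorem star_cauchyFun (c : ℝ) (hc : c ≠ 0) :
    star (cauchyFun c hc) = cauchyFun (-c) (neg_ne_zero.2 hc) := by
  ext x
  simp [cauchyFun_apply]

/-- The scalar resolvent identity. For `c ≠ c'` it makes a product of two such functions a linear
combination of them, so linear information controls the generated algebra. -/
theorem cauchyFun_sub (c c' : ℝ) (hc : c ≠ 0) (hc' : c' ≠ 0) :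
    cauchyFun c hc - cauchyFun c' hc' =
      (((c - c' : ℝ) : ℂ) * Complex.I) • (cauchyFun c hc * cauchyFun c' hc') := by
  ext x
  have h1 := ofReal_sub_mul_I_ne_zero x hc
  have h2 := ofReal_sub_mul_I_ne_zero x hc'
  simp only [BoundedContinuousFunction.coe_sub, Pi.sub_apply, cauchyFun_apply,
    BoundedContinuousFunction.coe_smul, BoundedContinuousFunction.coe_mul, Pi.mul_apply,
    smul_eq_mul]
  rw [inv_sub_inv h1 h2, div_eq_mul_inv, mul_inv]
  push_cast
  ring

theorem norm_cauchyFun_sub_le (c c' : ℝ) (hc : c ≠ 0) (hc' : c' ≠ 0) :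
    ‖cauchyFun c hc - cauchyFun c' hc'‖ ≤ |c - c'| * (|c|⁻¹ * |c'|⁻¹) := by
  rw [cauchyFun_sub, norm_smul, norm_mul, Complex.norm_I, mul_one, Complex.norm_real,
    Real.norm_eq_abs]
  gcongr
  exact (norm_mul_le _ _).trans (mul_le_mul (norm_cauchyFun_le _ _) (norm_cauchyFun_le _ _)
    (norm_nonneg _) (by positivity))

/-- The functions `x ↦ (x - c i)⁻¹` with `|c|` rational and larger than `η₀`. -/
def cauchySet (η₀ : ℝ) : Set (ℝ →ᵇ ℂ) :=
  {f | ∃ (q : ℚ) (hq : (q : ℝ) ≠ 0), η₀ < |(q : ℝ)| ∧ f = cauchyFun q hq}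

/-- A closed submodule that contains `1` and the functions `x ↦ (x - c i)⁻¹` contains the algebra
that they generate. -/
theorem adjoin_cauchySet_subset {η₀ : ℝ} (hη₀ : 0 < η₀) (V : Submodule ℂ (ℝ →ᵇ ℂ))
    (hV : IsClosed (V : Set (ℝ →ᵇ ℂ))) (h1 : 1 ∈ V) (hr : cauchySet η₀ ⊆ V) {f : ℝ →ᵇ ℂ}
    (hf : f ∈ Algebra.adjoin ℂ (cauchySet η₀)) : f ∈ V := by
  -- `V` itself need not be stable under products; the closed span of the generators is, and it lies
  -- in `V`.
  set M0 : Submodule ℂ (ℝ →ᵇ ℂ) := Submodule.span ℂ ({1} ∪ cauchySet η₀) with hM0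
  set M := M0.topologicalClosure with hM
  have hMV : M ≤ V := Submodule.topologicalClosure_minimal _
    (Submodule.span_le.2 (Set.union_subset (by simpa using h1) hr)) hV
  have hsub : M0 ≤ M := Submodule.le_topologicalClosure _
  have hMc : IsClosed (M : Set (ℝ →ᵇ ℂ)) := Submodule.isClosed_topologicalClosure _
  have hrM : ∀ g ∈ cauchySet η₀, g ∈ M := fun g hg => hsub (Submodule.subset_span (Or.inr hg))
  have hne : ∀ (q q' : ℚ) (hq : (q : ℝ) ≠ 0) (hq' : (q' : ℝ) ≠ 0), η₀ < |(q : ℝ)| →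
      η₀ < |(q' : ℝ)| → q ≠ q' → cauchyFun q hq * cauchyFun q' hq' ∈ M := by
    intro q q' hq hq' h h' hqq
    have hc : (((q : ℝ) - q' : ℝ) : ℂ) * Complex.I ≠ 0 := by
      refine mul_ne_zero ?_ Complex.I_ne_zero
      rw [Complex.ofReal_ne_zero, sub_ne_zero]
      exact_mod_cast hqq
    have : cauchyFun q hq * cauchyFun q' hq' = ((((q : ℝ) - q' : ℝ) : ℂ) * Complex.I)⁻¹ •
        (cauchyFun q hq - cauchyFun q' hq') := by
      rw [cauchyFun_sub, smul_smul, inv_mul_cancel₀ hc, one_smul]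
    rw [this]
    exact M.smul_mem _ (M.sub_mem (hrM _ ⟨q, hq, h, rfl⟩) (hrM _ ⟨q', hq', h', rfl⟩))
  -- A square is not covered by the resolvent identity; it is a uniform limit of products with a
  -- nearby distinct parameter `s`. Taking `|s|` slightly larger than `|q|` keeps `s` admissible.
  have hsq : ∀ (q : ℚ) (hq : (q : ℝ) ≠ 0), η₀ < |(q : ℝ)| →
      cauchyFun q hq * cauchyFun q hq ∈ M := by
    intro q hq h
    rw [← SetLike.mem_coe, ← hMc.closure_eq, Metric.mem_closure_iff]
    intro ε hε
    have hq0 : 0 < |(q : ℝ)| := hη₀.trans h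
    set C := |(q : ℝ)|⁻¹ * (|(q : ℝ)|⁻¹ * η₀⁻¹) with hC
    have hC0 : 0 < C := by positivity
    obtain ⟨q', hq'1, hq'2⟩ := exists_rat_btwn
      (show |(q : ℝ)| < |(q : ℝ)| + ε / C by linarith [div_pos hε hC0])
    have hpos : (0 : ℝ) < q' := hq0.trans hq'1
    obtain ⟨s, hs1, hs2, hs3⟩ : ∃ s : ℚ, |(s : ℝ)| = q' ∧ |(q : ℝ) - s| < ε / C ∧ q ≠ s := by
      rcases le_total 0 (q : ℝ) with h0 | h0
      · rw [abs_of_nonneg h0] at hq'1 hq'2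
        refine ⟨q', abs_of_pos hpos, ?_, fun hh => ?_⟩
        · rw [abs_lt]; constructor <;> linarith
        · rw [hh] at hq'1; exact lt_irrefl _ hq'1
      · rw [abs_of_nonpos h0] at hq'1 hq'2
        refine ⟨-q', by push_cast; rw [abs_neg, abs_of_pos hpos], ?_, fun hh => ?_⟩
        · push_cast; rw [abs_lt]; constructor <;> linarith
        · rw [hh] at hq'1; push_cast at hq'1; linarith
    have hs0 : (s : ℝ) ≠ 0 := by rw [← abs_pos, hs1]; exact hpos
    have hsη : η₀ < |(s : ℝ)| := by rw [hs1]; linarith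
    refine ⟨_, hne q s hq hs0 h hsη hs3, ?_⟩
    rw [dist_eq_norm, ← mul_sub]
    calc _ ≤ |(q : ℝ)|⁻¹ * (|(q : ℝ) - s| * (|(q : ℝ)|⁻¹ * |(s : ℝ)|⁻¹)) :=
          (norm_mul_le _ _).trans (mul_le_mul (norm_cauchyFun_le _ _)
            (norm_cauchyFun_sub_le _ _ _ _) (norm_nonneg _) (by positivity))
      _ ≤ |(q : ℝ)|⁻¹ * (|(q : ℝ) - s| * (|(q : ℝ)|⁻¹ * η₀⁻¹)) := by gcongr
      _ = |(q : ℝ) - s| * C := by rw [hC]; ring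
      _ < ε / C * C := by gcongr
      _ = ε := by field_simp
  have hmulM : ∀ g ∈ cauchySet η₀, ∀ m ∈ M, g * m ∈ M := by
    rintro g ⟨q, hq, h, rfl⟩
    have h0 : M0 ≤ M.comap (LinearMap.mulLeft ℂ (cauchyFun q hq)) := by
      refine Submodule.span_le.2 ?_
      rintro x (rfl | ⟨q', hq', h', rfl⟩)
      · simpa using hrM _ ⟨q, hq, h, rfl⟩
      · simp only [SetLike.mem_coe, Submodule.mem_comap, LinearMap.mulLeft_apply]
        rcases eq_or_ne q q' with rfl | hqq
        · exact hsq q hq h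
        · exact hne q q' hq hq' h h' hqq
    have h1 : M ≤ M.comap (LinearMap.mulLeft ℂ (cauchyFun q hq)) := by
      refine Submodule.topologicalClosure_minimal _ h0 ?_
      exact hMc.preimage (continuous_const_mul (cauchyFun q hq))
    exact fun m hm => h1 hm
  have hall : ∀ m ∈ M, f * m ∈ M := by
    induction hf using Algebra.adjoin_induction with
    | mem x hx => exact hmulM x hx
    | algebraMap c => intro m hm; rw [← Algebra.smul_def]; exact M.smul_mem c hm
    | add x y _ _ hx hy => intro m hm; rw [add_mul]; exact M.add_mem (hx m hm) (hy m hm)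
    | mul x y _ _ hx hy => intro m hm; rw [mul_assoc]; exact hx _ (hy m hm)
  have := hall 1 (hsub (Submodule.subset_span (Or.inl rfl)))
  rw [mul_one] at this
  exact hMV this

/-- The bounded continuous functions whose integrals converge form a closed submodule. -/
theorem exists_submodule_tendsto (ν : ℕ → ProbabilityMeasure ℝ) (μ : ProbabilityMeasure ℝ) :
    ∃ V : Submodule ℂ (ℝ →ᵇ ℂ), IsClosed (V : Set (ℝ →ᵇ ℂ)) ∧ ∀ f, f ∈ V ↔
      Tendsto (fun n => ∫ x, f x ∂(ν n : Measure ℝ)) atTop (𝓝 (∫ x, f x ∂(μ : Measure ℝ))) := by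
  have hi : ∀ (ρ : ProbabilityMeasure ℝ) (f : ℝ →ᵇ ℂ), Integrable f (ρ : Measure ℝ) :=
    fun ρ f => f.integrable _
  refine ⟨{ carrier := {f | Tendsto (fun n => ∫ x, f x ∂(ν n : Measure ℝ)) atTop
              (𝓝 (∫ x, f x ∂(μ : Measure ℝ)))}
            add_mem' := fun {f g} hf hg => ?_
            zero_mem' := by simp
            smul_mem' := fun c f hf => ?_ }, ?_, fun f => Iff.rfl⟩
  · simp only [Set.mem_ofPred_eq, BoundedContinuousFunction.coe_add, Pi.add_apply] at hf hg ⊢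
    simp only [fun ρ => integral_add (hi ρ f) (hi ρ g)]
    exact hf.add hg
  · simp only [Set.mem_ofPred_eq, BoundedContinuousFunction.coe_smul, smul_eq_mul] at hf ⊢
    simp only [integral_const_mul]
    exact hf.const_mul c
  · rw [← closure_subset_iff_isClosed]
    intro f hf
    change Tendsto _ _ _
    rw [Metric.tendsto_atTop]
    intro ε hε
    obtain ⟨g, hg, hfg⟩ := Metric.mem_closure_iff.1 hf (ε / 3) (by positivity)
    obtain ⟨n₀, hn₀⟩ := Metric.tendsto_atTop.1 (show Tendsto _ _ _ from hg) (ε / 3) (by positivity)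
    refine ⟨n₀, fun n hn => ?_⟩
    have hdist : ∀ ρ : ProbabilityMeasure ℝ,
        dist (∫ x, f x ∂(ρ : Measure ℝ)) (∫ x, g x ∂(ρ : Measure ℝ)) < ε / 3 := fun ρ => by
      rw [dist_eq_norm, ← integral_sub (hi ρ f) (hi ρ g)]
      refine lt_of_le_of_lt ?_ hfg
      have := norm_integral_le_of_norm_le_const (μ := (ρ : Measure ℝ))
        (ae_of_all _ fun x => (dist_eq_norm (f x) (g x)).symm.le.trans
          (BoundedContinuousFunction.dist_coe_le_dist x))
      simpa using this
    calc _ ≤ dist (∫ x, f x ∂(ν n : Measure ℝ)) (∫ x, g x ∂(ν n : Measure ℝ)) +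
          dist (∫ x, g x ∂(ν n : Measure ℝ)) (∫ x, g x ∂(μ : Measure ℝ)) +
          dist (∫ x, g x ∂(μ : Measure ℝ)) (∫ x, f x ∂(μ : Measure ℝ)) := dist_triangle4 _ _ _ _
      _ < ε / 3 + ε / 3 + ε / 3 := by
          gcongr
          · exact hdist _
          · exact hn₀ n hn
          · rw [dist_comm]; exact hdist _
      _ = ε := by ring

theorem im_cauchyFun (c : ℝ) (hc : c ≠ 0) (x : ℝ) :
    (cauchyFun c hc x).im = c / (x ^ 2 + c ^ 2) := by
  rw [cauchyFun_apply, Complex.inv_im]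
  simp [Complex.normSq_apply]
  ring

/-- The imaginary part is the Poisson kernel `c / (x² + c²)`, so the transform measures how much
mass lies far from the origin on the scale `c`. -/
theorem one_sub_mul_im_integral_cauchyFun (ρ : ProbabilityMeasure ℝ) (c : ℝ) (hc : c ≠ 0) :
    1 - c * (∫ x, cauchyFun c hc x ∂(ρ : Measure ℝ)).im =
      ∫ x, x ^ 2 / (x ^ 2 + c ^ 2) ∂(ρ : Measure ℝ) := by
  have hi : Integrable (cauchyFun c hc) (ρ : Measure ℝ) := (cauchyFun c hc).integrable _
  have hi2 : Integrable (fun x => (cauchyFun c hc x).im) (ρ : Measure ℝ) := hi.im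
  have him : (∫ x, cauchyFun c hc x ∂(ρ : Measure ℝ)).im =
      ∫ x, (cauchyFun c hc x).im ∂(ρ : Measure ℝ) := (integral_im hi).symm
  have hval : ∀ x : ℝ, x ^ 2 / (x ^ 2 + c ^ 2) = 1 - c * (cauchyFun c hc x).im := fun x => by
    rw [im_cauchyFun]
    have : x ^ 2 + c ^ 2 ≠ 0 := by positivity
    field_simp; ring
  simp only [hval]
  rw [integral_sub (integrable_const _) (hi2.const_mul c), integral_const_mul, him]
  simp

/-- Where `|x| > c` the ratio `x² / (x² + c²)` exceeds `1/2`. This yields tightness directly from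
Stieltjes transforms. -/
theorem measure_lt_norm_le (ρ : ProbabilityMeasure ℝ) {c : ℝ} (hc : 0 < c) :
    (ρ : Measure ℝ) {x | c < ‖x‖} ≤
      ENNReal.ofReal (2 * (1 - c * (∫ x, cauchyFun c hc.ne' x ∂(ρ : Measure ℝ)).im)) := by
  have hms : MeasurableSet {x : ℝ | c < ‖x‖} := measurableSet_lt measurable_const measurable_norm
  have hint : Integrable (fun x : ℝ => 2 * (x ^ 2 / (x ^ 2 + c ^ 2))) (ρ : Measure ℝ) := by
    refine Integrable.of_bound (C := 2) (Measurable.aestronglyMeasurable (by fun_prop))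
      (ae_of_all _ fun x => ?_)
    rw [Real.norm_of_nonneg (by positivity)]
    have : x ^ 2 / (x ^ 2 + c ^ 2) ≤ 1 :=
      div_le_one_of_le₀ (by nlinarith [sq_nonneg c]) (by positivity)
    linarith
  rw [one_sub_mul_im_integral_cauchyFun, ← integral_const_mul, ofReal_integral_eq_lintegral_ofReal
    hint (ae_of_all _ fun x => by positivity), ← lintegral_indicator_one hms]
  refine lintegral_mono fun x => ?_
  by_cases hx : c < ‖x‖
  · simp only [Set.indicator_of_mem (show x ∈ {x : ℝ | c < ‖x‖} from hx), Pi.one_apply]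
    rw [← ENNReal.ofReal_one]
    apply ENNReal.ofReal_le_ofReal
    have h2 : c ^ 2 < x ^ 2 := by
      rw [← sq_abs x]
      exact pow_lt_pow_left₀ hx hc.le two_ne_zero
    rw [← mul_div_assoc, le_div_iff₀ (by positivity)]
    linarith
  · rw [Set.indicator_of_notMem (show x ∉ {x : ℝ | c < ‖x‖} from hx)]
    exact zero_le

/-- Convergence of the Stieltjes transforms along the imaginary axis implies weak convergence. -/
theorem tendsto_of_stieltjes {ν : ℕ → ProbabilityMeasure ℝ} {μ : ProbabilityMeasure ℝ} {η₀ : ℝ}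
    (hη₀ : 0 < η₀) (h : ∀ q : ℚ, η₀ < (q : ℝ) →
      Tendsto (fun n => ∫ x, ((x : ℂ) - (q : ℝ) * Complex.I)⁻¹ ∂(ν n : Measure ℝ)) atTop
        (𝓝 (∫ x, ((x : ℂ) - (q : ℝ) * Complex.I)⁻¹ ∂(μ : Measure ℝ)))) :
    Tendsto ν atTop (𝓝 μ) := by
  obtain ⟨V, hVc, hV⟩ := exists_submodule_tendsto ν μ
  have hpos : ∀ (q : ℚ) (hq : (q : ℝ) ≠ 0), η₀ < (q : ℝ) → cauchyFun q hq ∈ V := fun q hq hlt =>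
    (hV _).2 (h q hlt)
  have hset : cauchySet η₀ ⊆ V := by
    rintro f ⟨q, hq, hlt, rfl⟩
    rcases le_total 0 (q : ℝ) with h0 | h0
    · rw [abs_of_nonneg h0] at hlt; exact hpos q hq hlt
    · rw [abs_of_nonpos h0] at hlt
      -- The lower half axis is obtained from the upper one by complex conjugation.
      have h1 := (hV _).1 (hpos (-q) (by push_cast; exact neg_ne_zero.2 hq) (by push_cast; exact hlt))
      have h2 := (Complex.continuous_conj.tendsto _).comp h1
      refine (hV _).2 ?_
      have hc : ∀ ρ : ProbabilityMeasure ℝ, (starRingEnd ℂ)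
          (∫ x, cauchyFun (-q : ℚ) (by push_cast; exact neg_ne_zero.2 hq) x ∂(ρ : Measure ℝ)) =
          ∫ x, cauchyFun q hq x ∂(ρ : Measure ℝ) := fun ρ => by
        rw [← integral_conj]
        congr 1; funext x
        simp [cauchyFun_apply, sub_eq_add_neg]
      simpa only [Function.comp_def, hc] using h2
  have hV1 : (1 : ℝ →ᵇ ℂ) ∈ V := (hV _).2 (by simp)
  have hstar : star (cauchySet η₀) = cauchySet η₀ := by
    have hsub : star (cauchySet η₀) ⊆ cauchySet η₀ := by
      rintro f ⟨q, hq, hlt, hf⟩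
      refine ⟨-q, by push_cast; exact neg_ne_zero.2 hq, by push_cast; rwa [abs_neg], ?_⟩
      rw [← star_star f, hf, star_cauchyFun]
      congr 1; push_cast; rfl
    refine Set.Subset.antisymm hsub ?_
    have := Set.star_subset_star.2 hsub
    rwa [star_star] at this
  set A : StarSubalgebra ℂ (ℝ →ᵇ ℂ) := StarAlgebra.adjoin ℂ (cauchySet η₀) with hA
  have hAmem : ∀ f ∈ A, f ∈ Algebra.adjoin ℂ (cauchySet η₀) := fun f hf => by
    have : f ∈ A.toSubalgebra := hf
    rwa [hA, StarAlgebra.adjoin_toSubalgebra, hstar, Set.union_self] at this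
  obtain ⟨q₀, hq₀, -⟩ := exists_rat_btwn (lt_add_one η₀)
  have hq₀0 : (q₀ : ℝ) ≠ 0 := (hη₀.trans hq₀).ne'
  refine ProbabilityMeasure.tendsto_of_tight_of_separatesPoints ℂ ?_ (A := A) ?_ fun g hg =>
    (hV g).1 (adjoin_cauchySet_subset hη₀ V hVc hV1 hset (hAmem g hg))
  · refine isTightMeasureSet_range_of_tendsto_limsup_measure_norm_gt
      (μ := fun n => (ν n : Measure ℝ)) ?_
    rw [ENNReal.tendsto_nhds_zero]
    intro ε hε
    obtain ⟨δ, hδ0, hδ⟩ : ∃ δ : ℝ, 0 < δ ∧ ENNReal.ofReal δ ≤ ε := by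
      rcases eq_or_ne ε ⊤ with rfl | hne
      · exact ⟨1, one_pos, le_top⟩
      · exact ⟨ε.toReal, ENNReal.toReal_pos hε.ne' hne, by rw [ENNReal.ofReal_toReal hne]⟩
    have hlim : Tendsto (fun c : ℕ => ∫ x, x ^ 2 / (x ^ 2 + (c : ℝ) ^ 2) ∂(μ : Measure ℝ)) atTop
        (𝓝 (∫ x, (0 : ℝ) ∂(μ : Measure ℝ))) := by
      refine tendsto_integral_of_dominated_convergence (fun _ => 1)
        (fun c => (Measurable.aestronglyMeasurable (by fun_prop))) (integrable_const _)
        (fun c => ae_of_all _ fun x => ?_) (ae_of_all _ fun x => ?_)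
      · rw [Real.norm_of_nonneg (by positivity)]
        exact div_le_one_of_le₀ (by nlinarith [sq_nonneg (c : ℝ)]) (by positivity)
      · have h1 : Tendsto (fun c : ℕ => x ^ 2 + (c : ℝ) ^ 2) atTop atTop :=
          tendsto_atTop_add_const_left _ _
            ((tendsto_pow_atTop two_ne_zero).comp tendsto_natCast_atTop_atTop)
        exact h1.const_div_atTop (x ^ 2)
    rw [integral_zero] at hlim
    -- `c` is chosen so that the tail bound for `μ` is below `δ`, and above `η₀` so that convergence
    -- at `ic` carries this bound over to `ν n` for large `n`.
    obtain ⟨c, hc1, hc2⟩ := ((hlim.eventually (gt_mem_nhds (show (0 : ℝ) < δ / 4 by positivity))).and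
      (eventually_gt_atTop ⌈η₀⌉₊)).exists
    have hcη : η₀ < (c : ℝ) := (Nat.le_ceil _).trans_lt (by exact_mod_cast hc2)
    have hc0 : (0 : ℝ) < c := hη₀.trans hcη
    have hconv := (hV _).1 (hpos (c : ℚ) (by exact_mod_cast hc0.ne') (by exact_mod_cast hcη))
    have hconv2 : Tendsto (fun n => 2 * (1 - c * (∫ x, cauchyFun c hc0.ne' x ∂(ν n : Measure ℝ)).im))
        atTop (𝓝 (2 * (1 - c * (∫ x, cauchyFun c hc0.ne' x ∂(μ : Measure ℝ)).im))) := by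
      have := (Complex.continuous_im.tendsto _).comp hconv
      simp only [Rat.cast_natCast] at this
      exact (tendsto_const_nhds.sub (this.const_mul _)).const_mul _
    have hlimval : 2 * (1 - c * (∫ x, cauchyFun c hc0.ne' x ∂(μ : Measure ℝ)).im) < δ := by
      rw [one_sub_mul_im_integral_cauchyFun]; linarith
    filter_upwards [eventually_ge_atTop (c : ℝ)] with r hr
    refine le_trans (limsup_le_of_le (by isBoundedDefault) ?_) hδ
    filter_upwards [hconv2.eventually (gt_mem_nhds hlimval)] with n hn
    calc (ν n : Measure ℝ) {x | r < ‖x‖} ≤ (ν n : Measure ℝ) {x | (c : ℝ) < ‖x‖} :=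
          measure_mono fun x (hx : r < ‖x‖) => hr.trans_lt hx
      _ ≤ _ := measure_lt_norm_le (ν n) hc0
      _ ≤ _ := ENNReal.ofReal_le_ofReal hn.le
  · intro x y hxy
    refine ⟨cauchyFun q₀ hq₀0, ⟨toContinuousMapStarₐ ℂ (cauchyFun q₀ hq₀0), ?_, rfl⟩, ?_⟩
    · refine ⟨cauchyFun q₀ hq₀0, ?_, rfl⟩
      exact StarAlgebra.subset_adjoin ℂ _
        ⟨q₀, hq₀0, by rwa [abs_of_pos (hη₀.trans hq₀)], rfl⟩
    · simp only [cauchyFun_apply, ne_eq, inv_inj, sub_left_inj]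
      exact_mod_cast hxy

end Stieltjes

/-! ### Poisson-kernel integrals for the semicircle density. -/

section SemicircleIntegrals

/-- The denominator `1 + γ² - 2 γ cos t`. -/
noncomputable def poissonDenom (γ : ℂ) (t : ℝ) : ℂ := 1 + γ ^ 2 - 2 * γ * (Real.cos t : ℂ)

/-- The factorization bounds the denominator away from zero when `‖γ‖ < 1`, also for complex `γ`. -/
theorem poissonDenom_eq (γ : ℂ) (t : ℝ) : poissonDenom γ t =
    (1 - γ * Complex.exp (t * Complex.I)) * (1 - γ * Complex.exp (-(t * Complex.I))) := by
  have h : Complex.exp (t * Complex.I) * Complex.exp (-(t * Complex.I)) = 1 := by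
    rw [← Complex.exp_add, add_neg_cancel, Complex.exp_zero]
  rw [poissonDenom, Complex.ofReal_cos, Complex.cos, ← neg_mul] at *
  linear_combination (-γ ^ 2) * h

theorem le_norm_poissonDenom {γ : ℂ} (hγ : ‖γ‖ < 1) (t : ℝ) :
    (1 - ‖γ‖) ^ 2 ≤ ‖poissonDenom γ t‖ := by
  have h : ∀ s : ℝ, 1 - ‖γ‖ ≤ ‖1 - γ * Complex.exp (s * Complex.I)‖ := fun s => by
    have := norm_sub_norm_le 1 (γ * Complex.exp (s * Complex.I))
    rwa [norm_one, norm_mul, Complex.norm_exp_ofReal_mul_I, mul_one] at this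
  have h2 := h (-t)
  rw [Complex.ofReal_neg, neg_mul] at h2
  rw [poissonDenom_eq, norm_mul, sq]
  exact mul_le_mul (h t) h2 (by linarith) (norm_nonneg _)

theorem poissonDenom_ne_zero {γ : ℂ} (hγ : ‖γ‖ < 1) (t : ℝ) : poissonDenom γ t ≠ 0 := by
  rw [← norm_pos_iff]
  exact lt_of_lt_of_le (by have := sub_pos.2 hγ; positivity) (le_norm_poissonDenom hγ t)

theorem continuous_poissonDenom (γ : ℂ) : Continuous (poissonDenom γ) := by
  unfold poissonDenom; fun_prop

theorem integral_cos_natCast_mul (k : ℕ) (hk : k ≠ 0) :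
    ∫ t in (0 : ℝ)..Real.pi, Real.cos (k * t) = 0 := by
  have hk' : (k : ℝ) ≠ 0 := by exact_mod_cast hk
  rw [intervalIntegral.integral_comp_mul_left (fun x => Real.cos x) hk', integral_cos]
  simp [Real.sin_nat_mul_pi]

theorem integral_sin_mul_sin (n : ℕ) :
    ∫ t in (0 : ℝ)..Real.pi, Real.sin t * Real.sin ((n + 1) * t) =
      if n = 0 then Real.pi / 2 else 0 := by
  have h : ∀ t : ℝ, Real.sin t * Real.sin ((n + 1) * t) =
      (Real.cos (n * t) - Real.cos (((n + 2 : ℕ) : ℝ) * t)) / 2 := fun t => by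
    have h1 : (n : ℝ) * t = (n + 1) * t - t := by ring
    have h2 : ((n + 2 : ℕ) : ℝ) * t = (n + 1) * t + t := by push_cast; ring
    rw [h1, h2, Real.cos_sub, Real.cos_add]; ring
  simp only [h]
  rw [intervalIntegral.integral_div, intervalIntegral.integral_sub
    (Continuous.intervalIntegrable (by fun_prop) _ _)
    (Continuous.intervalIntegrable (by fun_prop) _ _), integral_cos_natCast_mul (n + 2) (by omega)]
  split_ifs with hn
  · subst hn; simp
  · rw [integral_cos_natCast_mul n hn]; simp

/-- The integral of `sin t sin (n t) / (1 + γ² - 2 γ cos t)` over `[0, π]`. -/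
noncomputable def poissonInt (γ : ℂ) (n : ℕ) : ℂ :=
  ∫ t in (0 : ℝ)..Real.pi, ((Real.sin t * Real.sin (n * t) : ℝ) : ℂ) / poissonDenom γ t

theorem poissonInt_integrable {γ : ℂ} (hγ : ‖γ‖ < 1) (f : ℝ → ℂ) (hf : Continuous f) (a b : ℝ) :
    IntervalIntegrable (fun t => f t / poissonDenom γ t) volume a b :=
  (hf.div (continuous_poissonDenom γ) (poissonDenom_ne_zero hγ)).intervalIntegrable _ _

/-- Combine `sin((n+2)t) + sin(nt) = 2 cos t sin((n+1)t)` with the fact that `2γ cos t` is `1 + γ²`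
minus the denominator; the cancelled denominator leaves an orthogonality integral of sines. -/
theorem poissonInt_rec {γ : ℂ} (hγ : ‖γ‖ < 1) (n : ℕ) :
    γ * (poissonInt γ (n + 2) + poissonInt γ n) =
      (1 + γ ^ 2) * poissonInt γ (n + 1) - if n = 0 then (Real.pi / 2 : ℂ) else 0 := by
  have hi : ∀ k : ℕ, IntervalIntegrable (fun t => ((Real.sin t * Real.sin (k * t) : ℝ) : ℂ) /
      poissonDenom γ t) volume 0 Real.pi := fun k =>
    poissonInt_integrable hγ _ (by fun_prop) _ _
  have h0 : ∫ t in (0 : ℝ)..Real.pi, ((Real.sin t * Real.sin (((n + 1 : ℕ) : ℝ) * t) : ℝ) : ℂ) =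
      if n = 0 then (Real.pi / 2 : ℂ) else 0 := by
    rw [intervalIntegral.integral_ofReal]
    have := integral_sin_mul_sin n
    push_cast at this ⊢
    rw [this]
    split_ifs <;> simp
  rw [← h0]
  unfold poissonInt
  rw [← intervalIntegral.integral_add (hi _) (hi _), ← intervalIntegral.integral_const_mul,
    ← intervalIntegral.integral_const_mul, ← intervalIntegral.integral_sub ((hi _).const_mul _)
      (Continuous.intervalIntegrable (by fun_prop) _ _)]
  refine intervalIntegral.integral_congr fun t _ => ?_
  have hD := poissonDenom_ne_zero hγ t
  have hs : (Real.sin (((n + 2 : ℕ) : ℝ) * t) : ℂ) + (Real.sin (n * t) : ℂ) =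
      2 * (Real.cos t : ℂ) * (Real.sin (((n + 1 : ℕ) : ℝ) * t) : ℂ) := by
    have h1 : ((n + 2 : ℕ) : ℝ) * t = ((n + 1 : ℕ) : ℝ) * t + t := by push_cast; ring
    have h2 : (n : ℝ) * t = ((n + 1 : ℕ) : ℝ) * t - t := by push_cast; ring
    rw [h1, h2, Real.sin_add, Real.sin_sub]
    push_cast; ring
  have e : 1 + γ ^ 2 = poissonDenom γ t + 2 * γ * (Real.cos t : ℂ) := by
    rw [poissonDenom]; ring
  rw [e, ← add_div, Complex.ofReal_mul, Complex.ofReal_mul, Complex.ofReal_mul, ← mul_add, hs]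
  field_simp
  ring

theorem norm_poissonInt_le {γ : ℂ} (hγ : ‖γ‖ < 1) (n : ℕ) :
    ‖poissonInt γ n‖ ≤ ((1 - ‖γ‖) ^ 2)⁻¹ * Real.pi := by
  have := intervalIntegral.norm_integral_le_of_norm_le_const (a := 0) (b := Real.pi)
    (C := ((1 - ‖γ‖) ^ 2)⁻¹)
    (f := fun t => ((Real.sin t * Real.sin (n * t) : ℝ) : ℂ) / poissonDenom γ t) fun t _ => by
      have hpos : 0 < (1 - ‖γ‖) ^ 2 := by have := sub_pos.2 hγ; positivity
      rw [norm_div, Complex.norm_real, div_eq_mul_inv, Real.norm_eq_abs, abs_mul]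
      calc _ ≤ 1 * 1 * ((1 - ‖γ‖) ^ 2)⁻¹ := by
            gcongr
            · exact Real.abs_sin_le_one _
            · exact Real.abs_sin_le_one _
            · exact le_norm_poissonDenom hγ t
        _ = _ := by ring
  rwa [sub_zero, abs_of_pos Real.pi_pos] at this

/-- Write `J n` for the integral. Away from `n = 0` the recursion makes `γ ^ n (J (n+2) - γ J
(n+1))` independent of `n`. The `J n` are bounded and `‖γ‖ < 1`, so this constant is zero and `J 2 =
γ J 1`; the recursion at `n = 0` then determines `J 1`. -/
theorem poissonInt_one {γ : ℂ} (hγ : ‖γ‖ < 1) : poissonInt γ 1 = Real.pi / 2 := by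
  have h0 : poissonInt γ 0 = 0 := by simp [poissonInt]
  set B := ((1 - ‖γ‖) ^ 2)⁻¹ * Real.pi with hB
  have hC : ∀ n : ℕ, poissonInt γ 2 - γ * poissonInt γ 1 =
      γ ^ n * (poissonInt γ (n + 2) - γ * poissonInt γ (n + 1)) := fun n => by
    induction n with
    | zero => simp
    | succ n ih =>
      rw [ih, pow_succ, mul_assoc]
      congr 1
      have := poissonInt_rec hγ (n + 1)
      rw [if_neg (Nat.succ_ne_zero n), sub_zero] at this
      linear_combination -this
  have hlim : Tendsto (fun n : ℕ => ‖γ‖ ^ n * (B + ‖γ‖ * B)) atTop (𝓝 0) := by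
    have := (tendsto_pow_atTop_nhds_zero_of_lt_one (norm_nonneg γ) hγ).mul_const (B + ‖γ‖ * B)
    rwa [zero_mul] at this
  have h2 : poissonInt γ 2 - γ * poissonInt γ 1 = 0 := by
    rw [← norm_le_zero_iff]
    refine ge_of_tendsto' hlim fun n => ?_
    rw [hC n, norm_mul, norm_pow]
    gcongr
    refine (norm_sub_le _ _).trans (add_le_add (norm_poissonInt_le hγ _) ?_)
    rw [norm_mul]
    gcongr
    exact norm_poissonInt_le hγ _
  have h3 := poissonInt_rec hγ 0
  rw [if_pos rfl, h0] at h3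
  linear_combination γ * h2 - h3

end SemicircleIntegrals

/-! ### Total mass and Stieltjes transform of the limit measure. -/

section LimitMeasure

theorem ofReal_poissonDenom (β t : ℝ) :
    poissonDenom β t = ((1 + β ^ 2 - 2 * β * Real.cos t : ℝ) : ℂ) := by
  rw [poissonDenom]; push_cast; ring

/-- For real `β` the denominator is `(β - cos t)² + sin² t`. This covers the critical case `|β| =
1`, where it is not bounded away from zero, and bounds the integrand `sin² t / D` by `1`. -/
theorem poissonDenom_pos (β : ℝ) {t : ℝ} (ht : t ∈ Set.Ioo 0 Real.pi) :
    0 < 1 + β ^ 2 - 2 * β * Real.cos t := by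
  have h := Real.sin_pos_of_mem_Ioo ht
  nlinarith [Real.sin_sq_add_cos_sq t, sq_nonneg (β - Real.cos t), sq_pos_of_pos h]

theorem sin_sq_div_poissonDenom_le (β : ℝ) {t : ℝ} (ht : t ∈ Set.Ioo 0 Real.pi) :
    Real.sin t ^ 2 / (1 + β ^ 2 - 2 * β * Real.cos t) ≤ 1 := by
  rw [div_le_one (poissonDenom_pos β ht)]
  nlinarith [Real.sin_sq_add_cos_sq t, sq_nonneg (β - Real.cos t)]

theorem integrableOn_sin_sq_div (β : ℝ) :
    IntegrableOn (fun t => Real.sin t ^ 2 / (1 + β ^ 2 - 2 * β * Real.cos t))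
      (Set.Ioo 0 Real.pi) := by
  refine Measure.integrableOn_of_bounded (M := 1) (by simp) ?_ ?_
  · exact Measurable.aestronglyMeasurable (by fun_prop)
  · filter_upwards [ae_restrict_mem measurableSet_Ioo] with t ht
    rw [Real.norm_of_nonneg (div_nonneg (sq_nonneg _) (poissonDenom_pos β ht).le)]
    exact sin_sq_div_poissonDenom_le β ht

theorem integral_sin_sq_div_of_norm_lt {γ : ℂ} (hγ : ‖γ‖ < 1) :
    ∫ t in Set.Ioo 0 Real.pi, ((Real.sin t ^ 2 : ℝ) : ℂ) / poissonDenom γ t = Real.pi / 2 := by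
  rw [← integral_Ioc_eq_integral_Ioo, ← intervalIntegral.integral_of_le Real.pi_pos.le,
    ← poissonInt_one hγ, poissonInt]
  simp [sq]

/-- The total mass of the absolutely continuous part of the limit measure. -/
noncomputable def bulkMass (β : ℝ) : ℝ := if 1 < |β| then (β ^ 2)⁻¹ else 1

theorem bulkMass_of_lt {β : ℝ} (h : 1 < |β|) : bulkMass β = (β ^ 2)⁻¹ := if_pos h

theorem bulkMass_of_le {β : ℝ} (h : |β| ≤ 1) : bulkMass β = 1 := if_neg h.not_gt

/-- For `|β| > 1` the denominator is `β²` times the one for `β⁻¹`, reducing to `|β| < 1`. For `|β| =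
1` the integrand simplifies to `(1 + β cos t) / 2`. -/
theorem integral_sin_sq_div (β : ℝ) :
    ∫ t in Set.Ioo 0 Real.pi, Real.sin t ^ 2 / (1 + β ^ 2 - 2 * β * Real.cos t) =
      Real.pi / 2 * bulkMass β := by
  have key : ∀ γ : ℝ, |γ| < 1 → ∫ t in Set.Ioo 0 Real.pi,
      Real.sin t ^ 2 / (1 + γ ^ 2 - 2 * γ * Real.cos t) = Real.pi / 2 := fun γ hγ => by
    have := integral_sin_sq_div_of_norm_lt (γ := γ) (by simpa using hγ)
    simp only [ofReal_poissonDenom, ← Complex.ofReal_div] at this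
    rw [integral_complex_ofReal] at this
    exact_mod_cast this
  rcases lt_trichotomy |β| 1 with h | h | h
  · rw [key β h, bulkMass_of_le h.le, mul_one]
  · have h2 : β ^ 2 = 1 := by rw [← sq_abs, h, one_pow]
    rw [bulkMass_of_le h.le, mul_one, ← integral_Ioc_eq_integral_Ioo,
      integral_Ioc_eq_integral_Ioo, setIntegral_congr_fun (g := fun t => 1 / 2 + β / 2 * Real.cos t)
        measurableSet_Ioo fun t ht => ?_, ← integral_Ioc_eq_integral_Ioo,
      ← intervalIntegral.integral_of_le Real.pi_pos.le, intervalIntegral.integral_add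
        (Continuous.intervalIntegrable (by fun_prop) _ _)
        (Continuous.intervalIntegrable (by fun_prop) _ _), intervalIntegral.integral_const_mul]
    · simp; ring
    · have := poissonDenom_pos β ht
      rw [div_eq_iff this.ne']
      linear_combination Real.sin_sq_add_cos_sq t + (Real.cos t ^ 2 - 1 / 2 -
        β / 2 * Real.cos t) * h2
  · have hβ : β ≠ 0 := by rintro rfl; simp at h; linarith
    have h1 : |β⁻¹| < 1 := by rw [abs_inv]; exact inv_lt_one_of_one_lt₀ h
    rw [bulkMass_of_lt h, ← key _ h1, ← integral_mul_const]
    refine integral_congr_ae (ae_of_all _ fun t => ?_)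
    have : 1 + β ^ 2 - 2 * β * Real.cos t =
        β ^ 2 * (1 + β⁻¹ ^ 2 - 2 * β⁻¹ * Real.cos t) := by field_simp; ring
    simp only [this]
    rw [div_mul_eq_div_div, div_eq_mul_inv, div_eq_mul_inv, div_eq_mul_inv]
    ring

/-- The absolutely continuous part of the limit measure. -/
noncomputable def bulkMeasure (σ θ : ℝ) : Measure ℝ :=
  (volume.restrict (Set.Icc (-(2 * σ)) (2 * σ))).withDensity (fun x =>
      ENNReal.ofReal (√(4 * σ ^ 2 - x ^ 2) / (2 * Real.pi * (θ ^ 2 + σ ^ 2 - θ * x))))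

theorem image_mul_cos_Ioo {σ : ℝ} (hσ : 0 < σ) :
    (fun t => 2 * σ * Real.cos t) '' Set.Ioo 0 Real.pi = Set.Ioo (-(2 * σ)) (2 * σ) := by
  ext x
  constructor
  · rintro ⟨t, ht, rfl⟩
    have hs := Real.sin_pos_of_mem_Ioo ht
    have h := Real.sin_sq_add_cos_sq t
    have h1 : |Real.cos t| < 1 := by rw [← sq_lt_one_iff_abs_lt_one]; nlinarith
    rw [abs_lt] at h1
    constructor <;> nlinarith
  · intro hx
    have h1 : -1 < x / (2 * σ) := by rw [lt_div_iff₀ (by positivity)]; linarith [hx.1]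
    have h2 : x / (2 * σ) < 1 := by rw [div_lt_iff₀ (by positivity)]; linarith [hx.2]
    refine ⟨Real.arccos (x / (2 * σ)), ⟨Real.arccos_pos.2 h2, ?_⟩, ?_⟩
    · exact lt_of_le_of_ne (Real.arccos_le_pi _) fun h => by
        rw [Real.arccos_eq_pi] at h; linarith
    · simp only [Real.cos_arccos h1.le h2.le]
      field_simp

theorem injOn_mul_cos {σ : ℝ} (hσ : 0 < σ) :
    Set.InjOn (fun t => 2 * σ * Real.cos t) (Set.Ioo 0 Real.pi) := fun s hs t ht h => by
  have : (2 * σ) ≠ 0 := by positivity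
  exact Real.injOn_cos ⟨hs.1.le, hs.2.le⟩ ⟨ht.1.le, ht.2.le⟩ (mul_left_cancel₀ this h)

theorem hasDerivAt_mul_cos (σ t : ℝ) :
    HasDerivAt (fun t => 2 * σ * Real.cos t) (-(2 * σ * Real.sin t)) t := by
  simpa using (Real.hasDerivAt_cos t).const_mul (2 * σ)

/-- The substitution `x = 2σ cos t` including its Jacobian; `θ / σ` becomes the Poisson parameter.
-/
theorem bulk_density_mul_cos {σ θ t : ℝ} (hσ : 0 < σ) (ht : t ∈ Set.Ioo 0 Real.pi) :
    |-(2 * σ * Real.sin t)| * (√(4 * σ ^ 2 - (2 * σ * Real.cos t) ^ 2) /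
        (2 * Real.pi * (θ ^ 2 + σ ^ 2 - θ * (2 * σ * Real.cos t)))) =
      2 / Real.pi * (Real.sin t ^ 2 / (1 + (θ / σ) ^ 2 - 2 * (θ / σ) * Real.cos t)) := by
  have hs := Real.sin_pos_of_mem_Ioo ht
  have hD := poissonDenom_pos (θ / σ) ht
  have e1 : 4 * σ ^ 2 - (2 * σ * Real.cos t) ^ 2 = (2 * σ * Real.sin t) ^ 2 := by
    linear_combination (-4 * σ ^ 2) * Real.sin_sq_add_cos_sq t
  have e2 : θ ^ 2 + σ ^ 2 - θ * (2 * σ * Real.cos t) =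
      σ ^ 2 * (1 + (θ / σ) ^ 2 - 2 * (θ / σ) * Real.cos t) := by field_simp; ring
  rw [e1, e2, Real.sqrt_sq (by positivity), abs_neg, abs_of_pos (by positivity)]
  generalize 1 + (θ / σ) ^ 2 - 2 * (θ / σ) * Real.cos t = D at *
  have := Real.pi_pos
  field_simp

theorem bulk_density_nonneg {σ θ t : ℝ} (hσ : 0 < σ) (ht : t ∈ Set.Ioo 0 Real.pi) :
    0 ≤ √(4 * σ ^ 2 - (2 * σ * Real.cos t) ^ 2) /
        (2 * Real.pi * (θ ^ 2 + σ ^ 2 - θ * (2 * σ * Real.cos t))) := by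
  have hs := Real.sin_pos_of_mem_Ioo ht
  have h' : 0 < 2 * σ * Real.sin t := by positivity
  have h : 0 < |-(2 * σ * Real.sin t)| := abs_pos.2 (neg_ne_zero.2 h'.ne')
  refine nonneg_of_mul_nonneg_right ?_ h
  rw [bulk_density_mul_cos hσ ht]
  have := poissonDenom_pos (θ / σ) ht
  have := Real.pi_pos
  positivity

theorem bulkMeasure_univ {σ : ℝ} (hσ : 0 < σ) (θ : ℝ) :
    bulkMeasure σ θ Set.univ = ENNReal.ofReal (bulkMass (θ / σ)) := by
  rw [bulkMeasure, withDensity_apply _ MeasurableSet.univ, Measure.restrict_univ,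
    ← restrict_Ioo_eq_restrict_Icc, ← image_mul_cos_Ioo hσ,
    lintegral_image_eq_lintegral_abs_deriv_mul measurableSet_Ioo
      (fun t _ => (hasDerivAt_mul_cos σ t).hasDerivWithinAt) (injOn_mul_cos hσ),
    setLIntegral_congr_fun (g := fun t => ENNReal.ofReal (2 / Real.pi *
      (Real.sin t ^ 2 / (1 + (θ / σ) ^ 2 - 2 * (θ / σ) * Real.cos t)))) measurableSet_Ioo
      fun t ht => ?_, ← ofReal_integral_eq_lintegral_ofReal
        ((integrableOn_sin_sq_div _).const_mul _), integral_const_mul, integral_sin_sq_div]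
  · congr 1
    have := Real.pi_pos
    field_simp
  · filter_upwards [ae_restrict_mem measurableSet_Ioo] with t ht
    have := poissonDenom_pos (θ / σ) ht
    have := Real.pi_pos
    simp only [Pi.zero_apply]
    positivity
  · simp only [← ENNReal.ofReal_mul (abs_nonneg _)]
    rw [bulk_density_mul_cos hσ ht]

theorem integral_bulkMeasure {σ : ℝ} (hσ : 0 < σ) (θ : ℝ) (g : ℝ → ℂ) :
    ∫ x, g x ∂bulkMeasure σ θ = (2 / Real.pi : ℂ) * ∫ t in Set.Ioo 0 Real.pi,
      g (2 * σ * Real.cos t) * (((Real.sin t ^ 2 : ℝ) : ℂ) / poissonDenom ((θ / σ : ℝ) : ℂ) t) := by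
  rw [bulkMeasure, integral_withDensity_eq_integral_toReal_smul (by fun_prop) (by simp),
    ← restrict_Ioo_eq_restrict_Icc, ← image_mul_cos_Ioo hσ,
    integral_image_eq_integral_abs_deriv_smul measurableSet_Ioo
      (fun t _ => (hasDerivAt_mul_cos σ t).hasDerivWithinAt) (injOn_mul_cos hσ),
    ← integral_const_mul]
  refine setIntegral_congr_fun measurableSet_Ioo fun t ht => ?_
  rw [ENNReal.toReal_ofReal (bulk_density_nonneg hσ ht), smul_smul, bulk_density_mul_cos hσ ht,
    ofReal_poissonDenom, Complex.real_smul]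
  push_cast
  ring

theorem limitMeasure_eq (σ θ : ℝ) : limitMeasure σ θ = bulkMeasure σ θ +
    (if σ < |θ| then ENNReal.ofReal (1 - σ ^ 2 / θ ^ 2) • Measure.dirac (θ + σ ^ 2 / θ) else 0) :=
  rfl

theorem bulkMeasure_zero (θ : ℝ) : bulkMeasure 0 θ = 0 := by
  simp [bulkMeasure]

theorem one_lt_abs_div_iff {σ θ : ℝ} (hσ : 0 < σ) : 1 < |θ / σ| ↔ σ < |θ| := by
  rw [abs_div, abs_of_pos hσ, one_lt_div hσ]

/-- For `σ > 0` the bulk has mass `σ² / θ²` exactly when `|θ| > σ`, which the atom completes, and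
mass `1` otherwise. For `σ = 0` only the unit atom at `θ` remains. -/
theorem isProbabilityMeasure_limitMeasure {σ θ : ℝ} (hσ : 0 ≤ σ) (hθ : θ ≠ 0) :
    IsProbabilityMeasure (limitMeasure σ θ) := by
  constructor
  rw [limitMeasure_eq]
  rcases hσ.eq_or_lt with rfl | hσ
  · simp [bulkMeasure_zero, hθ]
  rw [Measure.add_apply, bulkMeasure_univ hσ]
  by_cases h : σ < |θ|
  · have hβ := (one_lt_abs_div_iff hσ).2 h
    have h1 : σ ^ 2 / θ ^ 2 ≤ 1 := by
      rw [div_le_one (by positivity), ← sq_abs θ]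
      gcongr
    rw [if_pos h, bulkMass_of_lt hβ, Measure.smul_apply, measure_univ, smul_eq_mul, mul_one,
      ← ENNReal.ofReal_add (by positivity) (by linarith), div_pow, inv_div]
    simp
  · have hβ := not_lt.1 fun h' => h ((one_lt_abs_div_iff hσ).1 h')
    simp [h, bulkMass_of_le hβ]

theorem integrable_inv_sub {z : ℂ} (hz : z.im ≠ 0) (ν : Measure ℝ) [IsFiniteMeasure ν] :
    Integrable (fun x : ℝ => ((x : ℂ) - z)⁻¹) ν := by
  refine Integrable.of_bound (C := |z.im|⁻¹) ?_ (ae_of_all _ fun x => ?_)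
  · exact Measurable.aestronglyMeasurable (by fun_prop)
  · rw [norm_inv]
    refine inv_anti₀ (abs_pos.2 hz) ?_
    simpa using Complex.abs_im_le_norm ((x : ℂ) - z)

/-- The Stieltjes transform of the limit measure. -/
theorem integral_limitMeasure {σ θ : ℝ} (hσ : 0 ≤ σ) (hθ : θ ≠ 0) {z m : ℂ} (hzim : z.im ≠ 0) (hm : m.im ≠ 0)
    (hmz : m * (z + σ ^ 2 * m) = -1) (hσm : σ * ‖m‖ < 1) :
    ∫ x : ℝ, ((x : ℂ) - z)⁻¹ ∂limitMeasure σ θ = m / (1 + θ * m) := by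
  have hm0 : m ≠ 0 := by rintro rfl; simp at hm
  have hθm : 1 + θ * m ≠ 0 := fun h => by
    have := congrArg Complex.im h
    simp [hθ, hm] at this
  have hθ' : (θ : ℂ) ≠ 0 := by exact_mod_cast hθ
  have hz : z = -1 / m - σ ^ 2 * m := by field_simp; linear_combination hmz
  rw [limitMeasure_eq]
  rcases hσ.eq_or_lt with rfl | hσ
  · simp only [bulkMeasure_zero, zero_add, abs_pos, ne_eq, hθ, not_false_eq_true, if_true]
    rw [hz]
    simp only [ne_eq, OfNat.ofNat_ne_zero, not_false_eq_true, zero_pow, zero_div, sub_zero,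
      ENNReal.ofReal_one, one_smul, add_zero, integral_dirac, Complex.ofReal_zero, zero_mul]
    have : (θ : ℂ) - -1 / m = (1 + θ * m) / m := by field_simp; ring
    rw [this, inv_div]
  have hσ' : (σ : ℂ) ≠ 0 := by exact_mod_cast hσ.ne'
  -- The Joukowski parameter of `z`: `z = σ (α + 1/α)` with `‖α‖ < 1`. On the bulk it makes `x - z`
  -- a multiple of the Poisson denominator of `α`.
  set α : ℂ := -σ * m with hα
  set β : ℝ := θ / σ with hβ
  have hβ0 : (β : ℂ) ≠ 0 := by rw [hβ]; push_cast; exact div_ne_zero hθ' hσ'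
  have hα0 : α ≠ 0 := mul_ne_zero (neg_ne_zero.2 hσ') hm0
  have hα1 : ‖α‖ < 1 := by
    rw [hα, norm_mul, norm_neg, Complex.norm_real, Real.norm_of_nonneg hσ.le]; exact hσm
  have hαβ : α - β ≠ 0 := fun h => by
    have := congrArg Complex.im h
    simp [hα, hσ.ne', hm] at this
  have hαβ1 : 1 - α * β ≠ 0 := by
    have : 1 - α * β = 1 + θ * m := by
      rw [hα, hβ]; push_cast; field_simp; ring
    rwa [this]
  have hzα : z = σ * (α + 1 / α) := by rw [hz, hα]; field_simp; ring
  have hint : ∀ γ : ℂ, ‖γ‖ < 1 → IntegrableOn (fun t =>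
      ((Real.sin t ^ 2 : ℝ) : ℂ) / poissonDenom γ t) (Set.Ioo 0 Real.pi) := fun γ hγ => by
    have := poissonInt_integrable hγ (fun t => ((Real.sin t ^ 2 : ℝ) : ℂ)) (by fun_prop) 0 Real.pi
    rwa [intervalIntegrable_iff_integrableOn_Ioo_of_le Real.pi_pos.le] at this
  have hintβ : IntegrableOn (fun t =>
      ((Real.sin t ^ 2 : ℝ) : ℂ) / poissonDenom β t) (Set.Ioo 0 Real.pi) := by
    simp only [ofReal_poissonDenom, ← Complex.ofReal_div]
    exact (integrableOn_sin_sq_div β).ofReal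
  have hbulk : ∫ x : ℝ, ((x : ℂ) - z)⁻¹ ∂bulkMeasure σ θ =
      -α / (σ * (α - β) * (1 - α * β)) * (α - β * bulkMass β) := by
    rw [integral_bulkMeasure hσ]
    -- Partial fractions in `cos t`: the product of two Poisson kernels becomes a combination of the
    -- single ones.
    have e : ∀ t ∈ Set.Ioo 0 Real.pi, (((2 * σ * Real.cos t : ℝ) : ℂ) - z)⁻¹ *
        (((Real.sin t ^ 2 : ℝ) : ℂ) / poissonDenom β t) =
        -α / (σ * (α - β) * (1 - α * β)) *
          (α * (((Real.sin t ^ 2 : ℝ) : ℂ) / poissonDenom α t) -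
            β * (((Real.sin t ^ 2 : ℝ) : ℂ) / poissonDenom β t)) := fun t ht => by
      have hDα := poissonDenom_ne_zero hα1 t
      have hDβ : poissonDenom β t ≠ 0 := by
        rw [ofReal_poissonDenom]; exact_mod_cast (poissonDenom_pos β ht).ne'
      have h1 : ((2 * σ * Real.cos t : ℝ) : ℂ) - z = -σ * poissonDenom α t / α := by
        rw [hzα, poissonDenom]; push_cast; field_simp; ring
      have h2 : α * poissonDenom β t - β * poissonDenom α t = (α - β) * (1 - α * β) := by
        simp only [poissonDenom]; ring
      have h3 : α * (((Real.sin t ^ 2 : ℝ) : ℂ) / poissonDenom α t) -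
            β * (((Real.sin t ^ 2 : ℝ) : ℂ) / poissonDenom β t) =
          ((Real.sin t ^ 2 : ℝ) : ℂ) * ((α - β) * (1 - α * β)) /
            (poissonDenom α t * poissonDenom β t) := by
        rw [← h2]; field_simp
      rw [h1, h3]
      field_simp
    rw [setIntegral_congr_fun measurableSet_Ioo e, integral_const_mul, integral_sub
      ((hint α hα1).const_mul _) (hintβ.const_mul _), integral_const_mul, integral_const_mul,
      integral_sin_sq_div_of_norm_lt hα1]
    have hb := congrArg (fun x : ℝ => (x : ℂ)) (integral_sin_sq_div β)
    simp only [← integral_complex_ofReal, Complex.ofReal_div, ← ofReal_poissonDenom] at hb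
    rw [hb]
    have : (Real.pi : ℂ) ≠ 0 := by exact_mod_cast Real.pi_ne_zero
    push_cast
    field_simp
  have hfin : IsFiniteMeasure (bulkMeasure σ θ) := ⟨by
    rw [bulkMeasure_univ hσ]; exact ENNReal.ofReal_lt_top⟩
  have hres : m / (1 + θ * m) = -α / (σ * (1 - α * β)) := by
    have : 1 + θ * m = 1 - α * β := by rw [hα, hβ]; push_cast; field_simp; ring
    rw [this, hα]; field_simp
  rw [hres]
  by_cases h : σ < |θ|
  · have hβ1 : 1 < |β| := (one_lt_abs_div_iff hσ).2 h
    have h1 : σ ^ 2 / θ ^ 2 ≤ 1 := by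
      rw [div_le_one (by positivity), ← sq_abs θ]
      gcongr
    rw [if_pos h, integral_add_measure, hbulk, integral_smul_measure, integral_dirac,
      ENNReal.toReal_ofReal (by linarith), bulkMass_of_lt hβ1, Complex.real_smul]
    · have h2 : ((θ + σ ^ 2 / θ : ℝ) : ℂ) - z = σ * (α - β) * (1 - α * β) / (α * β) := by
        rw [hzα, hβ]; push_cast; field_simp; ring
      rw [h2]
      have h3 : ((1 - σ ^ 2 / θ ^ 2 : ℝ) : ℂ) = 1 - 1 / (β : ℂ) ^ 2 := by
        rw [hβ]; push_cast; field_simp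
      rw [h3]
      push_cast
      field_simp
      ring
    · exact integrable_inv_sub hzim _
    · exact (integrable_dirac (by simp)).smul_measure ENNReal.ofReal_ne_top
  · have hβ1 := not_lt.1 fun h' => h ((one_lt_abs_div_iff hσ).1 h')
    rw [if_neg h, add_zero, hbulk, bulkMass_of_le hβ1]
    push_cast
    field_simp

end LimitMeasure

/-! ### The graph of the periodic band. -/

section BandEdges

open scoped Matrix Matrix.Norms.L2Operator

variable {N : ℕ}

theorem periodicDist_comm (i j : Fin N) : periodicDist i j = periodicDist j i := by
  simp only [periodicDist, Nat.dist_comm]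

theorem periodicDist_self (i : Fin N) : periodicDist i i = 0 := by
  simp [periodicDist]

theorem card_filter_range_min_le (N w : ℕ) :
    ((Finset.range N).filter fun d => min d (N - d) ≤ w).card = min (2 * w + 1) N := by
  rcases le_or_gt N (2 * w + 1) with h | h
  · rw [min_eq_right h, Finset.filter_true_of_mem fun d _ => by omega, Finset.card_range]
  · have : (Finset.range N).filter (fun d => min d (N - d) ≤ w) =
        Finset.range (w + 1) ∪ Finset.Ico (N - w) N := by
      ext d
      simp only [Finset.mem_filter, Finset.mem_range, Finset.mem_union, Finset.mem_Ico]
      omega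
    rw [this, Finset.card_union_of_disjoint, Finset.card_range, Nat.card_Ico]
    · omega
    · rw [Finset.disjoint_left]
      intro d hd
      simp only [Finset.mem_range, Finset.mem_Ico] at hd ⊢
      omega

/-- Rotation by `-i` modulo `N` moves the center to `0`, so the count does not depend on `i`. This
exact regularity is what makes all vertex variances agree asymptotically. -/
theorem card_periodicDist_le (i : Fin N) (w : ℕ) :
    (Finset.univ.filter fun j : Fin N => periodicDist i j ≤ w).card = min (2 * w + 1) N := by
  have : NeZero N := ⟨by have := i.2; omega⟩
  rw [← card_filter_range_min_le]
  refine Finset.card_bij' (fun j _ => ((j - i : Fin N) : ℕ))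
    (fun d _ => (Fin.ofNat N d + i : Fin N)) ?_ ?_ ?_ ?_
  · intro j hj
    rw [Finset.mem_filter_univ] at hj
    rw [Finset.mem_filter, Finset.mem_range]
    simp only [periodicDist, Nat.dist] at hj
    refine ⟨(j - i).2, ?_⟩
    have hi := i.2
    have hj2 := j.2
    rcases le_or_gt i j with h | h
    · rw [Fin.sub_val_of_le h]
      have : (i : ℕ) ≤ j := h
      omega
    · have : (j : ℕ) < i := h
      have : ((j - i : Fin N) : ℕ) = N - i + j := by
        rw [Fin.sub_def]; exact Nat.mod_eq_of_lt (by omega)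
      omega
  · intro d hd
    rw [Finset.mem_filter, Finset.mem_range] at hd
    rw [Finset.mem_filter_univ]
    simp only [periodicDist, Nat.dist, Fin.val_add, Fin.val_ofNat]
    have hi := i.2
    rw [Nat.mod_eq_of_lt hd.1]
    rcases lt_or_ge (d + (i : ℕ)) N with h | h
    · rw [Nat.mod_eq_of_lt h]; omega
    · rw [Nat.mod_eq_sub_mod h, Nat.mod_eq_of_lt (by omega)]; omega
  · intro j _
    simp
  · intro d hd
    simp only [Finset.mem_filter, Finset.mem_range] at hd
    simp [Nat.mod_eq_of_lt hd.1]

/-- The positions strictly above the diagonal inside the periodic band of width `w`. -/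
abbrev BandPair (N w : ℕ) : Type :=
  {p : Fin N × Fin N // p.1 < p.2 ∧ periodicDist p.1 p.2 ≤ w}

/-- An enumeration of the positions strictly above the diagonal inside the band. -/
noncomputable def bandEdge (N w : ℕ) (k : Fin (Fintype.card (BandPair N w))) : Fin N × Fin N :=
  ((Fintype.equivFin (BandPair N w)).symm k).1

theorem bandEdge_lt (N w : ℕ) (k : Fin (Fintype.card (BandPair N w))) :
    (bandEdge N w k).1 < (bandEdge N w k).2 :=
  ((Fintype.equivFin (BandPair N w)).symm k).2.1

theorem bandEdge_injective (N w : ℕ) : Function.Injective (bandEdge N w) :=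
  Subtype.val_injective.comp (Equiv.injective _)

theorem card_bandPair_le (N w : ℕ) : Fintype.card (BandPair N w) ≤ N ^ 2 := by
  refine (Fintype.card_subtype_le _).trans ?_
  simp [sq]

theorem sum_bandEdge {M : Type*} [AddCommMonoid M] (w : ℕ) (F : Fin N × Fin N → M) :
    ∑ k, F (bandEdge N w k) =
      ∑ i, ∑ j, if i < j ∧ periodicDist i j ≤ w then F (i, j) else 0 := by
  simp only [bandEdge]
  rw [Equiv.sum_comp (Fintype.equivFin (BandPair N w)).symm fun p => F p.1,
    ← Finset.sum_subtype (Finset.univ.filter fun p : Fin N × Fin N =>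
      p.1 < p.2 ∧ periodicDist p.1 p.2 ≤ w) (by simp) F, Finset.sum_filter, Fintype.sum_prod_type]

/-- Every band neighbour of `i` is counted once, as first or second endpoint; the `-1` removes `i`
itself, since edges lie strictly above the diagonal. -/
theorem vertexSum_bandEdge_one (w : ℕ) (i : Fin N) :
    vertexSum (bandEdge N w) (fun _ => (1 : ℝ)) i = ((min (2 * w + 1) N : ℕ) : ℝ) - 1 := by
  rw [vertexSum, sum_bandEdge w fun p => (if p.1 = i then (1 : ℝ) else 0) + if p.2 = i then 1 else 0]
  have h1 : ∀ a b : Fin N, (if a < b ∧ periodicDist a b ≤ w then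
      (if a = i then (1 : ℝ) else 0) + (if b = i then 1 else 0) else 0) =
      (if a = i then (if i < b ∧ periodicDist i b ≤ w then (1 : ℝ) else 0) else 0) +
      (if b = i then (if a < i ∧ periodicDist i a ≤ w then (1 : ℝ) else 0) else 0) := by
    intro a b
    by_cases ha : a = i
    · subst ha
      by_cases hb : b = a
      · subst hb; simp
      · simp [hb]
    · by_cases hb : b = i
      · subst hb; simp [ha, periodicDist_comm a b]
      · simp [ha, hb]
  simp only [h1, Finset.sum_add_distrib]
  rw [Finset.sum_comm]
  simp only [Finset.sum_ite_eq', Finset.mem_univ, if_true]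
  have h2 : ∀ j : Fin N, (if i < j ∧ periodicDist i j ≤ w then (1 : ℝ) else 0) +
      (if j < i ∧ periodicDist i j ≤ w then (1 : ℝ) else 0) =
      (if periodicDist i j ≤ w then (1 : ℝ) else 0) - if j = i then 1 else 0 := by
    intro j
    rcases lt_trichotomy i j with h | h | h
    · simp [h, h.not_gt, h.ne']
    · subst h; simp [periodicDist_self]
    · simp [h, h.not_gt, h.ne]
  rw [← Finset.sum_add_distrib, Finset.sum_congr rfl fun j _ => h2 j, Finset.sum_sub_distrib,
    Finset.sum_boole, card_periodicDist_le]
  simp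

theorem isBandEdges_bandEdge (N w : ℕ) :
    IsBandEdges (bandEdge N w) ((min (2 * w + 1) N : ℕ) : ℝ) :=
  ⟨bandEdge_injective N w, fun i => by rw [vertexSum_bandEdge_one]; linarith⟩

theorem abs_vertexSum_sub_le {n : ℕ} (e : Fin n → Fin N × Fin N) {s : Fin n → ℝ} {c δ : ℝ}
    (hs : ∀ k, |s k - c| ≤ δ) (i : Fin N) :
    |vertexSum e s i - c * vertexSum e (fun _ => (1 : ℝ)) i| ≤
      δ * vertexSum e (fun _ => (1 : ℝ)) i := by
  simp only [vertexSum, Finset.mul_sum, ← Finset.sum_sub_distrib]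
  refine (Finset.abs_sum_le_sum_abs _ _).trans (Finset.sum_le_sum fun k _ => ?_)
  have h0 : 0 ≤ δ := (abs_nonneg _).trans (hs k)
  have : (((if (e k).1 = i then s k else 0) + if (e k).2 = i then s k else 0) -
      c * ((if (e k).1 = i then (1 : ℝ) else 0) + if (e k).2 = i then 1 else 0)) =
      (s k - c) * ((if (e k).1 = i then (1 : ℝ) else 0) + if (e k).2 = i then 1 else 0) := by
    split_ifs <;> ring
  rw [this, abs_mul, abs_of_nonneg (a := _ + _) (by split_ifs <;> norm_num)]
  exact mul_le_mul_of_nonneg_right (hs k) (by split_ifs <;> norm_num)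

/-- A crude triangle inequality, sufficient because it is applied to truncation means, which are
smaller than any fixed inverse power of `N`. -/
theorem norm_edgeMatrix_le {n : ℕ} (e : Fin n → Fin N × Fin N) {y : Fin n → ℂ} {c : ℝ}
    (hy : ∀ k, ‖y k‖ ≤ c) : ‖edgeMatrix e y‖ ≤ n * (2 * c) := by
  refine (norm_sum_le _ _).trans ?_
  calc _ ≤ ∑ _k : Fin n, 2 * c := Finset.sum_le_sum fun k _ =>
        (norm_pairMatrix_le _ _).trans (by have := hy k; linarith)
    _ = _ := by simp

theorem edgeMatrix_bandEdge_apply (w : ℕ) (x : Fin N → Fin N → ℂ) (i j : Fin N) :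
    edgeMatrix (bandEdge N w) (fun k => x (bandEdge N w k).1 (bandEdge N w k).2) i j =
      if periodicDist i j ≤ w then
        (if i < j then x i j else if j < i then star (x j i) else 0) else 0 := by
  rw [edgeMatrix, Matrix.sum_apply,
    sum_bandEdge w fun p => pairMatrix p (x p.1 p.2) i j]
  have h1 : ∀ a b : Fin N, (if a < b ∧ periodicDist a b ≤ w then
      pairMatrix (a, b) (x a b) i j else 0) =
      (if a = i then (if b = j then (if i < j ∧ periodicDist i j ≤ w then x i j else 0) else 0)
        else 0) +
      (if a = j then (if b = i then (if j < i ∧ periodicDist i j ≤ w then star (x j i) else 0)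
        else 0) else 0) := by
    intro a b
    simp only [pairMatrix, Matrix.add_apply, Matrix.single_apply]
    by_cases h1 : a = i ∧ b = j
    · obtain ⟨rfl, rfl⟩ := h1
      by_cases h : a = b
      · subst h; simp
      · simp [Ne.symm h, h]
    · by_cases h2 : a = j ∧ b = i
      · obtain ⟨rfl, rfl⟩ := h2
        have h : ¬ a = b := fun h => h1 ⟨h, h.symm⟩
        simp [h, Ne.symm h, periodicDist_comm a b]
      · have h2' : ¬ (b = i ∧ a = j) := fun h => h2 h.symm
        rw [not_and] at h1 h2
        simp +contextual [h1, h2]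
        intro _ _
        rw [if_neg (not_and.2 h1), if_neg h2', add_zero]
  simp only [h1, Finset.sum_add_distrib, Finset.sum_ite_irrel, Finset.sum_ite_eq',
    Finset.mem_univ, if_true, Finset.sum_const_zero]
  split_ifs <;> first | omega | simp_all

theorem randomBandMatrix_eq (b : ℕ → ℕ) (N : ℕ) (x : Fin N → Fin N → ℂ) :
    randomBandMatrix b N x =
      Matrix.diagonal (fun i => ((1 / √(bandSize b N : ℝ) : ℝ) : ℂ) * x i i) +
      edgeMatrix (bandEdge N (b N)) (fun k => ((1 / √(bandSize b N : ℝ) : ℝ) : ℂ) *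
        x (bandEdge N (b N) k).1 (bandEdge N (b N) k).2) := by
  ext i j
  rw [Matrix.add_apply, edgeMatrix_bandEdge_apply (b N)
    fun i j => ((1 / √(bandSize b N : ℝ) : ℝ) : ℂ) * x i j]
  simp only [randomBandMatrix, bandMatrix, hermitianCompletion, Matrix.smul_apply,
    Matrix.hadamard_apply, Matrix.of_apply, smul_eq_mul]
  rcases lt_trichotomy i j with h | h | h
  · simp [h, h.le, h.ne]
  · subst h; simp [periodicDist_self]
  · simp [h, h.not_gt, h.not_ge, h.ne']

end BandEdges

/-! ### Truncation and recentering of the entries. -/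

section Truncation

variable {Ω : Type*} [MeasurableSpace Ω] {P : Measure Ω}

/-- The truncation of a complex number at level `L`. -/
noncomputable def truncate (L : ℝ) (x : ℂ) : ℂ := if ‖x‖ ≤ L then x else 0

theorem measurable_truncate (L : ℝ) : Measurable (truncate L) :=
  Measurable.ite (measurableSet_le measurable_norm measurable_const) measurable_id measurable_const

theorem norm_truncate_le {L : ℝ} (hL : 0 ≤ L) (x : ℂ) : ‖truncate L x‖ ≤ L := by
  unfold truncate
  split_ifs with h
  · exact h
  · simpa using hL

theorem norm_sub_truncate_le {L : ℝ} (hL : 0 < L) (x : ℂ) (m : ℕ) :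
    ‖x - truncate L x‖ ≤ ‖x‖ ^ (m + 1) / L ^ m := by
  unfold truncate
  split_ifs with h
  · rw [sub_self, norm_zero]; positivity
  · rw [sub_zero, le_div_iff₀ (by positivity), pow_succ']
    gcongr
    exact (not_le.1 h).le

theorem abs_norm_truncate_sq_sub_le {L : ℝ} (hL : 0 < L) (x : ℂ) :
    |‖truncate L x‖ ^ 2 - ‖x‖ ^ 2| ≤ ‖x‖ ^ 4 / L ^ 2 := by
  unfold truncate
  split_ifs with h
  · rw [sub_self, abs_zero]; positivity
  · rw [norm_zero, zero_pow two_ne_zero, zero_sub, abs_neg, abs_of_nonneg (by positivity),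
      le_div_iff₀ (by positivity), show ‖x‖ ^ 4 = ‖x‖ ^ 2 * ‖x‖ ^ 2 by ring]
    gcongr
    exact (not_le.1 h).le

/-- As `x` is centered, the truncated mean is minus the mean of the discarded tail, and a high
moment makes that tail as small as desired. -/
theorem norm_integral_truncate_le [IsProbabilityMeasure P] {x : Ω → ℂ} (hx : Integrable x P)
    (h0 : ∫ ω, x ω ∂P = 0) {L : ℝ} (hL : 0 < L) {m : ℕ}
    (hm : Integrable (fun ω => ‖x ω‖ ^ (m + 1)) P) :
    ‖∫ ω, truncate L (x ω) ∂P‖ ≤ (∫ ω, ‖x ω‖ ^ (m + 1) ∂P) / L ^ m := by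
  have hT : Integrable (fun ω => truncate L (x ω)) P :=
    integrable_of_norm_le ((measurable_truncate L).comp_aemeasurable
      hx.aestronglyMeasurable.aemeasurable).aestronglyMeasurable
      fun ω => norm_truncate_le hL.le (x ω)
  have h1 : ∫ ω, truncate L (x ω) ∂P = -∫ ω, (x ω - truncate L (x ω)) ∂P := by
    rw [integral_sub hx hT, h0, zero_sub, neg_neg]
  rw [h1, norm_neg, ← integral_div]
  exact norm_integral_le_of_norm_le (hm.div_const _)
    (ae_of_all _ fun ω => norm_sub_truncate_le hL (x ω) m)

/-- The truncated variance is the truncated second moment minus the squared truncated mean; each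
differs from its untruncated value by `O(L⁻²)`. -/
theorem abs_integral_truncate_sub_sq_sub_le [IsProbabilityMeasure P] {x : Ω → ℂ}
    (hxm : Measurable x) (hx : Integrable x P) (h0 : ∫ ω, x ω ∂P = 0) {L : ℝ} (hL : 0 < L)
    (h2 : Integrable (fun ω => ‖x ω‖ ^ 2) P) (h4 : Integrable (fun ω => ‖x ω‖ ^ 4) P) :
    |∫ ω, ‖truncate L (x ω) - ∫ ω', truncate L (x ω') ∂P‖ ^ 2 ∂P - ∫ ω, ‖x ω‖ ^ 2 ∂P| ≤
      (∫ ω, ‖x ω‖ ^ 4 ∂P + (∫ ω, ‖x ω‖ ^ 2 ∂P) ^ 2) / L ^ 2 := by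
  have hTm : Measurable fun ω => truncate L (x ω) := (measurable_truncate L).comp hxm
  have e := integral_norm_sub_sq (μ := P) hTm (fun ω => norm_truncate_le hL.le (x ω)) 0
  simp only [sub_zero] at e
  have hT2 : Integrable (fun ω => ‖truncate L (x ω)‖ ^ 2) P :=
    integrable_of_norm_le (C := L ^ 2) (hTm.norm.pow_const 2).aestronglyMeasurable fun ω => by
      rw [Real.norm_of_nonneg (by positivity)]
      gcongr
      exact norm_truncate_le hL.le (x ω)
  have hA : |∫ ω, ‖truncate L (x ω)‖ ^ 2 ∂P - ∫ ω, ‖x ω‖ ^ 2 ∂P| ≤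
      (∫ ω, ‖x ω‖ ^ 4 ∂P) / L ^ 2 := by
    rw [← integral_sub hT2 h2, ← integral_div, ← Real.norm_eq_abs]
    exact norm_integral_le_of_norm_le (h4.div_const _)
      (ae_of_all _ fun ω => abs_norm_truncate_sq_sub_le hL (x ω))
  have hB := norm_integral_truncate_le hx h0 hL (m := 1) h2
  rw [pow_one] at hB
  have hB2 : ‖∫ ω, truncate L (x ω) ∂P‖ ^ 2 ≤ (∫ ω, ‖x ω‖ ^ 2 ∂P) ^ 2 / L ^ 2 := by
    rw [← div_pow]; exact pow_le_pow_left₀ (norm_nonneg _) hB 2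
  have hB3 : 0 ≤ ‖∫ ω, truncate L (x ω) ∂P‖ ^ 2 := by positivity
  rw [add_div]
  rw [abs_le] at hA ⊢
  constructor <;> linarith [hA.1, hA.2]

theorem IsWignerFamily.exists_moment_bound {σ : ℝ} {X : (N : ℕ) → Fin N → Fin N → Ω → ℂ}
    (hX : IsWignerFamily P σ X) : ∃ C : ℕ → ℝ, ∀ m, 0 ≤ C m ∧ ∀ (N : ℕ) (i j : Fin N), i ≤ j →
      Integrable (fun ω => ‖X N i j ω‖ ^ m) P ∧ ∫ ω, ‖X N i j ω‖ ^ m ∂P ≤ C m := by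
  choose C hC using hX.moments
  refine ⟨fun m => C m, fun m => ⟨(C m).2, fun N i j hij => ?_⟩⟩
  have hmeas := hX.measurable N i j hij
  have he : ∀ ω, ‖‖X N i j ω‖ ^ m‖ₑ = ‖X N i j ω‖ₑ ^ m := fun ω => by
    rw [enorm_pow, enorm_norm]
  have hle : ∫⁻ ω, ‖‖X N i j ω‖ ^ m‖ₑ ∂P ≤ C m := by
    simp only [he]; exact hC m N i j hij
  have hi : Integrable (fun ω => ‖X N i j ω‖ ^ m) P :=
    ⟨(hmeas.norm.pow_const m).aestronglyMeasurable, hle.trans_lt ENNReal.coe_lt_top⟩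
  refine ⟨hi, ?_⟩
  rw [integral_eq_lintegral_of_nonneg_ae (ae_of_all _ fun ω => by positivity)
    hi.aestronglyMeasurable]
  refine ENNReal.toReal_le_coe_of_le_coe (le_trans (le_of_eq ?_) hle)
  refine lintegral_congr fun ω => ?_
  rw [← ofReal_norm, Real.norm_of_nonneg (by positivity)]

/-- The centered truncated entries above the diagonal inside the band, divided by `√ξ`. -/
noncomputable def bandFamily (P : Measure Ω) {N : ℕ} (x : Fin N → Fin N → Ω → ℂ) (L ξ : ℝ)
    (w : ℕ) (k : Fin (Fintype.card (BandPair N w))) (ω : Ω) : ℂ :=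
  ((1 / √ξ : ℝ) : ℂ) * (truncate L (x (bandEdge N w k).1 (bandEdge N w k).2 ω) -
    ∫ ω', truncate L (x (bandEdge N w k).1 (bandEdge N w k).2 ω') ∂P)

theorem IsWignerFamily.isEdgeFamily_bandFamily [IsProbabilityMeasure P] {σ : ℝ}
    {X : (N : ℕ) → Fin N → Fin N → Ω → ℂ} (hX : IsWignerFamily P σ X) (N w : ℕ) {L : ℝ}
    (hL : 0 ≤ L) (ξ : ℝ) : IsEdgeFamily P (bandFamily P (X N) L ξ w) (2 * L / √ξ) := by
  have hm : ∀ k, Measurable (X N (bandEdge N w k).1 (bandEdge N w k).2) := fun k =>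
    hX.measurable N _ _ (bandEdge_lt N w k).le
  have hTm : ∀ k, Measurable fun ω =>
      truncate L (X N (bandEdge N w k).1 (bandEdge N w k).2 ω) := fun k =>
    (measurable_truncate L).comp (hm k)
  have hTi : ∀ k, Integrable (fun ω =>
      truncate L (X N (bandEdge N w k).1 (bandEdge N w k).2 ω)) P := fun k =>
    integrable_of_norm_le (hTm k).aestronglyMeasurable fun ω => norm_truncate_le hL _
  refine ⟨fun k => ((hTm k).sub_const _).const_mul _, ?_, fun k => ?_, fun k ω => ?_⟩
  · have hg : Function.Injective fun k : Fin (Fintype.card (BandPair N w)) =>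
        (⟨N, ⟨bandEdge N w k, (bandEdge_lt N w k).le⟩⟩ : UpperIndex) := fun k l h => by
      simp only [Sigma.mk.injEq, heq_eq_eq, Subtype.mk.injEq, true_and] at h
      exact bandEdge_injective N w h
    exact (hX.indep.precomp hg).comp (fun k c => ((1 / √ξ : ℝ) : ℂ) * (truncate L c -
      ∫ ω', truncate L (X N (bandEdge N w k).1 (bandEdge N w k).2 ω') ∂P)) fun k =>
        ((measurable_truncate L).sub_const _).const_mul _
  · simp only [bandFamily]
    rw [integral_const_mul, integral_sub (hTi k) (integrable_const _)]
    simp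
  · have h1 := norm_truncate_le hL (X N (bandEdge N w k).1 (bandEdge N w k).2 ω)
    have h2 : ‖∫ ω', truncate L (X N (bandEdge N w k).1 (bandEdge N w k).2 ω') ∂P‖ ≤ L := by
      have := norm_integral_le_of_norm_le_const (μ := P) (ae_of_all _ fun ω' =>
        norm_truncate_le hL (X N (bandEdge N w k).1 (bandEdge N w k).2 ω'))
      simpa using this
    rw [bandFamily, norm_mul, Complex.norm_real, Real.norm_of_nonneg (by positivity),
      one_div_mul_eq_div]
    gcongr
    exact (norm_sub_le _ _).trans (by linarith)

/-- Each of the `ξ - 1` edges at a vertex carries variance near `σ² / ξ`. The term `σ² / ξ` in the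
error is the missing diagonal position. -/
theorem IsWignerFamily.abs_vertexSum_bandFamily_sub_le [IsProbabilityMeasure P] {σ : ℝ}
    {X : (N : ℕ) → Fin N → Fin N → Ω → ℂ} (hX : IsWignerFamily P σ X) {C : ℕ → ℝ}
    (hC : ∀ m, 0 ≤ C m ∧ ∀ (N : ℕ) (i j : Fin N), i ≤ j →
      Integrable (fun ω => ‖X N i j ω‖ ^ m) P ∧ ∫ ω, ‖X N i j ω‖ ^ m ∂P ≤ C m)
    (N w : ℕ) {L : ℝ} (hL : 0 < L) (i : Fin N) {ξ : ℝ} (hξ : ξ = (min (2 * w + 1) N : ℕ)) :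
    |vertexSum (bandEdge N w) (fun k => ∫ ω, ‖bandFamily P (X N) L ξ w k ω‖ ^ 2 ∂P) i -
      σ ^ 2| ≤ (C 4 + σ ^ 4) / L ^ 2 + σ ^ 2 / ξ := by
  have hξ0 : 1 ≤ ξ := by
    have := i.2
    rw [hξ]
    exact_mod_cast le_min (by omega) (by omega)
  have hvar : ∀ k, |∫ ω, ‖bandFamily P (X N) L ξ w k ω‖ ^ 2 ∂P - σ ^ 2 / ξ| ≤
      (C 4 + σ ^ 4) / L ^ 2 / ξ := fun k => by
    have hlt := bandEdge_lt N w k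
    have hx := hX.measurable N _ _ hlt.le
    have h1 : Integrable (X N (bandEdge N w k).1 (bandEdge N w k).2) P := by
      have := ((hC 1).2 N _ _ hlt.le).1
      simp only [pow_one] at this
      exact (integrable_norm_iff hx.aestronglyMeasurable).1 this
    have h := abs_integral_truncate_sub_sq_sub_le (P := P) hx h1 (hX.centered N _ _ hlt) hL
      ((hC 2).2 N _ _ hlt.le).1 ((hC 4).2 N _ _ hlt.le).1
    rw [hX.variance N _ _ hlt] at h
    have e : ∫ ω, ‖bandFamily P (X N) L ξ w k ω‖ ^ 2 ∂P = (1 / ξ) *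
        ∫ ω, ‖truncate L (X N (bandEdge N w k).1 (bandEdge N w k).2 ω) -
          ∫ ω', truncate L (X N (bandEdge N w k).1 (bandEdge N w k).2 ω') ∂P‖ ^ 2 ∂P := by
      rw [← integral_const_mul]
      refine integral_congr_ae (ae_of_all _ fun ω => ?_)
      simp only [bandFamily]
      rw [norm_mul, mul_pow, Complex.norm_real, Real.norm_of_nonneg (by positivity), div_pow,
        one_pow, Real.sq_sqrt (by linarith)]
    rw [e, show ∀ y : ℝ, 1 / ξ * y - σ ^ 2 / ξ = (y - σ ^ 2) / ξ from fun y => by ring, abs_div,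
      abs_of_pos (by linarith : 0 < ξ)]
    have h4 := ((hC 4).2 N _ _ hlt.le).2
    gcongr
    refine h.trans ?_
    gcongr
    exact (by ring : (σ ^ 2) ^ 2 = σ ^ 4).le
  have h := abs_vertexSum_sub_le (bandEdge N w) hvar i
  have hC4 := (hC 4).1
  rw [vertexSum_bandEdge_one, ← hξ] at h
  have e1 : σ ^ 2 / ξ * (ξ - 1) = σ ^ 2 - σ ^ 2 / ξ := by field_simp
  have e2 : (C 4 + σ ^ 4) / L ^ 2 / ξ * (ξ - 1) ≤ (C 4 + σ ^ 4) / L ^ 2 := by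
    rw [div_mul_eq_mul_div, div_le_iff₀ (by linarith)]
    exact mul_le_mul_of_nonneg_left (by linarith) (by positivity)
  rw [e1] at h
  have h3 : 0 ≤ σ ^ 2 / ξ := by positivity
  rw [abs_le] at h ⊢
  constructor <;> linarith [h.1, h.2]

end Truncation

/-! ### Concentration and limit of the expected resolvent for the truncated matrix. -/

section AlmostSure

open scoped Matrix Matrix.Norms.L2Operator

variable {Ω : Type*} [MeasurableSpace Ω] {P : Measure Ω}

theorem isBandEdges_bandSize (b : ℕ → ℕ) (N : ℕ) :
    IsBandEdges (bandEdge N (b N)) (bandSize b N : ℝ) :=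
  isBandEdges_bandEdge N (b N)

/-- By Tonelli the sum of the `f n` has finite integral, hence is finite almost everywhere and its
terms vanish; this plays the role of Borel–Cantelli. -/
theorem ae_tendsto_zero_of_summable_integral {f : ℕ → Ω → ℝ} (hf : ∀ n, Integrable (f n) P)
    (h0 : ∀ n ω, 0 ≤ f n ω) (hs : Summable fun n => ∫ ω, f n ω ∂P) :
    ∀ᵐ ω ∂P, Tendsto (fun n => f n ω) atTop (𝓝 0) := by
  have h1 : ∀ n, ∫⁻ ω, ENNReal.ofReal (f n ω) ∂P = ENNReal.ofReal (∫ ω, f n ω ∂P) := fun n =>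
    (ofReal_integral_eq_lintegral_ofReal (hf n) (ae_of_all _ (h0 n))).symm
  have h2 : ∫⁻ ω, ∑' n, ENNReal.ofReal (f n ω) ∂P ≠ ⊤ := by
    rw [lintegral_tsum fun n => (hf n).1.aemeasurable.ennreal_ofReal]
    simp only [h1]
    exact hs.tsum_ofReal_ne_top
  filter_upwards [ae_lt_top' (AEMeasurable.tsum fun n =>
    (hf n).1.aemeasurable.ennreal_ofReal) h2] with ω hω
  have h3 := ENNReal.tendsto_atTop_zero_of_tsum_ne_top hω.ne
  have h4 := (ENNReal.tendsto_toReal ENNReal.zero_ne_top).comp h3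
  simpa [Function.comp_def, ENNReal.toReal_ofReal (h0 _ ω)] using h4

theorem summable_of_eventually_le_rpow {f : ℕ → ℝ} (h0 : ∀ n, 0 ≤ f n) {c s : ℝ} (hs : s < -1)
    (h : ∀ᶠ n : ℕ in atTop, f n ≤ c * (n : ℝ) ^ s) : Summable f := by
  refine Summable.of_norm_bounded_eventually_nat
    ((Real.summable_nat_rpow.2 hs).mul_left c) ?_
  filter_upwards [h] with n hn
  rwa [Real.norm_of_nonneg (h0 n)]

theorem tendsto_zero_of_tendsto_pow {f : ℕ → ℝ} (h0 : ∀ n, 0 ≤ f n) {p : ℕ}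
    (h : Tendsto (fun n => f n ^ p) atTop (𝓝 0)) : Tendsto f atTop (𝓝 0) := by
  rw [Metric.tendsto_nhds]
  intro ε hε
  filter_upwards [h.eventually (gt_mem_nhds (pow_pos hε p))] with n hn
  rw [dist_zero_right, Real.norm_of_nonneg (h0 n)]
  exact lt_of_pow_lt_pow_left₀ p hε.le hn

/-- All error terms with `K = 2L / √ξ` are expressed through the single small parameter `L³ / √ξ`,
dictated by the worst term `K³ ξ`. -/
theorem scale_bounds {L ξ : ℝ} (hL : 1 ≤ L) (hξ : 1 ≤ ξ) :
    2 * L / √ξ ≤ 2 * (L ^ 3 / √ξ) ∧ (2 * L / √ξ) ^ 2 * √ξ ≤ 4 * (L ^ 3 / √ξ) ∧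
      (2 * L / √ξ) ^ 3 * ξ ≤ 8 * (L ^ 3 / √ξ) ∧
      8 * (2 * L / √ξ) ^ 2 + 16 * ξ * (2 * L / √ξ) ^ 4 ≤ 288 * (L ^ 3 / √ξ) ^ 2 ∧
      1 / ξ ≤ (L ^ 3 / √ξ) ^ 2 := by
  obtain ⟨s, hs, rfl⟩ : ∃ s : ℝ, 1 ≤ s ∧ ξ = s ^ 2 :=
    ⟨√ξ, Real.one_le_sqrt.2 hξ, (Real.sq_sqrt (by linarith)).symm⟩
  have hs0 : 0 < s := by linarith
  rw [Real.sqrt_sq hs0.le]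
  have h1 : L ≤ L ^ 3 := le_self_pow₀ hL (by norm_num)
  have h2 : L ^ 2 ≤ L ^ 3 := pow_le_pow_right₀ hL (by norm_num)
  have h3 : L ^ 2 ≤ L ^ 6 := pow_le_pow_right₀ hL (by norm_num)
  have h4 : L ^ 4 ≤ L ^ 6 := pow_le_pow_right₀ hL (by norm_num)
  have h5 : 1 ≤ L ^ 6 := one_le_pow₀ hL
  refine ⟨?_, ?_, ?_, ?_, ?_⟩
  · rw [← mul_div_assoc]; gcongr
  · have : (2 * L / s) ^ 2 * s = 4 * (L ^ 2 / s) := by field_simp; norm_num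
    rw [this]; gcongr
  · have : (2 * L / s) ^ 3 * s ^ 2 = 8 * (L ^ 3 / s) := by field_simp; norm_num
    rw [this]
  · have e1 : 8 * (2 * L / s) ^ 2 + 16 * s ^ 2 * (2 * L / s) ^ 4 =
        (32 * L ^ 2 + 256 * L ^ 4) / s ^ 2 := by field_simp; ring
    have e2 : 288 * (L ^ 3 / s) ^ 2 = 288 * L ^ 6 / s ^ 2 := by field_simp
    rw [e1, e2]
    gcongr
    linarith
  · rw [div_pow]
    gcongr
    exact h5.trans (by ring_nf; rfl)

/-- The band size dominates the eighth power of the truncation level `N ^ δ`. -/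
def IsAdmissibleBand (b : ℕ → ℕ) (δ : ℝ) : Prop :=
  ∀ᶠ N : ℕ in atTop, (N : ℝ) ^ (8 * δ) ≤ bandSize b N

theorem exists_isAdmissibleBand {b : ℕ → ℕ} (hb : ∃ ε : ℝ, 0 < ε ∧
    (fun N : ℕ => (N : ℝ) ^ ε) =o[atTop] (fun N : ℕ => (bandSize b N : ℝ))) :
    ∃ δ : ℝ, 0 < δ ∧ IsAdmissibleBand b δ := by
  obtain ⟨ε, hε, h⟩ := hb
  refine ⟨ε / 8, by positivity, ?_⟩
  filter_upwards [h.bound one_pos] with N hN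
  rw [Real.norm_of_nonneg (by positivity), Real.norm_of_nonneg (by positivity), one_mul] at hN
  rwa [mul_div_cancel₀ ε (by norm_num : (8 : ℝ) ≠ 0)]

theorem IsAdmissibleBand.eventually_le {b : ℕ → ℕ} {δ : ℝ} (hb : IsAdmissibleBand b δ)
    (hδ : 0 < δ) : ∀ᶠ N : ℕ in atTop, 1 ≤ (N : ℝ) ^ δ ∧ (1 : ℝ) ≤ bandSize b N ∧
      ((N : ℝ) ^ δ) ^ 3 / √(bandSize b N : ℝ) ≤ (N : ℝ) ^ (-δ) := by
  filter_upwards [hb, eventually_ge_atTop 1] with N hN hN1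
  have hN1' : (1 : ℝ) ≤ N := by exact_mod_cast hN1
  have hN0 : (0 : ℝ) < N := by linarith
  have h1 : 1 ≤ (N : ℝ) ^ δ := Real.one_le_rpow hN1' hδ.le
  have h2 : (1 : ℝ) ≤ bandSize b N :=
    (Real.one_le_rpow hN1' (by positivity)).trans hN
  refine ⟨h1, h2, ?_⟩
  -- The exponent `8δ` gives `√ξ ≥ L⁴`, one power of `L = N ^ δ` more than the scale `L³ / √ξ`
  -- consumes.
  have h3 : ((N : ℝ) ^ δ) ^ 4 ≤ √(bandSize b N : ℝ) := by
    refine Real.le_sqrt_of_sq_le (le_trans (le_of_eq ?_) hN)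
    rw [← pow_mul, mul_comm (8 : ℝ), Real.rpow_mul hN0.le]
    norm_cast
  rw [Real.rpow_neg hN0.le, div_le_iff₀ (by positivity)]
  calc ((N : ℝ) ^ δ) ^ 3 = ((N : ℝ) ^ δ)⁻¹ * ((N : ℝ) ^ δ) ^ 4 := by field_simp
    _ ≤ _ := by gcongr

theorem tendsto_natCast_rpow_neg {s : ℝ} (hs : 0 < s) :
    Tendsto (fun N : ℕ => (N : ℝ) ^ (-s)) atTop (𝓝 0) :=
  (tendsto_rpow_neg_atTop hs).comp tendsto_natCast_atTop_atTop

theorem IsAdmissibleBand.tendsto_scale {b : ℕ → ℕ} {δ : ℝ} (hb : IsAdmissibleBand b δ)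
    (hδ : 0 < δ) : Tendsto (fun N : ℕ => ((N : ℝ) ^ δ) ^ 3 / √(bandSize b N : ℝ)) atTop (𝓝 0) :=
  squeeze_zero' (Eventually.of_forall fun N => by positivity)
    ((hb.eventually_le hδ).mono fun N h => h.2.2) (tendsto_natCast_rpow_neg hδ)

variable {σ : ℝ} {X : (N : ℕ) → Fin N → Fin N → Ω → ℂ}

/-- The matrix obtained from the band matrix by truncating the entries at level `N ^ δ`,
recentering them and removing the diagonal. -/
noncomputable def truncatedBandMatrix (P : Measure Ω) (X : (N : ℕ) → Fin N → Fin N → Ω → ℂ)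
    (b : ℕ → ℕ) (δ : ℝ) (N : ℕ) (ω : Ω) : Matrix (Fin N) (Fin N) ℂ :=
  edgeMatrix (bandEdge N (b N)) fun k =>
    bandFamily P (X N) ((N : ℝ) ^ δ) (bandSize b N : ℝ) (b N) k ω

/-- The moment of order `2p` is `O(N ^ (-2δp))`, summable once `δ p > 1`. Moments of arbitrary order
are needed because the band may grow as an arbitrarily small power of `N`. -/
theorem IsWignerFamily.ae_tendsto_sub_integral [IsProbabilityMeasure P] (hX : IsWignerFamily P σ X) {b : ℕ → ℕ} {δ : ℝ}
    (hδ : 0 < δ) (hb : IsAdmissibleBand b δ) {z : ℂ} (hz : 1 ≤ z.im)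
    {u v : (N : ℕ) → Fin N → ℂ} (hu : ∀ N, ∑ i, ‖u N i‖ ^ 2 ≤ 1)
    (hv : ∀ N, ∑ i, ‖v N i‖ ^ 2 ≤ 1) :
    ∀ᵐ ω ∂P, Tendsto (fun N => star (u N) ⬝ᵥ green (truncatedBandMatrix P X b δ N ω) z *ᵥ v N -
      ∫ ω', star (u N) ⬝ᵥ green (truncatedBandMatrix P X b δ N ω') z *ᵥ v N ∂P) atTop (𝓝 0) := by
  obtain ⟨p, hp⟩ := exists_nat_gt (1 / δ)
  have hp' : 1 < δ * p := by rw [div_lt_iff₀ hδ] at hp; linarith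
  set Y : ℕ → Ω → ℂ := fun N ω =>
    star (u N) ⬝ᵥ green (truncatedBandMatrix P X b δ N ω) z *ᵥ v N with hY
  have hYb : ∀ N ω, ‖Y N ω‖ ≤ 1 := fun N ω =>
    norm_dotProduct_green_le (edgeMatrix_isHermitian _ _) hz (hu N) (hv N)
  have hE : ∀ N, IsEdgeFamily P (bandFamily P (X N) ((N : ℝ) ^ δ) (bandSize b N : ℝ) (b N))
      (2 * (N : ℝ) ^ δ / √(bandSize b N : ℝ)) := fun N =>
    hX.isEdgeFamily_bandFamily N (b N) (by positivity) _
  have hYm : ∀ N, Measurable (Y N) := fun N =>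
    (measurable_dotProduct_green (bandEdge N (b N)) z (u N) (v N)).comp
      (measurable_pi_lambda _ fun k => (hE N).measurable k)
  have hlim := ae_tendsto_zero_of_summable_integral (P := P)
    (f := fun N ω => ‖Y N ω - ∫ ω', Y N ω' ∂P‖ ^ (2 * p)) (fun N => ?_)
    (fun N ω => by positivity) ?_
  · filter_upwards [hlim] with ω hω
    rw [tendsto_zero_iff_norm_tendsto_zero]
    exact tendsto_zero_of_tendsto_pow (fun N => norm_nonneg _) hω
  · refine integrable_of_norm_le (C := 2 ^ (2 * p))
      (((hYm N).sub_const _).norm.pow_const _).aestronglyMeasurable fun ω => ?_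
    have h1 : ‖∫ ω', Y N ω' ∂P‖ ≤ 1 := by
      have := norm_integral_le_of_norm_le_const (μ := P) (ae_of_all _ (hYb N))
      simpa using this
    rw [Real.norm_of_nonneg (by positivity)]
    gcongr
    exact (norm_sub_le _ _).trans (by linarith [hYb N ω])
  · refine summable_of_eventually_le_rpow (fun N => integral_nonneg fun ω => by positivity)
      (c := momentConst p * 288 ^ p) (s := -(2 * (δ * p))) (by linarith) ?_
    filter_upwards [hb.eventually_le hδ] with N ⟨h1, h2, h3⟩
    refine ((hE N).integral_dotProduct_green_pow_le (isBandEdges_bandSize b N)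
      (by positivity) (by positivity) hz (hu N) (hv N) p).trans ?_
    rw [mul_assoc (momentConst p)]
    refine mul_le_mul_of_nonneg_left ?_ (momentConst_nonneg p)
    have h4 := (scale_bounds h1 h2).2.2.2.1
    calc _ ≤ (288 * (((N : ℝ) ^ δ) ^ 3 / √(bandSize b N : ℝ)) ^ 2) ^ p := by
          gcongr
      _ ≤ (288 * ((N : ℝ) ^ (-δ)) ^ 2) ^ p := by gcongr
      _ = _ := by
          rw [mul_pow, ← pow_mul, ← Real.rpow_natCast ((N : ℝ) ^ (-δ)), ← Real.rpow_mul (by positivity)]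
          congr 2
          push_cast; ring

theorem IsWignerFamily.tendsto_integral_green [IsProbabilityMeasure P] (hX : IsWignerFamily P σ X) {b : ℕ → ℕ} {δ : ℝ}
    (hδ : 0 < δ) (hb : IsAdmissibleBand b δ) {z m : ℂ} (hz : 1 ≤ z.im) (hm : ‖m‖ ≤ 1)
    (hmz : m * (z + σ ^ 2 * m) = -1) (hmσ : ‖m‖ * (σ ^ 2 + 1) ≤ 1 / 2)
    {u v : (N : ℕ) → Fin N → ℂ} (hu : ∀ N, ∑ i, ‖u N i‖ ^ 2 ≤ 1)
    (hv : ∀ N, ∑ i, ‖v N i‖ ^ 2 ≤ 1) :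
    Tendsto (fun N => ∫ ω, star (u N) ⬝ᵥ green (truncatedBandMatrix P X b δ N ω) z *ᵥ v N ∂P -
      m * (star (u N) ⬝ᵥ v N)) atTop (𝓝 0) := by
  obtain ⟨C, hC⟩ := hX.exists_moment_bound
  set T : ℕ → ℝ := fun N => ((N : ℝ) ^ δ) ^ 3 / √(bandSize b N : ℝ) with hT
  have hT0 : Tendsto T atTop (𝓝 0) := hb.tendsto_scale hδ
  set ρ : ℕ → ℝ := fun N => (C 4 + σ ^ 4) / ((N : ℝ) ^ δ) ^ 2 + σ ^ 2 / (bandSize b N : ℝ) with hρ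
  have hC4 := (hC 4).1
  have hρ0 : Tendsto ρ atTop (𝓝 0) := by
    have h1 : Tendsto (fun N : ℕ => (C 4 + σ ^ 4) * ((N : ℝ) ^ (-δ)) ^ 2 + σ ^ 2 * T N ^ 2)
        atTop (𝓝 0) := by
      have := (((tendsto_natCast_rpow_neg hδ).pow 2).const_mul (C 4 + σ ^ 4)).add
        ((hT0.pow 2).const_mul (σ ^ 2))
      simpa using this
    refine squeeze_zero' (Eventually.of_forall fun N => by positivity) ?_ h1
    filter_upwards [hb.eventually_le hδ] with N ⟨h1, h2, h3⟩
    have h4 := (scale_bounds h1 h2).2.2.2.2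
    simp only [hρ]
    rw [Real.rpow_neg (by positivity), inv_pow, ← div_eq_mul_inv, ← mul_one_div (σ ^ 2)]
    gcongr
  have hlim : Tendsto (fun N => 2 * (6 * (4 * T N) + 22 * (8 * T N) +
      2 * (σ ^ 2 + ρ N) * √(288 * T N ^ 2) + ρ N)) atTop (𝓝 0) := by
    have h1 := Real.continuous_sqrt.tendsto _ |>.comp ((hT0.pow 2).const_mul 288)
    have := (((((hT0.const_mul 4).const_mul 6).add ((hT0.const_mul 8).const_mul 22)).add
      (((hρ0.const_add (σ ^ 2)).const_mul 2).mul h1)).add hρ0).const_mul 2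
    simpa [Function.comp_def] using this
  refine squeeze_zero_norm' ?_ hlim
  filter_upwards [hb.eventually_le hδ, hρ0.eventually (gt_mem_nhds one_pos),
    hT0.eventually (gt_mem_nhds (show (0 : ℝ) < 1 / 2 by norm_num))] with N ⟨h1, h2, h3⟩ h4 h5
  have hE := hX.isEdgeFamily_bandFamily N (b N) (L := (N : ℝ) ^ δ) (by positivity)
    (bandSize b N : ℝ)
  obtain ⟨s1, s2, s3, s4, -⟩ := scale_bounds h1 h2
  have hρN : 0 ≤ ρ N := by positivity
  have hmT : ‖m‖ * (σ ^ 2 + ρ N) ≤ 1 / 2 := le_trans (by gcongr) hmσ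
  refine (hE.norm_expected_green_sub_le (isBandEdges_bandSize b N) (by linarith)
    (by positivity) (s1.trans (by simp only [hT] at h5; linarith)) hz
    (ρ := ρ N) (fun i => hX.abs_vertexSum_bandFamily_sub_le hC N (b N) (by positivity) i rfl) hm hmz hmT
    hρN (hu N) (hv N)).trans ?_
  have s5 := Real.sqrt_le_sqrt s4
  have s2' := mul_le_mul_of_nonneg_left s2 (by norm_num : (0 : ℝ) ≤ 6)
  have s3' := mul_le_mul_of_nonneg_left s3 (by norm_num : (0 : ℝ) ≤ 22)
  have s5' := mul_le_mul_of_nonneg_left s5 (by positivity : (0 : ℝ) ≤ 2 * (σ ^ 2 + ρ N))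
  simp only [hT]
  linarith

/-- A union bound in moment form: the sum over at most `N²` entries of `‖X‖ ^ m N ^ (-δm)` has mean
`O(N ^ (2 - δm))`, which is summable for `δ m > 4`. -/
theorem IsWignerFamily.ae_eventually_norm_le (hX : IsWignerFamily P σ X) {δ : ℝ} (hδ : 0 < δ) :
    ∀ᵐ ω ∂P, ∀ᶠ N : ℕ in atTop, ∀ i j : Fin N, i ≤ j → ‖X N i j ω‖ ≤ (N : ℝ) ^ δ := by
  obtain ⟨C, hC⟩ := hX.exists_moment_bound
  obtain ⟨m, hm⟩ := exists_nat_gt (4 / δ)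
  have hm' : 4 < δ * m := by rw [div_lt_iff₀ hδ] at hm; linarith
  have hint : ∀ (N : ℕ) (i j : Fin N),
      Integrable (fun ω => if i ≤ j then ‖X N i j ω‖ ^ m * (N : ℝ) ^ (-(δ * m)) else 0) P := by
    intro N i j
    split_ifs with h
    · exact (((hC m).2 N i j h).1).mul_const _
    · exact integrable_zero _ _ _
  have hlim := ae_tendsto_zero_of_summable_integral (P := P)
    (f := fun N ω => ∑ i, ∑ j, if i ≤ j then ‖X N i j ω‖ ^ m * (N : ℝ) ^ (-(δ * m)) else 0)
    (fun N => integrable_finsetSum _ fun i _ => integrable_finsetSum _ fun j _ => hint N i j)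
    (fun N ω => Finset.sum_nonneg fun i _ => Finset.sum_nonneg fun j _ => by positivity) ?_
  · filter_upwards [hlim] with ω hω
    filter_upwards [hω.eventually (gt_mem_nhds one_pos), eventually_ge_atTop 1] with N hN hN1 i j hij
    have hN0 : (0 : ℝ) < N := by exact_mod_cast hN1
    have h1 : ‖X N i j ω‖ ^ m * (N : ℝ) ^ (-(δ * m)) < 1 := by
      refine lt_of_le_of_lt ?_ hN
      calc _ = if i ≤ j then ‖X N i j ω‖ ^ m * (N : ℝ) ^ (-(δ * m)) else 0 := by rw [if_pos hij]
        _ ≤ ∑ j, if i ≤ j then ‖X N i j ω‖ ^ m * (N : ℝ) ^ (-(δ * m)) else 0 :=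
            Finset.single_le_sum (f := fun j => if i ≤ j then
              ‖X N i j ω‖ ^ m * (N : ℝ) ^ (-(δ * m)) else 0) (fun j _ => by positivity)
              (Finset.mem_univ j)
        _ ≤ _ := Finset.single_le_sum (f := fun i => ∑ j, if i ≤ j then
              ‖X N i j ω‖ ^ m * (N : ℝ) ^ (-(δ * m)) else 0)
              (fun i _ => Finset.sum_nonneg fun j _ => by positivity) (Finset.mem_univ i)
    rw [Real.rpow_neg hN0.le, Real.rpow_mul hN0.le, Real.rpow_natCast, mul_inv_lt_iff₀
      (by positivity), one_mul] at h1
    exact (lt_of_pow_lt_pow_left₀ m (by positivity) h1).le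
  · refine summable_of_eventually_le_rpow (c := C m) (s := 2 - δ * m) (fun N => integral_nonneg
      fun ω => Finset.sum_nonneg fun i _ => Finset.sum_nonneg fun j _ => by positivity)
      (by linarith) ?_
    filter_upwards [eventually_ge_atTop 1] with N hN1
    have hN0 : (0 : ℝ) < N := by exact_mod_cast hN1
    rw [integral_finsetSum _ fun i _ => integrable_finsetSum _ fun j _ => hint N i j]
    calc _ ≤ ∑ _i : Fin N, ∑ _j : Fin N, C m * (N : ℝ) ^ (-(δ * m)) := by
          refine Finset.sum_le_sum fun i _ => ?_
          rw [integral_finsetSum _ fun j _ => hint N i j]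
          refine Finset.sum_le_sum fun j _ => ?_
          have := (hC m).1
          split_ifs with h
          · rw [integral_mul_const]
            gcongr
            exact ((hC m).2 N i j h).2
          · simp only [integral_zero]; positivity
      _ = _ := by
          simp only [Finset.sum_const, Finset.card_univ, Fintype.card_fin, nsmul_eq_mul]
          rw [sub_eq_add_neg, Real.rpow_add hN0, Real.rpow_two]
          ring

end AlmostSure

/-! ### Removing the truncation and adding the spikes. -/

section Perturbation

open scoped Matrix Matrix.Norms.L2Operator

variable {Ω : Type*} [MeasurableSpace Ω] {P : Measure Ω} {σ : ℝ}
  {X : (N : ℕ) → Fin N → Fin N → Ω → ℂ}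

theorem pairMatrix_sub {N : ℕ} (p : Fin N × Fin N) (c d : ℂ) :
    pairMatrix p c - pairMatrix p d = pairMatrix p (c - d) := by
  ext i j
  simp only [pairMatrix, Matrix.sub_apply, Matrix.add_apply, Matrix.single_apply, star_sub]
  split_ifs <;> ring

/-- Almost surely the truncation is eventually inactive, so the difference consists of the diagonal,
of norm at most `N ^ δ / √ξ`, and of the subtracted means. With `δ m > 3` each mean is `O(N⁻³)`,
which survives the crude factor `N²` for the number of edges. -/
theorem IsWignerFamily.ae_tendsto_norm_sub [IsProbabilityMeasure P] (hX : IsWignerFamily P σ X)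
    {b : ℕ → ℕ} {δ : ℝ} (hδ : 0 < δ) (hb : IsAdmissibleBand b δ) :
    ∀ᵐ ω ∂P, Tendsto (fun N => ‖randomBandMatrix b N (fun i j => X N i j ω) -
      truncatedBandMatrix P X b δ N ω‖) atTop (𝓝 0) := by
  obtain ⟨C, hC⟩ := hX.exists_moment_bound
  obtain ⟨m, hm⟩ := exists_nat_gt (3 / δ)
  have hm' : 3 < δ * m := by rw [div_lt_iff₀ hδ] at hm; linarith
  have hlim : Tendsto (fun N : ℕ => (N : ℝ) ^ (-δ) + 2 * C (m + 1) * (N : ℝ) ^ (-(1 : ℝ)))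
      atTop (𝓝 0) := by
    have := (tendsto_natCast_rpow_neg hδ).add
      ((tendsto_natCast_rpow_neg one_pos).const_mul (2 * C (m + 1)))
    simpa using this
  filter_upwards [hX.ae_eventually_norm_le hδ] with ω hω
  refine squeeze_zero' (Eventually.of_forall fun N => norm_nonneg _) ?_ hlim
  filter_upwards [hω, hb.eventually_le hδ, eventually_ge_atTop 1] with N hN ⟨h1, h2, h3⟩ hN1
  have hN1' : (1 : ℝ) ≤ N := by exact_mod_cast hN1
  have hN0 : (0 : ℝ) < N := by linarith
  have hs : 1 ≤ √(bandSize b N : ℝ) := Real.one_le_sqrt.2 h2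
  set c : ℂ := ((1 / √(bandSize b N : ℝ) : ℝ) : ℂ) with hc
  have hcn : ‖c‖ = 1 / √(bandSize b N : ℝ) := by
    rw [hc, Complex.norm_real, Real.norm_of_nonneg (by positivity)]
  have hC1 := (hC (m + 1)).1
  have e : randomBandMatrix b N (fun i j => X N i j ω) - truncatedBandMatrix P X b δ N ω =
      Matrix.diagonal (fun i => c * X N i i ω) + edgeMatrix (bandEdge N (b N)) (fun k => c *
        ∫ ω', truncate ((N : ℝ) ^ δ)
          (X N (bandEdge N (b N) k).1 (bandEdge N (b N) k).2 ω') ∂P) := by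
    rw [randomBandMatrix_eq, add_sub_assoc, truncatedBandMatrix, edgeMatrix, edgeMatrix,
      edgeMatrix, ← Finset.sum_sub_distrib]
    congr 1
    refine Finset.sum_congr rfl fun k _ => ?_
    have ht : truncate ((N : ℝ) ^ δ) (X N (bandEdge N (b N) k).1 (bandEdge N (b N) k).2 ω) =
        X N (bandEdge N (b N) k).1 (bandEdge N (b N) k).2 ω :=
      if_pos (hN _ _ (bandEdge_lt N (b N) k).le)
    rw [bandFamily, ht, pairMatrix_sub]
    congr 1
    ring
  rw [e]
  refine (norm_add_le _ _).trans (add_le_add ?_ ?_)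
  · rw [Matrix.l2_opNorm_diagonal]
    refine (pi_norm_le_iff_of_nonneg (by positivity)).2 fun i => ?_
    rw [norm_mul, hcn]
    refine le_trans ?_ h3
    rw [one_div_mul_eq_div]
    gcongr
    exact (hN i i le_rfl).trans (le_self_pow₀ h1 (by norm_num))
  · have h4 : ∀ k, ‖c * ∫ ω', truncate ((N : ℝ) ^ δ)
        (X N (bandEdge N (b N) k).1 (bandEdge N (b N) k).2 ω') ∂P‖ ≤
        C (m + 1) * (N : ℝ) ^ (-(3 : ℝ)) := fun k => by
      have hlt := bandEdge_lt N (b N) k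
      have hx : Integrable (X N (bandEdge N (b N) k).1 (bandEdge N (b N) k).2) P := by
        have := ((hC 1).2 N _ _ hlt.le).1
        simp only [pow_one] at this
        exact (integrable_norm_iff (hX.measurable N _ _ hlt.le).aestronglyMeasurable).1 this
      have h5 := norm_integral_truncate_le hx (hX.centered N _ _ hlt)
        (L := (N : ℝ) ^ δ) (by positivity) ((hC (m + 1)).2 N _ _ hlt.le).1
      have h6 := ((hC (m + 1)).2 N _ _ hlt.le).2
      have h7 : (((N : ℝ) ^ δ) ^ m)⁻¹ ≤ (N : ℝ) ^ (-(3 : ℝ)) := by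
        rw [← Real.rpow_natCast, ← Real.rpow_mul hN0.le, ← Real.rpow_neg hN0.le]
        exact Real.rpow_le_rpow_of_exponent_le hN1' (by linarith)
      rw [norm_mul, hcn]
      calc _ ≤ 1 * (C (m + 1) * (N : ℝ) ^ (-(3 : ℝ))) := by
            gcongr
            · rw [div_le_one (by linarith)]; exact hs
            · refine h5.trans ?_
              rw [div_eq_mul_inv]
              gcongr
        _ = _ := one_mul _
    refine (norm_edgeMatrix_le _ h4).trans ?_
    have h8 : ((Fintype.card (BandPair N (b N)) : ℕ) : ℝ) ≤ (N : ℝ) ^ 2 := by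
      exact_mod_cast card_bandPair_le N (b N)
    calc _ ≤ (N : ℝ) ^ 2 * (2 * (C (m + 1) * (N : ℝ) ^ (-(3 : ℝ)))) := by gcongr
      _ = 2 * C (m + 1) * ((N : ℝ) ^ (2 : ℝ) * (N : ℝ) ^ (-(3 : ℝ))) := by
          rw [Real.rpow_two]; ring
      _ = _ := by rw [← Real.rpow_add hN0]; norm_num

theorem randomBandMatrix_isHermitian (b : ℕ → ℕ) (N : ℕ) {x : Fin N → Fin N → ℂ}
    (hx : ∀ i, (x i i).im = 0) : (randomBandMatrix b N x).IsHermitian := by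
  have := spikedMatrix_isHermitian b N hx (r := 0) Fin.elim0 Fin.elim0
  simpa [spikedMatrix, spikeMatrix] using this

/-- The isotropic law: concentration, the limit of the expectation, and Lipschitz dependence of the
resolvent on the matrix in operator norm. -/
theorem IsWignerFamily.ae_tendsto_green [IsProbabilityMeasure P] (hX : IsWignerFamily P σ X)
    {b : ℕ → ℕ} {δ : ℝ} (hδ : 0 < δ) (hb : IsAdmissibleBand b δ) {z m : ℂ} (hz : 1 ≤ z.im)
    (hm : ‖m‖ ≤ 1) (hmz : m * (z + σ ^ 2 * m) = -1) (hmσ : ‖m‖ * (σ ^ 2 + 1) ≤ 1 / 2)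
    {u v : (N : ℕ) → Fin N → ℂ} (hu : ∀ N, ∑ i, ‖u N i‖ ^ 2 ≤ 1)
    (hv : ∀ N, ∑ i, ‖v N i‖ ^ 2 ≤ 1) :
    ∀ᵐ ω ∂P, Tendsto (fun N =>
      star (u N) ⬝ᵥ green (randomBandMatrix b N (fun i j => X N i j ω)) z *ᵥ v N -
        m * (star (u N) ⬝ᵥ v N)) atTop (𝓝 0) := by
  have h1 := hX.tendsto_integral_green hδ hb hz hm hmz hmσ hu hv
  filter_upwards [hX.ae_tendsto_sub_integral hδ hb hz hu hv, hX.ae_tendsto_norm_sub hδ hb]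
    with ω h2 h3
  have h4 : Tendsto (fun N =>
      star (u N) ⬝ᵥ green (randomBandMatrix b N (fun i j => X N i j ω)) z *ᵥ v N -
        star (u N) ⬝ᵥ green (truncatedBandMatrix P X b δ N ω) z *ᵥ v N) atTop (𝓝 0) := by
    refine squeeze_zero_norm (fun N => ?_) h3
    have hH : (truncatedBandMatrix P X b δ N ω).IsHermitian := edgeMatrix_isHermitian _ _
    have hΞ : (randomBandMatrix b N (fun i j => X N i j ω)).IsHermitian :=
      randomBandMatrix_isHermitian b N fun i => hX.diagonal_real N i ω
    rw [← dotProduct_sub, ← Matrix.sub_mulVec, green_sub_green hΞ hH hz]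
    refine (norm_star_dotProduct_mulVec_le _ (hu N) (hv N)).trans ?_
    rw [norm_sub_rev]
    calc _ ≤ ‖green (randomBandMatrix b N (fun i j => X N i j ω)) z‖ *
          ‖truncatedBandMatrix P X b δ N ω - randomBandMatrix b N (fun i j => X N i j ω)‖ *
          ‖green (truncatedBandMatrix P X b δ N ω) z‖ :=
          (norm_mul_le _ _).trans (by gcongr; exact norm_mul_le _ _)
      _ ≤ 1 * ‖truncatedBandMatrix P X b δ N ω - randomBandMatrix b N (fun i j => X N i j ω)‖ *
          1 := by
          gcongr
          · exact norm_green_le hΞ hz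
          · exact norm_green_le hH hz
      _ = _ := by ring
  have := (h4.add h2).add h1
  simp only [add_zero] at this
  refine this.congr fun N => ?_
  ring

variable {r : ℕ}

theorem dotProduct_spikeMatrix {N : ℕ} (θ : Fin r → ℝ) (a : Fin r → EuclideanSpace ℂ (Fin N))
    (G R : Matrix (Fin N) (Fin N) ℂ) (u v : Fin N → ℂ) :
    star u ⬝ᵥ (G * spikeMatrix θ a * R) *ᵥ v =
      ∑ q, (θ q : ℂ) * (star u ⬝ᵥ G *ᵥ (a q).ofLp) * (star (a q).ofLp ⬝ᵥ R *ᵥ v) := by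
  rw [spikeMatrix, Finset.mul_sum, Finset.sum_mul, Matrix.sum_mulVec, dotProduct_sum]
  refine Finset.sum_congr rfl fun q _ => ?_
  rw [← Matrix.mulVec_mulVec, ← Matrix.mulVec_mulVec, Matrix.smul_mulVec,
    Matrix.vecMulVec_mulVec, Matrix.mulVec_smul, dotProduct_smul]
  simp only [op_smul_eq_smul, Matrix.mulVec_smul, dotProduct_smul, smul_eq_mul]
  ring

theorem star_dotProduct_of_orthonormal {N : ℕ} {a : Fin r → EuclideanSpace ℂ (Fin N)}
    (ha : Orthonormal ℂ a) (s q : Fin r) :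
    star (a s).ofLp ⬝ᵥ (a q).ofLp = if s = q then 1 else 0 := by
  rw [← orthonormal_iff_ite.1 ha s q, EuclideanSpace.inner_eq_star_dotProduct, dotProduct_comm]

theorem sum_norm_sq_of_orthonormal {N : ℕ} {a : Fin r → EuclideanSpace ℂ (Fin N)}
    (ha : Orthonormal ℂ a) (s : Fin r) : ∑ i, ‖(a s).ofLp i‖ ^ 2 ≤ 1 := by
  rw [← EuclideanSpace.norm_sq_eq, ha.1 s, one_pow]

/-- The resolvent identity between `H` and `H + A`, tested on spike vectors, is a linear system for
`F q`. Its coefficients `⟨a s, G a q⟩` tend to `m` for `q = s` and to `0` otherwise, and the `F q`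
are bounded, so asymptotically only the equation `m = F s (1 + θ s m)` is left. -/
theorem tendsto_green_spiked {H A : (N : ℕ) → Matrix (Fin N) (Fin N) ℂ}
    (hH : ∀ N, (H N).IsHermitian) (hM : ∀ N, (H N + A N).IsHermitian)
    {θ : Fin r → ℝ} {a : (N : ℕ) → Fin r → EuclideanSpace ℂ (Fin N)}
    (hA : ∀ N, A N = spikeMatrix θ (a N)) (ha : ∀ N : ℕ, r ≤ N → Orthonormal ℂ (a N))
    {z m : ℂ} (hz : 1 ≤ z.im) {s : Fin r} (hm : 1 + θ s * m ≠ 0)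
    (hG : ∀ q, Tendsto (fun N => star (a N s).ofLp ⬝ᵥ green (H N) z *ᵥ (a N q).ofLp -
      m * (star (a N s).ofLp ⬝ᵥ (a N q).ofLp)) atTop (𝓝 0)) :
    Tendsto (fun N => star (a N s).ofLp ⬝ᵥ green (H N + A N) z *ᵥ (a N s).ofLp) atTop
      (𝓝 (m / (1 + θ s * m))) := by
  set ε : Fin r → ℕ → ℂ := fun q N => star (a N s).ofLp ⬝ᵥ green (H N) z *ᵥ (a N q).ofLp -
      m * (star (a N s).ofLp ⬝ᵥ (a N q).ofLp) with hε
  set F : Fin r → ℕ → ℂ := fun q N =>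
    star (a N q).ofLp ⬝ᵥ green (H N + A N) z *ᵥ (a N s).ofLp with hF
  have hF1 : ∀ q, ∀ N, r ≤ N → ‖F q N‖ ≤ 1 := fun q N hN =>
    norm_dotProduct_green_le (hM N) hz (sum_norm_sq_of_orthonormal (ha N hN) q)
      (sum_norm_sq_of_orthonormal (ha N hN) s)
  have hεF : ∀ q, Tendsto (fun N => (θ q : ℂ) * (ε q N * F q N)) atTop (𝓝 0) := fun q => by
    have h : Tendsto (fun N => ε q N * F q N) atTop (𝓝 0) := by
      refine squeeze_zero_norm' ?_ (tendsto_zero_iff_norm_tendsto_zero.1 (hG q))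
      filter_upwards [eventually_ge_atTop r] with N hN
      rw [norm_mul]
      exact mul_le_of_le_one_right (norm_nonneg _) (hF1 q N hN)
    simpa using h.const_mul (θ q : ℂ)
  have hlim : Tendsto (fun N => (m + ε s N - ∑ q, (θ q : ℂ) * (ε q N * F q N)) / (1 + θ s * m))
      atTop (𝓝 (m / (1 + θ s * m))) := by
    have := (((hG s).const_add m).sub (tendsto_finsetSum Finset.univ fun q _ => hεF q)).div_const
      (1 + θ s * m)
    simpa using this
  refine hlim.congr' ?_
  filter_upwards [eventually_ge_atTop r] with N hN
  have h1 := congrArg (fun B => star (a N s).ofLp ⬝ᵥ B *ᵥ (a N s).ofLp)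
    (green_sub_green (hH N) (hM N) hz)
  simp only [add_sub_cancel_left, Matrix.sub_mulVec, dotProduct_sub] at h1
  rw [hA N, dotProduct_spikeMatrix, ← hA N] at h1
  have h2 : ∀ q, star (a N s).ofLp ⬝ᵥ green (H N) z *ᵥ (a N q).ofLp =
      ε q N + m * (if s = q then 1 else 0) := fun q => by
    rw [← star_dotProduct_of_orthonormal (ha N hN) s q, hε]
    simp
  simp only [h2, if_true, mul_one] at h1
  have h3 : ∑ q, (θ q : ℂ) * (ε q N + m * (if s = q then 1 else 0)) *
      (star (a N q).ofLp ⬝ᵥ green (H N + A N) z *ᵥ (a N s).ofLp) =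
      ∑ q, (θ q : ℂ) * (ε q N * F q N) + θ s * m * F s N := by
    have : ∀ q, (θ q : ℂ) * (ε q N + m * (if s = q then 1 else 0)) *
      (star (a N q).ofLp ⬝ᵥ green (H N + A N) z *ᵥ (a N s).ofLp) =
      (θ q : ℂ) * (ε q N * F q N) + if s = q then θ q * m * F q N else 0 := fun q => by
      simp only [hF]
      split_ifs <;> ring
    rw [Finset.sum_congr rfl fun q _ => this q, Finset.sum_add_distrib, Finset.sum_ite_eq]
    simp
  rw [h3] at h1
  rw [div_eq_iff hm]
  change _ = F s N * _
  change _ - F s N = _ at h1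
  linear_combination h1

end Perturbation

/-! ### Stieltjes transform of a vector spectral measure as a resolvent form. -/

section SpectralStieltjes

open scoped Matrix

variable {N : ℕ}

theorem green_mulVec_eigenvectorBasis {H : Matrix (Fin N) (Fin N) ℂ} (hH : H.IsHermitian) {z : ℂ}
    (hz : 1 ≤ z.im) (k : Fin N) : green H z *ᵥ (hH.eigenvectorBasis k).ofLp =
      ((hH.eigenvalues k : ℂ) - z)⁻¹ • (hH.eigenvectorBasis k).ofLp := by
  have h0 : (hH.eigenvalues k : ℂ) - z ≠ 0 := fun h => by
    have := congrArg Complex.im h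
    simp at this
    linarith
  have h1 : (H - z • 1) *ᵥ (hH.eigenvectorBasis k).ofLp =
      ((hH.eigenvalues k : ℂ) - z) • (hH.eigenvectorBasis k).ofLp := by
    rw [Matrix.sub_mulVec, Matrix.smul_mulVec, Matrix.one_mulVec, hH.mulVec_eigenvectorBasis k,
      sub_smul]
    rfl
  have h2 := congrArg (green H z *ᵥ ·) h1
  simp only [Matrix.mulVec_mulVec, green_mul_sub hH hz, Matrix.one_mulVec,
    Matrix.mulVec_smul] at h2
  rw [eq_inv_smul_iff₀ h0, ← h2]

theorem integral_inv_sub_vectorSpectralMeasure {H : Matrix (Fin N) (Fin N) ℂ}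
    (hH : H.IsHermitian) (u : EuclideanSpace ℂ (Fin N)) {z : ℂ} (hz : 1 ≤ z.im) :
    ∫ x : ℝ, ((x : ℂ) - z)⁻¹ ∂(vectorSpectralMeasure hH u : Measure ℝ) =
      star u.ofLp ⬝ᵥ green H z *ᵥ u.ofLp := by
  have h1 : star u.ofLp ⬝ᵥ green H z *ᵥ u.ofLp =
      inner ℂ u (Matrix.toEuclideanLin (green H z) u) := by
    rw [EuclideanSpace.inner_eq_star_dotProduct, dotProduct_comm]
    rfl
  have h2 : ∀ k, Matrix.toEuclideanLin (green H z) (hH.eigenvectorBasis k) =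
      ((hH.eigenvalues k : ℂ) - z)⁻¹ • hH.eigenvectorBasis k := fun k => by
    ext i
    have := congrFun (green_mulVec_eigenvectorBasis hH hz k) i
    simpa [Matrix.toLpLin_apply] using this
  rw [h1]
  conv_rhs => rw [← hH.eigenvectorBasis.sum_repr' u]
  rw [map_sum, inner_sum]
  simp only [vectorSpectralMeasure, FiniteMeasure.toMeasure_mk]
  rw [integral_finsetSum_measure]
  · refine Finset.sum_congr rfl fun k _ => ?_
    rw [integral_smul_measure, integral_dirac, ENNReal.toReal_ofReal (by positivity),
      map_smul, h2, inner_smul_right, inner_smul_right, hH.eigenvectorBasis.sum_repr' u,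
      ← inner_conj_symm (hH.eigenvectorBasis k) u, Complex.real_smul, Complex.ofReal_pow,
      ← Complex.conj_mul' (inner ℂ u (hH.eigenvectorBasis k))]
    ring
  · intro k _
    exact (integrable_dirac (by simp)).smul_measure ENNReal.ofReal_ne_top

end SpectralStieltjes

/-! ### The semicircle fixed point on the imaginary axis. -/

section Semicircle

/-- On the imaginary axis `m = iκ` with `κ > 0` solving `κ (η + σ² κ) = 1`. In particular `κ η ≤ 1`,
and the size of `η` yields all the smallness conditions. -/
theorem exists_semicircle_stieltjes {σ η : ℝ} (hη : 2 * (σ ^ 2 + 1) < η) :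
    ∃ m : ℂ, m.im ≠ 0 ∧ m * ((η * Complex.I) + σ ^ 2 * m) = -1 ∧ ‖m‖ ≤ 1 ∧
      ‖m‖ * (σ ^ 2 + 1) ≤ 1 / 2 ∧ σ * ‖m‖ < 1 := by
  have hη0 : 0 < η := by nlinarith [sq_nonneg σ]
  obtain ⟨κ, hκ0, hκ⟩ : ∃ κ : ℝ, 0 < κ ∧ κ * (η + σ ^ 2 * κ) = 1 := by
    set s := √(η ^ 2 + 4 * σ ^ 2) with hs
    have hs2 : s ^ 2 = η ^ 2 + 4 * σ ^ 2 := Real.sq_sqrt (by positivity)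
    have hs0 : 0 ≤ s := Real.sqrt_nonneg _
    -- The positive root in rationalized form, which remains valid for `σ = 0`.
    refine ⟨2 / (η + s), by positivity, ?_⟩
    field_simp
    linear_combination (-1 : ℝ) * hs2
  have hn : ‖(κ : ℂ) * Complex.I‖ = κ := by
    rw [norm_mul, Complex.norm_I, mul_one, Complex.norm_real, Real.norm_of_nonneg hκ0.le]
  have h1 : κ * (σ ^ 2 + 1) ≤ 1 / 2 := by
    have : κ * (2 * (σ ^ 2 + 1)) ≤ κ * η := by gcongr
    nlinarith [mul_nonneg (mul_nonneg (sq_nonneg σ) hκ0.le) hκ0.le]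
  refine ⟨κ * Complex.I, by simpa using hκ0.ne', ?_, ?_, by rwa [hn], ?_⟩
  · have h : (κ : ℂ) * (η + σ ^ 2 * κ) = 1 := by exact_mod_cast hκ
    linear_combination (Complex.I ^ 2) * h + Complex.I_sq
  · rw [hn]; nlinarith [mul_nonneg hκ0.le (sq_nonneg σ)]
  · rw [hn]
    nlinarith [mul_nonneg hκ0.le (sq_nonneg (σ - 1))]

end Semicircle

/-! ### Almost sure convergence of the spiked spectral measures. -/

section Main

variable {Ω : Type*} [MeasurableSpace Ω] {P : Measure Ω} {σ : ℝ}
  {X : (N : ℕ) → Fin N → Fin N → Ω → ℂ} {r : ℕ}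

/-- Convergence of the Stieltjes transforms of the spectral measures of the spiked matrices. -/
theorem IsWignerFamily.ae_tendsto_integral_inv_sub [IsProbabilityMeasure P] (hσ : 0 ≤ σ)
    (hX : IsWignerFamily P σ X) {b : ℕ → ℕ} {δ : ℝ} (hδ : 0 < δ) (hb : IsAdmissibleBand b δ)
    {θ : Fin r → ℝ} {a : (N : ℕ) → Fin r → EuclideanSpace ℂ (Fin N)}
    (ha : ∀ N : ℕ, r ≤ N → Orthonormal ℂ (a N)) {s : Fin r} (hθ : θ s ≠ 0) {η : ℝ}
    (hη : 2 * (σ ^ 2 + 1) < η) :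
    ∀ᵐ ω ∂P, Tendsto (fun N => ∫ x : ℝ, ((x : ℂ) - η * Complex.I)⁻¹
      ∂(vectorSpectralMeasure (hX.isHermitian_spikedMatrix b N ω θ (a N)) (a N s) : Measure ℝ))
      atTop (𝓝 (∫ x : ℝ, ((x : ℂ) - η * Complex.I)⁻¹ ∂limitMeasure σ (θ s))) := by
  obtain ⟨m, hm0, hmz, hm1, hmσ, hσm⟩ := exists_semicircle_stieltjes hη
  have hzim : ((η : ℂ) * Complex.I).im = η := by simp
  have hη1 : 1 ≤ η := by nlinarith [sq_nonneg σ]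
  have hz : 1 ≤ ((η : ℂ) * Complex.I).im := by rwa [hzim]
  have hθm : 1 + θ s * m ≠ 0 := fun h => by
    have := congrArg Complex.im h
    simp [hθ, hm0] at this
  rw [integral_limitMeasure hσ hθ (by rw [hzim]; linarith) hm0 hmz hσm]
  -- Nothing is known about `a N` for `N < r`, while the isotropic law asks for unit-ball vectors at
  -- every `N`; the default `0` does not affect the limit.
  let u : Fin r → (N : ℕ) → Fin N → ℂ := fun q N => if r ≤ N then (a N q).ofLp else 0
  have hu : ∀ q N, ∑ i, ‖u q N i‖ ^ 2 ≤ 1 := fun q N => by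
    by_cases h : r ≤ N
    · simp only [u, if_pos h]; exact sum_norm_sq_of_orthonormal (ha N h) q
    · simp [u, h]
  filter_upwards [ae_all_iff.2 fun q => hX.ae_tendsto_green hδ hb hz hm1 hmz hmσ (hu s) (hu q)]
    with ω hω
  simp only [integral_inv_sub_vectorSpectralMeasure _ _ hz]
  refine tendsto_green_spiked (fun N => randomBandMatrix_isHermitian b N fun i =>
    hX.diagonal_real N i ω) (fun N => hX.isHermitian_spikedMatrix b N ω θ (a N))
    (fun N => rfl) ha hz hθm fun q => (hω q).congr' ?_
  filter_upwards [eventually_ge_atTop r] with N hN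
  simp only [u, if_pos hN]

end Main

end SpikedBand

theorem mainTheorem6 {Ω : Type*} [MeasurableSpace Ω] (P : Measure Ω) [IsProbabilityMeasure P]
    (σ : ℝ) (hσ : 0 ≤ σ)
    (X : (N : ℕ) → Fin N → Fin N → Ω → ℂ) (hX : SpikedBand.IsWignerFamily P σ X)
    (b : ℕ → ℕ)
    (hb : ∃ ε : ℝ, 0 < ε ∧
      (fun N : ℕ => (N : ℝ) ^ ε) =o[atTop] (fun N : ℕ => (SpikedBand.bandSize b N : ℝ)))
    (r : ℕ) (θ : Fin r → ℝ) (hθ : ∀ s, θ s ≠ 0)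
    (a : (N : ℕ) → Fin r → EuclideanSpace ℂ (Fin N))
    (ha : ∀ N : ℕ, r ≤ N → Orthonormal ℂ (a N))
    (s' : Fin r) :
    ∃ μ : ProbabilityMeasure ℝ,
      (μ : Measure ℝ) = SpikedBand.limitMeasure σ (θ s') ∧
      ∀ᵐ ω ∂P, Tendsto
        (fun N : ℕ => SpikedBand.vectorSpectralMeasure
          (hX.isHermitian_spikedMatrix b N ω θ (a N)) (a N s'))
        atTop (𝓝 μ.toFiniteMeasure) := by
  obtain ⟨δ, hδ, hbδ⟩ := SpikedBand.exists_isAdmissibleBand hb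
  refine ⟨⟨SpikedBand.limitMeasure σ (θ s'),
    SpikedBand.isProbabilityMeasure_limitMeasure hσ (hθ s')⟩, rfl, ?_⟩
  set μ : ProbabilityMeasure ℝ := ⟨SpikedBand.limitMeasure σ (θ s'),
    SpikedBand.isProbabilityMeasure_limitMeasure hσ (hθ s')⟩ with hμ
  -- Restricting to rational heights leaves countably many exceptional null sets.
  filter_upwards [ae_all_iff.2 fun q : ℚ => eventually_imp_distrib_left.2
    fun hq : 2 * (σ ^ 2 + 1) < (q : ℝ) =>
      hX.ae_tendsto_integral_inv_sub hσ hδ hbδ ha (hθ s') hq] with ω hω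
  -- The spectral measure is known to have mass one only for `r ≤ N`; the finitely many other terms
  -- are set to `μ`.
  let ν : ℕ → ProbabilityMeasure ℝ := fun N => if h : r ≤ N then
    ⟨SpikedBand.vectorSpectralMeasure (hX.isHermitian_spikedMatrix b N ω θ (a N)) (a N s'),
      (SpikedBand.isSpectralMeasure_vectorSpectralMeasure _ _
        ((ha N h).1 s')).isProbabilityMeasure⟩ else μ
  have hν : ∀ N, r ≤ N → (ν N).toFiniteMeasure =
      SpikedBand.vectorSpectralMeasure (hX.isHermitian_spikedMatrix b N ω θ (a N)) (a N s') :=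
    fun N hN => by
      have : ν N = ⟨SpikedBand.vectorSpectralMeasure (hX.isHermitian_spikedMatrix b N ω θ (a N))
          (a N s'), (SpikedBand.isSpectralMeasure_vectorSpectralMeasure _ _
            ((ha N hN).1 s')).isProbabilityMeasure⟩ := dif_pos hN
      rw [this]
      exact Subtype.ext rfl
  have hlim : Tendsto ν atTop (𝓝 μ) := by
    refine SpikedBand.tendsto_of_stieltjes (η₀ := 2 * (σ ^ 2 + 1)) (by positivity) fun q hq => ?_
    refine (hω q hq).congr' ?_
    filter_upwards [eventually_ge_atTop r] with N hN
    rw [← hν N hN]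
    rfl
  refine ((ProbabilityMeasure.tendsto_nhds_iff_toFiniteMeasure_tendsto_nhds _).1 hlim).congr' ?_
  filter_upwards [eventually_ge_atTop r] with N hN
  exact hν N hN
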